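/- All Hilbert spaces are finite-dimensional, logarithms are to base $2$, $\|X\|_1=\mathrm{tr}\sqrt{X^\dagger X}$, real powers of positive operators are taken on the support, $\nu(X)$ is the number of distinct eigenvalues of $X$, $[M]=\{1,\dots,M\}$, and $|\Phi^{(M)}\rangle=M^{-1/2}\sum_{i=1}^M|i\rangle\otimes|i\rangle$, $\Phi^{(M)}=|\Phi^{(M)}\rangle\langle\Phi^{(M)}|$. **Codes.** Let $T$ be a quantum channel from $A^n$ to $B^n$. An $(M,\epsilon)^{\mathrm{CC}}$ code for $T$ consists of density operators $f(w)$ on $A^n$, $w\in[M]$, and a POVM $\{\Lambda^w\}_{w\in[M]}$ with $\frac1M\sum_w\mathrm{tr}(\Lambda^wT(f(w)))\ge1-\epsilon$; its output state is $\frac1M\sum_wT(f(w))$. An $(M,\overline M,\epsilon)^{\mathrm{CC\text{-}ES}}$ code for $T$ with a shared secret key $s$ uniform over $[S]$ ($\log S$ bits of key) consists of density operators $g_s(w)$ on $\widetilde A\otimes A^n$, $\dim\widetilde A=\overline M$, and channels $\mathcal D_s$ from $B^n$ to $W\otimes\widetilde B$, $\dim W=M$, $\dim\widetilde B=\overline M$,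 such that $$\frac1{SM}\sum_{s,w}\langle w|\,\mathrm{tr}_{\widetilde B}\,\mathcal D_s\big(T(\mathrm{tr}_{\widetilde A}\,g_s(w))\big)|w\rangle\ge1-\epsilon,\qquad \Big\|\frac1{SM}\sum_{s,w}\big(\mathrm{id}_{\widetilde A}\otimes(\mathrm{tr}_W\circ\mathcal D_s\circ T)\big)(g_s(w))-\Phi^{(\overline M)}\Big\|_1\le\epsilon;$$ its output state is $\frac1{SM}\sum_{s,w}T(\mathrm{tr}_{\widetilde A}\,g_s(w))$. **Entanglement distillation.** An $(M,L,\rho_{AB},\epsilon)^{\mathrm{ED}}$ code ($M\ge1$) consists of a channel $\mathcal E_{A\to C\widetilde A}$ whose output is always classical on $C$, $\dim C=L$, and a channel $\mathcal D_{CB\to\widetilde B}$, with $\dim\widetilde A=\dim\widetilde B=M$, such that $\|(\mathrm{id}_{\widetilde A}\otimes\mathcal D)\circ(\mathcal E\otimes\mathrm{id}_B)(\rho_{AB})-\Phi^{(M)}\|_1\le\epsilon$. Let $E_d(\rho_{AB},L,\epsilon)$ be the largest $M$ for which such a code exists ($\infty$ if $M$ is unbounded, $0$ if there is none). **Covert classical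 sub-protocol.** Fix channels $\mathcal N_{A\to B}$ (the true channel) and $\mathcal M_{A\to A}$. For density operators $f_2(w)$ on $A^{m}$, $w\in[M]$, put $\rho^w=\mathcal N^{\otimes m}(\mathcal M^{\otimes m}(f_2(w)))$. Positive integers $L$ (number of messages) and $K$ (number of key values) are called admissible for $(f_2,\zeta)$ if (a) or (b) holds. (a) $\mathcal H_A=\mathcal H_B$, $\mathcal N=\mathrm{id}_A$, $K=1$, and $$\log L\le\min_w\sup_{0<a<1}\Big[H^a(\rho^w)-\frac4a\log\frac2\zeta\Big],\qquad H^a(\rho)=-\frac1a\log\mathrm{tr}\,\rho^{a+1}.$$ (b) There are classical-quantum states $\sigma^w_{XA^{m}}=\sum_xP^w(x)|x\rangle\langle x|\otimes\tau^w_x$ ($X$ finite) whose images $\sigma^w=(\mathrm{id}_X\otimes\mathcal N^{\otimes m})(\sigma^w_{XA^{m}})=\sum_xP^w(x)|x\rangle\langle x|\otimes\sigma^{w,x}$ satisfy $\mathrm{tr}_X\sigma^w=\rho^w$ and, for all $w$, $\log L\le\log\overline M_w$ and $$\log K\ge\inf_{a<0}\Big[I^R_a(\sigma^w)+\log\nu(\rho^w)+\Big(2-\frac2a\Big)\log\frac{12}\zeta\Big]-\log\overline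 M_w+1,$$ where $$\log\overline M_w=\sup_{0<a<1}\Big[I^H_a(\sigma^w)-\frac1a\log\nu(\sigma^w_X\otimes\sigma^w_{B^{m}})-\frac4a\log\frac{12}\zeta\Big],$$ $$I^H_a(\sigma)=-\frac1a\log\mathrm{tr}\big(\sigma(\sigma_X\otimes\sigma_B)^{a/2}\sigma^{-a}(\sigma_X\otimes\sigma_B)^{a/2}\big),\qquad I^R_a(\sigma)=-\frac1a\log\sum_xP(x)\,\mathrm{tr}\big((\sigma^x)^{1-a}\sigma_B^a\big).$$ **Theorem.** Let $(f,\Lambda)$ be an $(M,\epsilon)^{\mathrm{CC}}$ code, $M\ge1$, for $\mathcal N^{\otimes n}\circ\mathcal M^{\otimes n}$ with output state $\rho^c_{B^n}$, where $n=n_1+n_2$ and $f(w)=f_1(w)\otimes f_2(w)$ with density operators $f_1(w)$ on $A^{n_1}$ and $f_2(w)$ on $A^{n_2}$. For each $w$ let $|\phi^w\rangle_{RA^{n_1}}$ be a purification of $\mathcal M^{\otimes n_1}(f_1(w))$, and let $\sigma^w_{RB^{n_1}}=(\mathrm{id}_R\otimes\mathcal N^{\otimes n_1})(|\phi^w\rangle\langle\phi^w|)$.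 Let $\zeta>0$, let $L,K$ be admissible for $(f_2,\zeta)$, and let $\overline M\ge1$ be an integer with $$\overline M\le\min_{w\in[M]}E_d\big(\sigma^w_{RB^{n_1}},L,\zeta\big).$$ Then there is an $$\Big(M,\overline M,\;2\zeta+2\sqrt{\epsilon+\zeta}+2\sqrt{\zeta+2\sqrt{\epsilon+\zeta}}\Big)^{\mathrm{CC\text{-}ES}}$$ code for the true channel $\mathcal N^{\otimes n}$, with a shared secret key of $\log L+\log K$ bits, whose output state $\rho^s_{B^n}$ satisfies $\|\rho^s_{B^n}-\rho^c_{B^n}\|_1\le\zeta$. -/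

import Mathlib

open scoped Kronecker ComplexOrder

noncomputable section

namespace QStego

variable {A B : Type*}

/-! ## Operators, states, channels

The system `A` is the Hilbert space with orthonormal basis indexed by the finite type `A`;
operators on it are matrices, `A × B` is the tensor product and `Fin n → A` is the `n`-fold
tensor power. -/

/-- Operators on the system `A`. -/
abbrev Op (A : Type*) := Matrix A A ℂ

/-- Density operators. -/
def IsDensity [Fintype A] (ρ : Op A) : Prop := ρ.PosSemidef ∧ ρ.trace = 1

/-- Trace norm `tr √(X† X)`. -/
def traceNorm [Fintype A] [DecidableEq A] (X : Op A) : ℝ :=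
  (cfc Real.sqrt (X.conjTranspose * X)).trace.re

/-- Real power of a Hermitian operator through its spectral decomposition; a nonzero power acts on
the support (`0 ^ p = 0` for `p ≠ 0`), so a negative power is a generalized inverse. -/
def rpow [Fintype A] [DecidableEq A] (X : Op A) (p : ℝ) : Op A := cfc (fun x : ℝ => x ^ p) X

/-- Number of distinct eigenvalues. -/
def numEig [Fintype A] [DecidableEq A] (X : Op A) : ℕ := (spectrum ℂ X).ncard

/-- Partial trace over the first factor. -/
def trFst [Fintype A] (X : Op (A × B)) : Op B := fun b b' => ∑ a, X (a, b) (a, b')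

/-- Partial trace over the second factor. -/
def trSnd [Fintype B] (X : Op (A × B)) : Op A := fun a a' => ∑ b, X (a, b) (a', b)

/-- `id_K ⊗ Φ`. -/
def idTensor (K : Type*) (Φ : Op A → Op B) (X : Op (K × A)) : Op (K × B) :=
  fun p q => Φ (fun a a' => X (p.1, a) (q.1, a')) p.2 q.2

/-- `Φ ⊗ id_K`. -/
def tensorId (K : Type*) (Φ : Op A → Op B) (X : Op (A × K)) : Op (B × K) :=
  fun p q => Φ (fun a a' => X (a, p.2) (a', q.2)) p.1 q.1

/-- Quantum channels: linear, completely positive, trace-preserving maps. -/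
structure IsChannel [Fintype A] [Fintype B] (Φ : Op A →ₗ[ℂ] Op B) : Prop where
  completelyPositive : ∀ (k : ℕ) (X : Op (Fin k × A)),
    X.PosSemidef → (idTensor (Fin k) Φ X).PosSemidef
  tracePreserving : ∀ X : Op A, (Φ X).trace = X.trace

/-- The `n`-fold tensor power `Φ^{⊗ n}`, given on matrix units by
`|a⟩⟨a'| ↦ ⨂ᵢ Φ(|aᵢ⟩⟨a'ᵢ|)`. -/
def tensorPow [Fintype A] [DecidableEq A] (Φ : Op A →ₗ[ℂ] Op B) (n : ℕ) :
    Op (Fin n → A) →ₗ[ℂ] Op (Fin n → B) where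
  toFun X := Matrix.of fun b b' =>
    ∑ a, ∑ a', X a a' * ∏ i, Φ (Matrix.single (a i) (a' i) 1) (b i) (b' i)
  map_add' X Y := by
    ext b b'
    simp [add_mul, Finset.sum_add_distrib]
  map_smul' c X := by
    ext b b'
    simp [Finset.mul_sum, mul_assoc]

/-- `ρ ⊗ σ` as an operator on the tensor power of order `n₁ + n₂`. -/
def appendTensor {n₁ n₂ : ℕ} (ρ : Op (Fin n₁ → A)) (σ : Op (Fin n₂ → A)) :
    Op (Fin (n₁ + n₂) → A) :=
  fun a a' =>
    ρ (fun i => a (Fin.castAdd n₂ i)) (fun i => a' (Fin.castAdd n₂ i)) *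
      σ (fun i => a (Fin.natAdd n₁ i)) (fun i => a' (Fin.natAdd n₁ i))

/-- The rank-one operator `|φ⟩⟨φ|`. -/
def ketbra (φ : A → ℂ) : Op A := Matrix.vecMulVec φ (star φ)

/-- The maximally entangled state `Φ^{(M)}`, `|Φ^{(M)}⟩ = M^{-1/2} ∑ᵢ |i⟩ ⊗ |i⟩`. -/
def maxEnt (M : ℕ) : Op (Fin M × Fin M) :=
  ketbra fun p => if p.1 = p.2 then ((1 / Real.sqrt M : ℝ) : ℂ) else 0

/-! ## Codes -/

/-- `(f, Λ)` is an `(M, ε)` classical communication code for the channel `T`. -/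
structure IsCCCode [Fintype A] [Fintype B] [DecidableEq B] (T : Op A →ₗ[ℂ] Op B) (M : ℕ)
    (f : Fin M → Op A) (Λ : Fin M → Op B) (ε : ℝ) : Prop where
  density : ∀ w, IsDensity (f w)
  povm_nonneg : ∀ w, (Λ w).PosSemidef
  povm_sum : ∑ w, Λ w = 1
  success : 1 - ε ≤ (1 / (M : ℝ)) * ∑ w, (Λ w * T (f w)).trace.re

/-- Output state of a classical communication code. -/
def ccOutput (T : Op A →ₗ[ℂ] Op B) (M : ℕ) (f : Fin M → Op A) : Op B :=
  (1 / (M : ℂ)) • ∑ w, T (f w)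

/-- `(f, D)` is an `(M, M', ε)` code for classical communication and entanglement sharing over `T`,
with a shared secret key uniformly distributed over a set of `S` elements: encoder and decoder may
depend on the key, and all quantities are averaged over it.  The first output factor of the
decoder is the classical message, the second one Bob's half of the entangled state. -/
structure IsCCESCode [Fintype A] [Fintype B] (T : Op A →ₗ[ℂ] Op B) (S M M' : ℕ)
    (f : Fin S → Fin M → Op (Fin M' × A)) (D : Fin S → Op B →ₗ[ℂ] Op (Fin M × Fin M'))
    (ε : ℝ) : Prop where
  density : ∀ s w, IsDensity (f s w)
  channel : ∀ s, IsChannel (D s)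
  message : 1 - ε ≤ (1 / ((S : ℝ) * (M : ℝ))) *
    ∑ s, ∑ w, ((trSnd (D s (T (trFst (f s w))))) w w).re
  entanglement : traceNorm ((1 / ((S : ℂ) * (M : ℂ))) •
      ∑ s, ∑ w, idTensor (Fin M') (fun Y => trFst (D s (T Y))) (f s w) - maxEnt M') ≤ ε

/-- Output state of a code for classical communication and entanglement sharing. -/
def ccesOutput (T : Op A →ₗ[ℂ] Op B) (S M M' : ℕ) (f : Fin S → Fin M → Op (Fin M' × A)) : Op B :=
  (1 / ((S : ℂ) * (M : ℂ))) • ∑ s, ∑ w, T (trFst (f s w))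

/-! ## Entanglement distillation -/

/-- The state on `Ã ⊗ B̃` obtained from `ρ` on `A ⊗ B` by Alice's encoder `E : A → C ⊗ Ã`
and, after the transmission of `C`, Bob's decoder `D : C ⊗ B → B̃`. -/
def edOutput {A' B' C : Type*} (E : Op A → Op (C × A')) (D : Op (C × B) → Op B')
    (ρ : Op (A × B)) : Op (A' × B') :=
  idTensor A' D
    (Matrix.submatrix (tensorId B E ρ) (fun p : A' × C × B => ((p.2.1, p.1), p.2.2))
      (fun p : A' × C × B => ((p.2.1, p.1), p.2.2)))

/-- `(E, D)` is an `(M, L, ρ, ε)` entanglement distillation code: the output of `E` is always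
classical on the `L`-dimensional system that is sent to Bob. -/
structure IsEDCode [Fintype A] [Fintype B] (M L : ℕ) (ρ : Op (A × B)) (ε : ℝ)
    (E : Op A →ₗ[ℂ] Op (Fin L × Fin M)) (D : Op (Fin L × B) →ₗ[ℂ] Op (Fin M)) : Prop where
  pos : 1 ≤ M
  encoder : IsChannel E
  decoder : IsChannel D
  classical : ∀ (X : Op A) (c c' : Fin L) (i j : Fin M), c ≠ c' → E X (c, i) (c', j) = 0
  error : traceNorm (edOutput E D ρ - maxEnt M) ≤ ε

/-- `E_d(ρ, L, ε)`, the largest `M` for which an `(M, L, ρ, ε)` entanglement distillation code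
exists (`⊤` if there are such codes with arbitrarily large `M`, `0` if there is none). -/
def distillable [Fintype A] [Fintype B] (ρ : Op (A × B)) (L : ℕ) (ε : ℝ) : ℕ∞ :=
  sSup {m : ℕ∞ | ∃ M : ℕ, m = M ∧ ∃ E D, IsEDCode M L ρ ε E D}

/-! ## Rényi quantities (logarithms to base 2) -/

/-- `H^a(ρ) = -(1/a) log tr ρ^{a+1}`. -/
def renyiH [Fintype A] [DecidableEq A] (a : ℝ) (ρ : Op A) : ℝ :=
  -(1 / a) * Real.logb 2 (rpow ρ (a + 1)).trace.re

/-- The cq state `∑ₓ P(x) |x⟩⟨x| ⊗ ρˣ`. -/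
def cqState {m : ℕ} (P : Fin m → ℝ) (ρ : Fin m → Op B) : Op (Fin m × B) :=
  fun p q => if p.1 = q.1 then (P p.1 : ℂ) * ρ p.1 p.2 q.2 else 0

/-- The product `ρ_X ⊗ ρ_B` of the marginals of `ρ_{XB}`. -/
def prodMarginals {m : ℕ} [Fintype B] (ρ : Op (Fin m × B)) : Op (Fin m × B) :=
  trSnd ρ ⊗ₖ trFst ρ

/-- `-(1/a) log tr (ρ_{XB} (ρ_X ⊗ ρ_B)^{a/2} ρ_{XB}^{-a} (ρ_X ⊗ ρ_B)^{a/2})`. -/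
def mutualInfoH {m : ℕ} [Fintype B] [DecidableEq B] (a : ℝ) (ρ : Op (Fin m × B)) : ℝ :=
  -(1 / a) * Real.logb 2
    (ρ * rpow (prodMarginals ρ) (a / 2) * rpow ρ (-a) * rpow (prodMarginals ρ) (a / 2)).trace.re

/-- `-(1/a) log ∑ₓ P(x) tr ((ρˣ)^{1-a} ρ_B^a)`. -/
def mutualInfoR {m : ℕ} [Fintype B] [DecidableEq B] (a : ℝ) (P : Fin m → ℝ)
    (ρ : Fin m → Op B) : ℝ :=
  -(1 / a) * Real.logb 2
    (∑ x, P x * (rpow (ρ x) (1 - a) * rpow (trFst (cqState P ρ)) a).trace.re)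

/-! ## Size and key of the covert classical sub-protocol -/

/-- Bound on the number of covert bits, noiseless channel, expected output state `ρ`:
`sup_{0<a<1} (H^a(ρ) - (4/a) log (2/ζ))`. -/
def noiselessBits [Fintype B] [DecidableEq B] (ρ : Op B) (ζ : ℝ) : EReal :=
  ⨆ a ∈ Set.Ioo (0 : ℝ) 1, ((renyiH a ρ - 4 / a * Real.logb 2 (2 / ζ) : ℝ) : EReal)

/-- Bound on the number of covert bits, general channel, output ensemble `(P, ρ)`. -/
def noisyBits {m : ℕ} [Fintype B] [DecidableEq B] (P : Fin m → ℝ) (ρ : Fin m → Op B)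
    (ζ : ℝ) : EReal :=
  ⨆ a ∈ Set.Ioo (0 : ℝ) 1,
    ((mutualInfoH a (cqState P ρ)
      - 1 / a * Real.logb 2 (numEig (prodMarginals (cqState P ρ)))
      - 4 / a * Real.logb 2 (12 / ζ) : ℝ) : EReal)

/-- Number of key bits, general channel, output ensemble `(P, ρ)`, with `ξ` the admissible trace
norm deviation of the output. -/
def noisyKeyBits {m : ℕ} [Fintype B] [DecidableEq B] (P : Fin m → ℝ) (ρ : Fin m → Op B)
    (ζ ξ : ℝ) : EReal :=
  (⨅ a ∈ Set.Iio (0 : ℝ),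
    ((mutualInfoR a P ρ + Real.logb 2 (numEig (trFst (cqState P ρ)))
      + (2 - 2 / a) * Real.logb 2 (12 / ξ) : ℝ) : EReal))
  - noisyBits P ρ ζ + 1

/-- `N` is noiseless: input and output space agree (the bases are matched by `e`) and `N` is the
identity. -/
def IsNoiseless (N : Op A →ₗ[ℂ] Op B) : Prop :=
  ∃ e : A ≃ B, ∀ X, N X = Matrix.reindex e e X

/-- `L` covert messages and a key of `K` values are admissible for the covert classical
sub-protocol with cover encoder `f` over `n` uses of `N`, when the warden expects the channel
`N ∘ 𝓜` and the tolerance is `ζ`.  Either `N` is noiseless, `K = 1` (no key), and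
`log L ≤ min_w sup_a …`; or there are, for each `w`, an ensemble `(P w, τ w)` of channel inputs
whose average output is the output expected by the warden, and `L`, `K` satisfy the rate and key
bounds of these ensembles. -/
def IsCovertSize [Fintype A] [DecidableEq A] [Fintype B] [DecidableEq B]
    (N : Op A →ₗ[ℂ] Op B) (𝓜 : Op A →ₗ[ℂ] Op A) (n M : ℕ) (f : Fin M → Op (Fin n → A)) (ζ : ℝ)
    (L K : ℕ) : Prop :=
  1 ≤ L ∧ 1 ≤ K ∧
  ((IsNoiseless N ∧ K = 1 ∧
      ∀ w, ((Real.logb 2 L : ℝ) : EReal) ≤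
        noiselessBits (tensorPow N n (tensorPow 𝓜 n (f w))) ζ) ∨
   ∃ (m : ℕ) (P : Fin M → Fin m → ℝ) (τ : Fin M → Fin m → Op (Fin n → A)),
      (∀ w x, 0 ≤ P w x) ∧ (∀ w, ∑ x, P w x = 1) ∧ (∀ w x, IsDensity (τ w x)) ∧
      (∀ w, trFst (cqState (P w) fun x => tensorPow N n (τ w x)) =
        tensorPow N n (tensorPow 𝓜 n (f w))) ∧
      (∀ w, ((Real.logb 2 L : ℝ) : EReal) ≤ noisyBits (P w) (fun x => tensorPow N n (τ w x)) ζ) ∧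
      (∀ w, noisyKeyBits (P w) (fun x => tensorPow N n (τ w x)) ζ ζ ≤
        ((Real.logb 2 K : ℝ) : EReal)))

end QStego

end

open scoped Kronecker ComplexOrder

noncomputable section

namespace QStego

open Matrix

/-! ## Tensor products of maps and completely positive maps -/

section Maps

variable {A B C D K A' B' C' D' : Type*}

/-! For each message `w`, Alice prepares the purification `φ w`, keeps `R` and sends the other part
through the first block. The output of this block is exactly what the warden expects, and Alice and
Bob now share the state `σ^w`. Distilling entanglement from it takes one classical message `c` with
`L` values, which must be hidden in the second block. It is sent as `c + s`, with `s` a uniform key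
in a group of order `L`. Then `c + s` is uniform and independent of `c`, so the mean output is the
product of the exact first block and the mean output of a covert classical code under uniform
messages and keys. If that code imitates the second block up to `ζ`, so does the whole protocol
(`OneWay.innerCode`). This gives, for each fixed `w`, an entanglement sharing code (`InnerCode`)
with output `ζ`-close to that of the cover codeword.

Bob does not know `w`. Since the output is `ζ`-close to the honest one, the cover measurement `Λ`
still finds `w` with mean error at most `ε + ζ`. Performed through square roots of its effects, it
is gentle, so the decoder for `w` can be applied afterwards (`traceNorm_gentle`,
`exists_isCCESCode`).

The covert codes are of two kinds. Over a noiseless channel the eigenvectors of the expected output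
are grouped into blocks with nearly constant eigenvalues; the message selects a part of a random
block, decoding is exact, and no key is needed (`exists_blocks`, `exists_noiseless_covertCode`).
Over a general channel a random codebook is drawn from the input ensemble. Decoding combines
Chernoff tests of the output states against their mean with a square-root measurement
(`exists_test`, `exists_sqrt_measurement`). Covertness follows from a second moment estimate for
truncated output states, which pinching shows to be dominated by a multiple of the mean
(`exists_truncation`, `expect_traceNorm_avg_sub_le`). Local randomness of Alice, of size `R`, fills
the gap between `L` and the number of codewords that can be packed (`exists_multiplicity`).

One further point: `E_d` is a supremum, so a distillation code may produce a maximally entangled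
state larger than the required one, and local operations alone shrink it only approximately. In the
noiseless case the covert code also transmits entanglement of dimension about `1/ζ`, which makes the
local error small. In the noisy case about `1/ζ²` additional message values coordinate the shrinking
(`oneWay_maxEnt`); they are paid for out of the key, which `sq_le_key` shows to be large enough, and
leftover key values carry only the cover.

The inner error is at most `7ζ` once `ζ ≤ 1/16`. Otherwise the claimed error is at least `2` and the
cover itself is a code. -/

/-- `idTensor` as a linear map. -/
def idTensorL (K : Type*) (Φ : Op A →ₗ[ℂ] Op B) : Op (K × A) →ₗ[ℂ] Op (K × B) where
  toFun := idTensor K Φ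
  map_add' X Y := by
    ext p q
    exact congrFun (congrFun (map_add Φ (fun a a' => X (p.1, a) (q.1, a') : Op A)
      (fun a a' => Y (p.1, a) (q.1, a') : Op A)) p.2) q.2
  map_smul' c X := by
    ext p q
    exact congrFun (congrFun (map_smul Φ c (fun a a' => X (p.1, a) (q.1, a') : Op A)) p.2) q.2

/-- `tensorId` as a linear map. -/
def tensorIdL (K : Type*) (Φ : Op A →ₗ[ℂ] Op B) : Op (A × K) →ₗ[ℂ] Op (B × K) where
  toFun := tensorId K Φ
  map_add' X Y := by
    ext p q
    exact congrFun (congrFun (map_add Φ (fun a a' => X (a, p.2) (a', q.2) : Op A)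
      (fun a a' => Y (a, p.2) (a', q.2) : Op A)) p.1) q.1
  map_smul' c X := by
    ext p q
    exact congrFun (congrFun (map_smul Φ c (fun a a' => X (a, p.2) (a', q.2) : Op A)) p.1) q.1

/-- The tensor product `Φ ⊗ Ψ` of two linear maps. -/
def mapTensor (Φ : Op A →ₗ[ℂ] Op B) (Ψ : Op C →ₗ[ℂ] Op D) : Op (A × C) →ₗ[ℂ] Op (B × D) :=
  tensorIdL D Φ ∘ₗ idTensorL A Ψ

lemma mapTensor_kronecker (Φ : Op A →ₗ[ℂ] Op B) (Ψ : Op C →ₗ[ℂ] Op D) (X : Op A) (Y : Op C) :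
    mapTensor Φ Ψ (X ⊗ₖ Y) = Φ X ⊗ₖ Ψ Y := by
  have h1 : idTensorL A Ψ (X ⊗ₖ Y) = X ⊗ₖ Ψ Y := by
    ext p q
    change Ψ (X p.1 q.1 • Y) p.2 q.2 = _
    simp [kroneckerMap_apply]
  have h2 : tensorIdL D Φ (X ⊗ₖ Ψ Y) = Φ X ⊗ₖ Ψ Y := by
    ext p q
    have : (fun a a' => (X ⊗ₖ Ψ Y) (a, p.2) (a', q.2)) = Ψ Y p.2 q.2 • X := by
      ext a a'; simp [kroneckerMap_apply, mul_comm]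
    change Φ (fun a a' => (X ⊗ₖ Ψ Y) (a, p.2) (a', q.2)) p.1 q.1 = _
    rw [this]
    simp [kroneckerMap_apply, mul_comm]
  simp only [mapTensor, LinearMap.comp_apply, h1, h2]

lemma op_ext {V : Type*} [AddCommMonoid V] [Module ℂ V] [Finite A] [DecidableEq A]
    {f g : Op A →ₗ[ℂ] V} (h : ∀ a a', f (Matrix.single a a' 1) = g (Matrix.single a a' 1)) :
    f = g := by
  have := Fintype.ofFinite A
  ext X
  rw [Matrix.matrix_eq_sum_single X]
  simp only [map_sum]
  refine Finset.sum_congr rfl fun i _ => Finset.sum_congr rfl fun j _ => ?_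
  have : Matrix.single i j (X i j) = X i j • Matrix.single i j (1 : ℂ) := by simp
  rw [this, map_smul, map_smul, h]

/-- Matrix units of a composite system are Kronecker products. Identities between tensored maps are
reduced to product operators in this way throughout. -/
lemma kronecker_ext {V : Type*} [AddCommMonoid V] [Module ℂ V] [Finite A] [Finite C]
    {f g : Op (A × C) →ₗ[ℂ] V} (h : ∀ (X : Op A) (Y : Op C), f (X ⊗ₖ Y) = g (X ⊗ₖ Y)) :
    f = g := by
  classical
  refine op_ext fun a a' => ?_
  have : Matrix.single a a' (1 : ℂ) =
      Matrix.single a.1 a'.1 (1 : ℂ) ⊗ₖ Matrix.single a.2 a'.2 (1 : ℂ) := by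
    rw [Matrix.single_kronecker_single]; simp
  rw [this, h]

lemma mapTensor_comp [Finite A] [Finite C] (Φ' : Op B →ₗ[ℂ] Op B') (Ψ' : Op D →ₗ[ℂ] Op D')
    (Φ : Op A →ₗ[ℂ] Op B) (Ψ : Op C →ₗ[ℂ] Op D) :
    mapTensor (Φ' ∘ₗ Φ) (Ψ' ∘ₗ Ψ) = mapTensor Φ' Ψ' ∘ₗ mapTensor Φ Ψ :=
  kronecker_ext fun X Y => by simp [mapTensor_kronecker]

lemma mapTensor_sum_left {ι : Type*} [Finite A] [Finite C] (s : Finset ι)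
    (Φ : ι → Op A →ₗ[ℂ] Op B) (Ψ : Op C →ₗ[ℂ] Op D) :
    mapTensor (∑ i ∈ s, Φ i) Ψ = ∑ i ∈ s, mapTensor (Φ i) Ψ :=
  kronecker_ext fun X Y => by
    simp only [mapTensor_kronecker, LinearMap.sum_apply]
    ext p q
    simp [Matrix.sum_apply, Finset.sum_mul]

lemma mapTensor_sum_right {ι : Type*} [Finite A] [Finite C] (s : Finset ι)
    (Φ : Op A →ₗ[ℂ] Op B) (Ψ : ι → Op C →ₗ[ℂ] Op D) :
    mapTensor Φ (∑ i ∈ s, Ψ i) = ∑ i ∈ s, mapTensor Φ (Ψ i) :=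
  kronecker_ext fun X Y => by
    simp only [mapTensor_kronecker, LinearMap.sum_apply]
    ext p q
    simp [Matrix.sum_apply, Finset.mul_sum]

lemma idTensor_eq_mapTensor (Φ : Op A →ₗ[ℂ] Op B) (X : Op (K × A)) :
    idTensor K Φ X = mapTensor LinearMap.id Φ X := rfl

lemma tensorId_eq_mapTensor (Φ : Op A →ₗ[ℂ] Op B) (X : Op (A × K)) :
    tensorId K Φ X = mapTensor Φ LinearMap.id X := rfl

/-- The partial trace over the first factor as a linear map. -/
def trFstL [Fintype A] : Op (A × B) →ₗ[ℂ] Op B where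
  toFun := trFst
  map_add' X Y := by ext b b'; simp [trFst, Finset.sum_add_distrib]
  map_smul' c X := by ext b b'; simp [trFst, Finset.mul_sum]

/-- The partial trace over the second factor as a linear map. -/
def trSndL [Fintype B] : Op (A × B) →ₗ[ℂ] Op A where
  toFun := trSnd
  map_add' X Y := by ext b b'; simp [trSnd, Finset.sum_add_distrib]
  map_smul' c X := by ext b b'; simp [trSnd, Finset.mul_sum]

lemma trFst_kronecker [Fintype A] (X : Op A) (Y : Op B) : trFst (X ⊗ₖ Y) = X.trace • Y := by
  ext b b'; simp [trFst, kroneckerMap_apply, Matrix.trace, Finset.sum_mul]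

lemma trSnd_kronecker [Fintype B] (X : Op A) (Y : Op B) : trSnd (X ⊗ₖ Y) = Y.trace • X := by
  ext b b'; simp [trSnd, kroneckerMap_apply, Matrix.trace, mul_comm, Finset.mul_sum]

lemma trace_trFst [Fintype A] [Fintype B] (X : Op (A × B)) : (trFst X).trace = X.trace := by
  simp only [Matrix.trace, trFst, Matrix.diag, Fintype.sum_prod_type]
  exact Finset.sum_comm

lemma trace_trSnd [Fintype A] [Fintype B] (X : Op (A × B)) : (trSnd X).trace = X.trace := by
  simp only [Matrix.trace, trSnd, Matrix.diag, Fintype.sum_prod_type]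

/-- `X ↦ V X V†`. -/
def conjMap [Fintype A] (V : Matrix B A ℂ) : Op A →ₗ[ℂ] Op B where
  toFun X := V * X * Vᴴ
  map_add' X Y := by simp [Matrix.mul_add, Matrix.add_mul]
  map_smul' c X := by simp

@[simp] lemma conjMap_apply [Fintype A] (V : Matrix B A ℂ) (X : Op A) :
    conjMap V X = V * X * Vᴴ := rfl

/-- Completely positive maps, through Kraus operators. -/
def CP [Fintype A] (Φ : Op A →ₗ[ℂ] Op B) : Prop :=
  ∃ (r : ℕ) (V : Fin r → Matrix B A ℂ), Φ = ∑ i, conjMap (V i)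

/-- Trace-preserving maps. -/
def TP [Fintype A] [Fintype B] (Φ : Op A →ₗ[ℂ] Op B) : Prop := ∀ X, (Φ X).trace = X.trace

lemma CP.of_kraus {ι : Type*} [Fintype A] [Fintype ι] {Φ : Op A →ₗ[ℂ] Op B}
    (V : ι → Matrix B A ℂ) (h : Φ = ∑ i, conjMap (V i)) : CP Φ := by
  refine ⟨Fintype.card ι, fun i => V ((Fintype.equivFin ι).symm i), ?_⟩
  rw [h]
  exact (Equiv.sum_comp (Fintype.equivFin ι).symm fun i => conjMap (V i)).symm

lemma CP.conj [Fintype A] (V : Matrix B A ℂ) : CP (conjMap V) :=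
  CP.of_kraus (fun _ : Unit => V) (by simp)

lemma CP.id [Fintype A] : CP (LinearMap.id : Op A →ₗ[ℂ] Op A) := by
  classical
  exact CP.of_kraus (fun _ : Unit => 1) (by ext; simp)

lemma CP.sum {ι : Type*} [Fintype A] [Fintype ι] {Φ : ι → Op A →ₗ[ℂ] Op B}
    (h : ∀ i, CP (Φ i)) : CP (∑ i, Φ i) := by
  choose r V hV using h
  refine CP.of_kraus (ι := Σ i, Fin (r i)) (fun x => V x.1 x.2) ?_
  rw [Fintype.sum_sigma]
  exact Finset.sum_congr rfl fun i _ => hV i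

lemma CP.comp [Fintype A] [Fintype B] {Φ : Op A →ₗ[ℂ] Op B} {Ψ : Op B →ₗ[ℂ] Op C}
    (hΨ : CP Ψ) (hΦ : CP Φ) : CP (Ψ ∘ₗ Φ) := by
  obtain ⟨r, V, rfl⟩ := hΦ
  obtain ⟨s, W, rfl⟩ := hΨ
  refine CP.of_kraus (ι := Fin s × Fin r) (fun x => W x.1 * V x.2) ?_
  ext1 X
  simp only [LinearMap.comp_apply, LinearMap.sum_apply, conjMap_apply, Fintype.sum_prod_type,
    Matrix.mul_sum, Matrix.sum_mul, Matrix.conjTranspose_mul, Matrix.mul_assoc]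

lemma mapTensor_conjMap [Fintype A] [Fintype C] (V : Matrix B A ℂ) (W : Matrix D C ℂ) :
    mapTensor (conjMap V) (conjMap W) = conjMap (V ⊗ₖ W) :=
  kronecker_ext fun X Y => by
    simp [mapTensor_kronecker, Matrix.mul_kronecker_mul, Matrix.conjTranspose_kronecker]

lemma CP.mapTensor [Fintype A] [Fintype C] {Φ : Op A →ₗ[ℂ] Op B} {Ψ : Op C →ₗ[ℂ] Op D}
    (hΦ : CP Φ) (hΨ : CP Ψ) : CP (mapTensor Φ Ψ) := by
  obtain ⟨r, V, rfl⟩ := hΦ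
  obtain ⟨s, W, rfl⟩ := hΨ
  rw [mapTensor_sum_left]
  refine CP.sum fun i => ?_
  rw [mapTensor_sum_right]
  refine CP.sum fun j => ?_
  rw [mapTensor_conjMap]
  exact CP.conj _

lemma CP.posSemidef [Fintype A] [Fintype B] {Φ : Op A →ₗ[ℂ] Op B} (hΦ : CP Φ) {X : Op A}
    (hX : X.PosSemidef) : (Φ X).PosSemidef := by
  obtain ⟨r, V, rfl⟩ := hΦ
  simp only [LinearMap.sum_apply, conjMap_apply]
  exact Matrix.posSemidef_sum _ fun i _ => hX.mul_mul_conjTranspose_same (V i)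

lemma CP.isHermitian [Fintype A] [Fintype B] {Φ : Op A →ₗ[ℂ] Op B} (hΦ : CP Φ) {X : Op A}
    (hX : X.IsHermitian) : (Φ X).IsHermitian := by
  obtain ⟨r, V, rfl⟩ := hΦ
  simp only [LinearMap.sum_apply, conjMap_apply, Matrix.IsHermitian, Matrix.conjTranspose_sum,
    Matrix.conjTranspose_mul, Matrix.conjTranspose_conjTranspose, hX.eq, Matrix.mul_assoc]

lemma TP.id [Fintype A] : TP (LinearMap.id : Op A →ₗ[ℂ] Op A) := fun _ => rfl

lemma TP.comp [Fintype A] [Fintype B] [Fintype C] {Φ : Op A →ₗ[ℂ] Op B} {Ψ : Op B →ₗ[ℂ] Op C}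
    (hΨ : TP Ψ) (hΦ : TP Φ) : TP (Ψ ∘ₗ Φ) := fun X => by
  rw [LinearMap.comp_apply, hΨ, hΦ]

/-- No signalling: a trace-preserving map on one side does not influence the weights of outcomes on
the other side. -/
lemma trace_mapTensor_of_right [Fintype A] [Fintype B] [Fintype C] [Fintype D]
    (Φ : Op A →ₗ[ℂ] Op B) {Ψ : Op C →ₗ[ℂ] Op D} (hΨ : TP Ψ) (X : Op (A × C)) :
    (mapTensor Φ Ψ X).trace = (Φ (trSnd X)).trace := by
  have : Matrix.traceLinearMap _ ℂ ℂ ∘ₗ mapTensor Φ Ψ =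
      Matrix.traceLinearMap _ ℂ ℂ ∘ₗ Φ ∘ₗ trSndL :=
    kronecker_ext fun X Y => by
      simp only [LinearMap.comp_apply, Matrix.traceLinearMap_apply, mapTensor_kronecker,
        Matrix.trace_kronecker, hΨ Y]
      change _ = (Φ (trSnd _)).trace
      rw [trSnd_kronecker, map_smul, Matrix.trace_smul, smul_eq_mul, mul_comm]
  exact LinearMap.congr_fun this X

lemma TP.mapTensor [Fintype A] [Fintype B] [Fintype C] [Fintype D]
    {Φ : Op A →ₗ[ℂ] Op B} {Ψ : Op C →ₗ[ℂ] Op D} (hΦ : TP Φ) (hΨ : TP Ψ) :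
    TP (mapTensor Φ Ψ) := fun X => by
  rw [trace_mapTensor_of_right Φ hΨ, hΦ, trace_trSnd]

lemma trFst_mapTensor [Fintype A] [Fintype B] [Fintype C] [Fintype D]
    {Φ : Op A →ₗ[ℂ] Op B} (hΦ : TP Φ) (Ψ : Op C →ₗ[ℂ] Op D) (X : Op (A × C)) :
    trFst (mapTensor Φ Ψ X) = Ψ (trFst X) := by
  have : trFstL ∘ₗ QStego.mapTensor Φ Ψ = Ψ ∘ₗ trFstL :=
    kronecker_ext fun X Y => by
      change trFst (QStego.mapTensor Φ Ψ _) = Ψ (trFst _)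
      rw [mapTensor_kronecker, trFst_kronecker, trFst_kronecker, hΦ, map_smul]
  exact LinearMap.congr_fun this X

lemma trFst_idTensor [Fintype A] [Fintype K] (Φ : Op A →ₗ[ℂ] Op B) (X : Op (K × A)) :
    trFst (idTensor K Φ X) = Φ (trFst X) := by
  have : trFst X = ∑ k, (Matrix.of fun a a' => X (k, a) (k, a') : Op A) := by
    ext a a'; simp [trFst, Matrix.sum_apply]
  rw [this, map_sum]
  ext b b'
  rw [Matrix.sum_apply]
  rfl

lemma CP.trFstL [Fintype A] [Fintype B] : CP (trFstL : Op (A × B) →ₗ[ℂ] Op B) := by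
  classical
  refine CP.of_kraus (ι := A) (fun a => Matrix.of fun b p => if p = (a, b) then 1 else 0) ?_
  ext X b b'
  simp only [QStego.trFstL, LinearMap.coe_mk, AddHom.coe_mk, trFst, LinearMap.sum_apply,
    Matrix.sum_apply, conjMap_apply, Matrix.mul_apply, Matrix.of_apply,
    Matrix.conjTranspose_apply]
  refine Finset.sum_congr rfl fun a _ => ?_
  simp [apply_ite]

lemma CP.trSndL [Fintype A] [Fintype B] : CP (trSndL : Op (A × B) →ₗ[ℂ] Op A) := by
  classical
  refine CP.of_kraus (ι := B) (fun b => Matrix.of fun a p => if p = (a, b) then 1 else 0) ?_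
  ext X b b'
  simp only [QStego.trSndL, LinearMap.coe_mk, AddHom.coe_mk, trSnd, LinearMap.sum_apply,
    Matrix.sum_apply, conjMap_apply, Matrix.mul_apply, Matrix.of_apply,
    Matrix.conjTranspose_apply]
  refine Finset.sum_congr rfl fun a _ => ?_
  simp [apply_ite]

/-- Relabelling of the basis as a linear map. -/
def reindexL (e : A ≃ B) : Op A →ₗ[ℂ] Op B := (Matrix.reindexLinearEquiv ℂ ℂ e e).toLinearMap

@[simp] lemma reindexL_apply (e : A ≃ B) (X : Op A) (b b' : B) :
    reindexL e X b b' = X (e.symm b) (e.symm b') := rfl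

lemma CP.reindexL [Fintype A] (e : A ≃ B) : CP (reindexL e) := by
  classical
  refine CP.of_kraus (fun _ : Unit => Matrix.of fun b a => if a = e.symm b then 1 else 0) ?_
  ext X b b'
  simp [Matrix.mul_apply, apply_ite]

lemma TP.reindexL [Fintype A] [Fintype B] (e : A ≃ B) : TP (reindexL e) := fun X => by
  simp only [Matrix.trace, Matrix.diag, reindexL_apply]
  exact Equiv.sum_comp e.symm fun a => X a a

/-- Tensoring with a fixed operator on the left. -/
def kronL (Z : Op K) : Op A →ₗ[ℂ] Op (K × A) where
  toFun X := Z ⊗ₖ X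
  map_add' X Y := by simp [Matrix.kronecker_add]
  map_smul' c X := by simp [Matrix.kronecker_smul]

lemma CP.kronL [Fintype A] [Fintype K] {Z : Op K} (hZ : Z.PosSemidef) :
    CP (kronL (A := A) Z) := by
  classical
  obtain ⟨Y, rfl⟩ : ∃ Y : Op K, Z = Yᴴ * Y := by
    open scoped MatrixOrder in
    exact CStarAlgebra.nonneg_iff_eq_star_mul_self.mp hZ.nonneg
  refine CP.of_kraus (ι := K)
    (fun k => Matrix.of fun p a => if p.2 = a then star (Y k p.1) else 0) ?_
  ext X p q
  simp only [QStego.kronL, LinearMap.coe_mk, AddHom.coe_mk, kroneckerMap_apply,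
    LinearMap.sum_apply, Matrix.sum_apply, conjMap_apply, Matrix.mul_apply, Matrix.of_apply,
    Matrix.conjTranspose_apply, Finset.sum_mul]
  refine Finset.sum_congr rfl fun k _ => ?_
  simp [apply_ite, mul_comm, mul_left_comm]

/-- Choi's theorem: channels have Kraus operators. -/
lemma IsChannel.cp [Fintype A] [Fintype B] {Φ : Op A →ₗ[ℂ] Op B} (h : IsChannel Φ) : CP Φ := by
  classical
  let e := Fintype.equivFin A
  -- The unnormalized maximally entangled vector. The blocks of its projector are the matrix units,
  -- so its image is the Choi matrix, and a factorization of that positive matrix gives the Kraus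
  -- operators.
  let v : Fin (Fintype.card A) × A → ℂ := fun p => if p.1 = e p.2 then 1 else 0
  have hv := h.completelyPositive _ _ (Matrix.posSemidef_vecMulVec_self_star v)
  obtain ⟨Y, hY⟩ : ∃ Y, idTensor (Fin (Fintype.card A)) Φ (vecMulVec v (star v)) = Yᴴ * Y := by
    open scoped MatrixOrder in
    exact CStarAlgebra.nonneg_iff_eq_star_mul_self.mp hv.nonneg
  refine CP.of_kraus (fun i => Matrix.of fun b a => star (Y i (e a, b))) ?_
  refine op_ext fun a a' => ?_
  ext b b'
  have h1 := congrFun (congrFun hY (e a, b)) (e a', b')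
  have h2 : (fun c c' => vecMulVec v (star v) (e a, c) (e a', c')) = Matrix.single a a' (1 : ℂ) := by
    ext c c'
    by_cases h1 : a = c <;> by_cases h2 : a' = c' <;>
      simp [vecMulVec_apply, v, h1, h2]
  simp only [idTensor, h2] at h1
  rw [h1]
  simp only [LinearMap.sum_apply, Matrix.sum_apply, conjMap_apply, Matrix.mul_apply,
    Matrix.of_apply, Matrix.conjTranspose_apply, star_star]
  refine Finset.sum_congr rfl fun i _ => ?_
  rw [Finset.sum_eq_single a' (by intro x _ hx; simp [Ne.symm hx]) (by simp),
    Finset.sum_eq_single a (by intro x _ hx; simp [Ne.symm hx]) (by simp)]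
  simp

lemma CP.isChannel [Fintype A] [Fintype B] {Φ : Op A →ₗ[ℂ] Op B} (h : CP Φ) (h' : TP Φ) :
    IsChannel Φ where
  completelyPositive k X hX := by
    rw [idTensor_eq_mapTensor]
    exact (CP.id.mapTensor h).posSemidef hX
  tracePreserving := h'

lemma IsChannel.tp [Fintype A] [Fintype B] {Φ : Op A →ₗ[ℂ] Op B} (h : IsChannel Φ) : TP Φ :=
  h.tracePreserving

lemma IsChannel.comp [Fintype A] [Fintype B] [Fintype C] {Φ : Op A →ₗ[ℂ] Op B}
    {Ψ : Op B →ₗ[ℂ] Op C} (hΨ : IsChannel Ψ) (hΦ : IsChannel Φ) : IsChannel (Ψ ∘ₗ Φ) :=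
  (hΨ.cp.comp hΦ.cp).isChannel (hΨ.tp.comp hΦ.tp)

lemma IsChannel.isDensity [Fintype A] [Fintype B] {Φ : Op A →ₗ[ℂ] Op B} (h : IsChannel Φ)
    {X : Op A} (hX : IsDensity X) : IsDensity (Φ X) :=
  ⟨h.cp.posSemidef hX.1, (h.tp X).trans hX.2⟩

/-! ### Tensor powers -/

lemma tensorPow_single [Fintype A] [DecidableEq A] (Φ : Op A →ₗ[ℂ] Op B) (n : ℕ)
    (a a' : Fin n → A) (b b' : Fin n → B) :
    tensorPow Φ n (Matrix.single a a' 1) b b' =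
      ∏ i, Φ (Matrix.single (a i) (a' i) 1) (b i) (b' i) := by
  simp only [tensorPow, LinearMap.coe_mk, AddHom.coe_mk, Matrix.of_apply]
  rw [Finset.sum_eq_single a (by
      intro x _ hx
      exact Finset.sum_eq_zero fun y _ => by simp [Ne.symm hx]) (by simp),
    Finset.sum_eq_single a' (by intro x _ hx; simp [Ne.symm hx]) (by simp)]
  simp

lemma mul_single_mul_conjTranspose [Fintype A] [DecidableEq A] (W : Matrix B A ℂ) (a a' : A)
    (b b' : B) : (W * Matrix.single a a' (1 : ℂ) * Wᴴ) b b' = W b a * star (W b' a') := by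
  simp only [Matrix.mul_apply, Matrix.conjTranspose_apply]
  rw [Finset.sum_eq_single a' (by intro x _ hx; simp [Ne.symm hx]) (by simp),
    Finset.sum_eq_single a (by intro x _ hx; simp [Ne.symm hx]) (by simp)]
  simp

/-- The Kraus operators are the tensor products of those of `Φ`, indexed by tuples; on matrix units
this is the expansion of a product of sums. -/
lemma CP.tensorPow [Fintype A] [DecidableEq A] {Φ : Op A →ₗ[ℂ] Op B} (h : CP Φ)
    (n : ℕ) : CP (tensorPow Φ n) := by
  obtain ⟨r, V, rfl⟩ := h
  refine CP.of_kraus (ι := Fin n → Fin r)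
    (fun j => Matrix.of fun b a => ∏ i, V (j i) (b i) (a i)) ?_
  refine op_ext fun a a' => ?_
  ext b b'
  rw [tensorPow_single]
  simp only [LinearMap.sum_apply, Matrix.sum_apply, conjMap_apply, mul_single_mul_conjTranspose]
  rw [Finset.prod_univ_sum]
  simp only [Fintype.piFinset_univ, Matrix.of_apply, star_prod, Finset.prod_mul_distrib]

lemma TP.tensorPow [Fintype A] [DecidableEq A] [Fintype B] [DecidableEq B]
    {Φ : Op A →ₗ[ℂ] Op B} (h : TP Φ) (n : ℕ) : TP (tensorPow Φ n) := by
  have : Matrix.traceLinearMap _ ℂ ℂ ∘ₗ QStego.tensorPow Φ n = Matrix.traceLinearMap _ ℂ ℂ := by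
    refine op_ext fun a a' => ?_
    simp only [LinearMap.comp_apply, Matrix.traceLinearMap_apply, Matrix.trace, Matrix.diag,
      tensorPow_single]
    have h2 := Finset.prod_univ_sum (fun _ : Fin n => (Finset.univ : Finset B))
      (fun i b => Φ (Matrix.single (a i) (a' i) 1) b b)
    rw [Fintype.piFinset_univ] at h2
    rw [← h2]
    have h3 : ∀ i, ∑ b, Φ (Matrix.single (a i) (a' i) 1) b b =
        if a i = a' i then 1 else 0 := by
      intro i
      have := h (Matrix.single (a i) (a' i) 1)
      rw [Matrix.trace] at this
      simp only [Matrix.diag] at this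
      rw [this]
      split_ifs with h5
      · rw [h5]; simp
      · simp [Matrix.trace_single_eq_of_ne _ _ _ h5]
    simp only [h3]
    by_cases h4 : a = a'
    · subst h4
      simp [Matrix.single_apply]
    · obtain ⟨i, hi⟩ := Function.ne_iff.mp h4
      rw [Finset.prod_eq_zero (Finset.mem_univ i) (by simp [hi])]
      symm
      refine Finset.sum_eq_zero fun x _ => ?_
      simp only [Matrix.single_apply]
      rw [if_neg]
      rintro ⟨h5, h6⟩
      exact h4 (h5.trans h6.symm)
  intro X
  exact LinearMap.congr_fun this X

lemma IsChannel.tensorPow [Fintype A] [DecidableEq A] [Fintype B] [DecidableEq B]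
    {Φ : Op A →ₗ[ℂ] Op B} (h : IsChannel Φ) (n : ℕ) : IsChannel (tensorPow Φ n) :=
  (h.cp.tensorPow n).isChannel (h.tp.tensorPow n)

/-- The splitting of the tensor power of order `n₁ + n₂`. -/
def splitEquiv (A : Type*) (n₁ n₂ : ℕ) : (Fin n₁ → A) × (Fin n₂ → A) ≃ (Fin (n₁ + n₂) → A) :=
  Fin.appendEquiv n₁ n₂

lemma splitEquiv_symm_apply (n₁ n₂ : ℕ) (a : Fin (n₁ + n₂) → A) :
    (splitEquiv A n₁ n₂).symm a =
      (fun i => a (Fin.castAdd n₂ i), fun i => a (Fin.natAdd n₁ i)) := rfl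

/-- This lets the two blocks of channel uses be treated as two separate channels `T₁` and `T₂`. -/
lemma tensorPow_split [Fintype A] [DecidableEq A] (Φ : Op A →ₗ[ℂ] Op B)
    (n₁ n₂ : ℕ) :
    tensorPow Φ (n₁ + n₂) ∘ₗ reindexL (splitEquiv A n₁ n₂) =
      reindexL (splitEquiv B n₁ n₂) ∘ₗ mapTensor (tensorPow Φ n₁) (tensorPow Φ n₂) := by
  refine op_ext fun a a' => ?_
  have h1 : Matrix.single a a' (1 : ℂ) =
      Matrix.single a.1 a'.1 (1 : ℂ) ⊗ₖ Matrix.single a.2 a'.2 (1 : ℂ) := by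
    rw [Matrix.single_kronecker_single]; simp
  have h2 : reindexL (splitEquiv A n₁ n₂) (Matrix.single a a' (1 : ℂ)) =
      Matrix.single (splitEquiv A n₁ n₂ a) (splitEquiv A n₁ n₂ a') 1 := by
    ext x y
    simp [Matrix.single_apply, Equiv.eq_symm_apply]
  ext b b'
  rw [LinearMap.comp_apply, h2, tensorPow_single, LinearMap.comp_apply, h1, mapTensor_kronecker,
    reindexL_apply, kroneckerMap_apply, tensorPow_single, tensorPow_single, Fin.prod_univ_add]
  obtain ⟨a1, a2⟩ := a
  obtain ⟨a1', a2'⟩ := a'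
  simp [splitEquiv, Fin.appendEquiv]

lemma appendTensor_eq {n₁ n₂ : ℕ} (ρ : Op (Fin n₁ → A)) (σ : Op (Fin n₂ → A)) :
    appendTensor ρ σ = reindexL (splitEquiv A n₁ n₂) (ρ ⊗ₖ σ) := rfl

end Maps

/-! ## Functional calculus and trace norm -/

section TraceNorm

variable {A B ι : Type*} [Fintype A] [Fintype B] [Fintype ι]

/-- The diagonal matrix with real entries `d`. -/
abbrev rdiag [DecidableEq ι] (d : ι → ℝ) : Op ι := Matrix.diagonal fun i => (d i : ℂ)

omit [Fintype ι] in
lemma posSemidef_rdiag [DecidableEq ι] {d : ι → ℝ} (hd : ∀ i, 0 ≤ d i) :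
    (rdiag d).PosSemidef :=
  Matrix.PosSemidef.diagonal fun i => by
    exact Complex.zero_le_real.mpr (hd i)

lemma posSemidef_conj_rdiag [DecidableEq ι] (U : Matrix A ι ℂ) {d : ι → ℝ} (hd : ∀ i, 0 ≤ d i) :
    (U * rdiag d * Uᴴ).PosSemidef :=
  (posSemidef_rdiag hd).mul_mul_conjTranspose_same U

omit [Fintype A] in
lemma isHermitian_conj_rdiag [DecidableEq ι] (U : Matrix A ι ℂ) (d : ι → ℝ) :
    (U * rdiag d * Uᴴ).IsHermitian := by
  refine Matrix.isHermitian_mul_mul_conjTranspose U ?_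
  rw [Matrix.IsHermitian, Matrix.diagonal_conjTranspose]
  congr 1
  ext i
  simp

lemma cfc_eq_conj_rdiag [DecidableEq A] {X : Op A} (hX : X.IsHermitian) (f : ℝ → ℝ) :
    cfc f X = (hX.eigenvectorUnitary : Matrix A A ℂ) * rdiag (fun i => f (hX.eigenvalues i)) *
      (hX.eigenvectorUnitary : Matrix A A ℂ)ᴴ := by
  rw [hX.cfc_eq f, Matrix.IsHermitian.cfc, Unitary.conjStarAlgAut_apply]
  rfl

lemma eigenvectorUnitary_conjTranspose_mul [DecidableEq A] {X : Op A} (hX : X.IsHermitian) :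
    (hX.eigenvectorUnitary : Matrix A A ℂ)ᴴ * (hX.eigenvectorUnitary : Matrix A A ℂ) = 1 :=
  Unitary.coe_star_mul_self hX.eigenvectorUnitary

lemma eigenvectorUnitary_mul_conjTranspose [DecidableEq A] {X : Op A} (hX : X.IsHermitian) :
    (hX.eigenvectorUnitary : Matrix A A ℂ) * (hX.eigenvectorUnitary : Matrix A A ℂ)ᴴ = 1 :=
  Unitary.coe_mul_star_self hX.eigenvectorUnitary

lemma eq_conj_rdiag_eigenvalues [DecidableEq A] {X : Op A} (hX : X.IsHermitian) :
    X = (hX.eigenvectorUnitary : Matrix A A ℂ) * rdiag hX.eigenvalues *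
      (hX.eigenvectorUnitary : Matrix A A ℂ)ᴴ := by
  have h := cfc_eq_conj_rdiag hX id
  rwa [cfc_id ℝ X hX.isSelfAdjoint] at h

lemma conj_mul_conj [DecidableEq ι] {U : Matrix A ι ℂ} (hU : Uᴴ * U = 1) (X Y : Op ι) :
    U * X * Uᴴ * (U * Y * Uᴴ) = U * (X * Y) * Uᴴ := by
  calc U * X * Uᴴ * (U * Y * Uᴴ) = U * X * (Uᴴ * U) * Y * Uᴴ := by simp only [Matrix.mul_assoc]
    _ = _ := by rw [hU, Matrix.mul_one]; simp only [Matrix.mul_assoc]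

lemma conj_rdiag_mul [DecidableEq ι] {U : Matrix A ι ℂ} (hU : Uᴴ * U = 1) (c d : ι → ℝ) :
    U * rdiag c * Uᴴ * (U * rdiag d * Uᴴ) = U * rdiag (fun i => c i * d i) * Uᴴ := by
  rw [conj_mul_conj hU, Matrix.diagonal_mul_diagonal]
  simp only [rdiag, Complex.ofReal_mul]

omit [Fintype A] in
lemma conj_rdiag_sub [DecidableEq ι] (U : Matrix A ι ℂ) (c d : ι → ℝ) :
    U * rdiag c * Uᴴ - U * rdiag d * Uᴴ = U * rdiag (fun i => c i - d i) * Uᴴ := by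
  rw [← Matrix.sub_mul, ← Matrix.mul_sub, Matrix.diagonal_sub]
  simp only [rdiag, Complex.ofReal_sub]

omit [Fintype A] in
lemma conj_rdiag_add [DecidableEq ι] (U : Matrix A ι ℂ) (c d : ι → ℝ) :
    U * rdiag c * Uᴴ + U * rdiag d * Uᴴ = U * rdiag (fun i => c i + d i) * Uᴴ := by
  rw [← Matrix.add_mul, ← Matrix.mul_add, Matrix.diagonal_add]
  simp only [rdiag, Complex.ofReal_add]

lemma conj_rdiag_one [DecidableEq A] {U : Op A} (hU : U * Uᴴ = 1) :
    U * rdiag (fun _ => 1) * Uᴴ = 1 := by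
  rw [show rdiag (fun _ : A => (1 : ℝ)) = (1 : Op A) by simp [rdiag], Matrix.mul_one, hU]

lemma trace_conj [DecidableEq ι] {U : Matrix A ι ℂ} (hU : Uᴴ * U = 1) (X : Op ι) :
    (U * X * Uᴴ).trace = X.trace := by
  rw [Matrix.trace_mul_comm, ← Matrix.mul_assoc, hU, Matrix.one_mul]

lemma trace_conj_rdiag [DecidableEq ι] {U : Matrix A ι ℂ} (hU : Uᴴ * U = 1) (d : ι → ℝ) :
    (U * rdiag d * Uᴴ).trace = ((∑ i, d i : ℝ) : ℂ) := by
  rw [trace_conj hU, Matrix.trace_diagonal]; simp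

/-- The functional calculus can be computed in any eigenbasis. -/
lemma cfc_conj_rdiag [DecidableEq A] [DecidableEq ι] {U : Matrix A ι ℂ} (hU : Uᴴ * U = 1)
    (hU' : U * Uᴴ = 1) (d : ι → ℝ) (f : ℝ → ℝ) :
    cfc f (U * rdiag d * Uᴴ) = U * rdiag (fun i => f (d i)) * Uᴴ := by
  have hX : (U * rdiag d * Uᴴ).IsHermitian := isHermitian_conj_rdiag U d
  rw [cfc_eq_conj_rdiag hX]
  set V : Matrix A A ℂ := (hX.eigenvectorUnitary : Matrix A A ℂ)
  have hV : Vᴴ * V = 1 := eigenvectorUnitary_conjTranspose_mul hX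
  have hV' : V * Vᴴ = 1 := eigenvectorUnitary_mul_conjTranspose hX
  -- `Uᴴ * V` intertwines the two diagonal matrices, so its entries vanish where the diagonal values
  -- differ. Hence it also intertwines any function of them.
  have h1 : rdiag d * (Uᴴ * V) = Uᴴ * V * rdiag hX.eigenvalues := by
    calc rdiag d * (Uᴴ * V) = Uᴴ * (U * rdiag d * Uᴴ) * V := by
          simp only [← Matrix.mul_assoc, hU, Matrix.one_mul]
      _ = Uᴴ * (V * rdiag hX.eigenvalues * Vᴴ) * V := by rw [← eq_conj_rdiag_eigenvalues hX]
      _ = _ := by simp only [Matrix.mul_assoc, hV, Matrix.mul_one]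
  have h2 : rdiag (fun i => f (d i)) * (Uᴴ * V) =
      Uᴴ * V * rdiag (fun i => f (hX.eigenvalues i)) := by
    ext i j
    have := congrFun (congrFun h1 i) j
    rw [Matrix.diagonal_mul, Matrix.mul_diagonal] at this ⊢
    by_cases h : (Uᴴ * V) i j = 0
    · simp [h]
    · rw [mul_comm] at this
      have := mul_left_cancel₀ h this
      have h3 : d i = hX.eigenvalues j := by exact_mod_cast this
      simp only [h3, mul_comm]
  calc V * rdiag (fun i => f (hX.eigenvalues i)) * Vᴴ
      = U * (Uᴴ * V * rdiag (fun i => f (hX.eigenvalues i))) * Vᴴ := by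
        simp only [← Matrix.mul_assoc, hU', Matrix.one_mul]
    _ = U * rdiag (fun i => f (d i)) * Uᴴ * (V * Vᴴ) := by
        rw [← h2]; simp only [Matrix.mul_assoc]
    _ = _ := by rw [hV', Matrix.mul_one]

lemma exists_eq_conjTranspose_mul_self {X : Op A} (hX : X.PosSemidef) : ∃ Y : Op A, X = Yᴴ * Y := by
  classical
  open scoped MatrixOrder in
  exact CStarAlgebra.nonneg_iff_eq_star_mul_self.mp hX.nonneg

lemma re_trace_nonneg {X : Op A} (hX : X.PosSemidef) : 0 ≤ X.trace.re :=
  (Complex.nonneg_iff.mp hX.trace_nonneg).1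

lemma re_trace_mul_nonneg {X Y : Op A} (hX : X.PosSemidef) (hY : Y.PosSemidef) :
    0 ≤ (X * Y).trace.re := by
  obtain ⟨Z, rfl⟩ := exists_eq_conjTranspose_mul_self hX
  rw [Matrix.mul_assoc, Matrix.trace_mul_comm]
  exact re_trace_nonneg (hY.mul_mul_conjTranspose_same Z)

lemma trace_eq_re {X : Op A} (hX : X.IsHermitian) : X.trace = (X.trace.re : ℂ) := by
  have h : star X.trace = X.trace := by rw [← Matrix.trace_conjTranspose, hX.eq]
  exact (Complex.conj_eq_iff_re.mp h).symm

lemma re_trace_conjTranspose_mul_self (X : Matrix A B ℂ) :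
    (Xᴴ * X).trace.re = ∑ p : A × B, ‖X p.1 p.2‖ ^ 2 := by
  simp only [Matrix.trace, Matrix.diag, Matrix.mul_apply, Matrix.conjTranspose_apply,
    Complex.re_sum, Fintype.sum_prod_type]
  rw [Finset.sum_comm]
  refine Finset.sum_congr rfl fun i _ => Finset.sum_congr rfl fun j _ => ?_
  rw [Complex.star_def, mul_comm, Complex.mul_conj, Complex.ofReal_re, Complex.normSq_eq_norm_sq]

/-- Cauchy–Schwarz inequality for the Hilbert–Schmidt inner product. -/
lemma re_trace_conjTranspose_mul_le (X Y : Matrix A B ℂ) :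
    (Xᴴ * Y).trace.re ≤ √(Xᴴ * X).trace.re * √(Yᴴ * Y).trace.re := by
  rw [re_trace_conjTranspose_mul_self, re_trace_conjTranspose_mul_self]
  refine le_trans ?_ (Real.sum_mul_le_sqrt_mul_sqrt Finset.univ
    (fun p : A × B => ‖X p.1 p.2‖) (fun p => ‖Y p.1 p.2‖))
  simp only [Matrix.trace, Matrix.diag, Matrix.mul_apply, Matrix.conjTranspose_apply,
    Complex.re_sum, Fintype.sum_prod_type]
  rw [Finset.sum_comm]
  refine Finset.sum_le_sum fun i _ => Finset.sum_le_sum fun j _ => ?_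
  refine (Complex.re_le_norm _).trans ?_
  simp

omit [Fintype B] in
lemma isHermitian_sum {κ : Type*} {X : κ → Op B} (s : Finset κ) (h : ∀ i ∈ s, (X i).IsHermitian) :
    (∑ i ∈ s, X i).IsHermitian := by
  rw [Matrix.IsHermitian, Matrix.conjTranspose_sum]
  exact Finset.sum_congr rfl fun i hi => h i hi

omit [Fintype B] in
lemma isHermitian_smul {X : Op B} (h : X.IsHermitian) (c : ℝ) :
    ((c : ℂ) • X).IsHermitian := by
  rw [Matrix.IsHermitian, Matrix.conjTranspose_smul, h.eq]
  simp

omit [Fintype B] in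
lemma posSemidef_smul {X : Op B} (h : X.PosSemidef) {c : ℝ} (hc : 0 ≤ c) :
    ((c : ℂ) • X).PosSemidef := h.smul (by exact_mod_cast hc)

lemma re_trace_smul (c : ℝ) (X : Op B) : ((c : ℂ) • X).trace.re = c * X.trace.re := by
  rw [Matrix.trace_smul, smul_eq_mul, Complex.re_ofReal_mul]

variable [DecidableEq A] [DecidableEq B]

lemma traceNorm_eq_sum {X : Op A} (hX : X.IsHermitian) :
    traceNorm X = ∑ i, |hX.eigenvalues i| := by
  have hU := eigenvectorUnitary_conjTranspose_mul hX
  have hU' := eigenvectorUnitary_mul_conjTranspose hX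
  have h := eq_conj_rdiag_eigenvalues hX
  rw [traceNorm, hX.eq]
  set U : Matrix A A ℂ := (hX.eigenvectorUnitary : Matrix A A ℂ)
  set d := hX.eigenvalues
  rw [show X * X = U * rdiag (fun i => d i * d i) * Uᴴ by
    rw [← conj_rdiag_mul hU, ← h], cfc_conj_rdiag hU hU', trace_conj_rdiag hU, Complex.ofReal_re]
  exact Finset.sum_congr rfl fun i _ => Real.sqrt_mul_self_eq_abs _

lemma traceNorm_nonneg (X : Op A) : 0 ≤ traceNorm X := by
  have hX : (Xᴴ * X).IsHermitian := Matrix.isHermitian_conjTranspose_mul_self X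
  rw [traceNorm, cfc_eq_conj_rdiag hX,
    trace_conj_rdiag (eigenvectorUnitary_conjTranspose_mul hX), Complex.ofReal_re]
  exact Finset.sum_nonneg fun i _ => Real.sqrt_nonneg _

/-- Positive and negative part. This decomposition and the sign in `exists_sign` are the two dual
descriptions of the trace norm from which its properties below are derived. -/
lemma exists_sub_eq {X : Op A} (hX : X.IsHermitian) :
    ∃ P Q : Op A, P.PosSemidef ∧ Q.PosSemidef ∧ X = P - Q ∧
      traceNorm X = P.trace.re + Q.trace.re := by
  have hU := eigenvectorUnitary_conjTranspose_mul hX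
  refine ⟨_, _, posSemidef_conj_rdiag hX.eigenvectorUnitary
    (d := fun i => max (hX.eigenvalues i) 0) fun i => le_max_right _ _,
    posSemidef_conj_rdiag hX.eigenvectorUnitary
    (d := fun i => max (-hX.eigenvalues i) 0) fun i => le_max_right _ _, ?_, ?_⟩
  · conv_lhs => rw [eq_conj_rdiag_eigenvalues hX]
    rw [conj_rdiag_sub]
    congr 3
    funext i
    rcases le_total 0 (hX.eigenvalues i) with h | h
    · rw [max_eq_left h, max_eq_right (by linarith), sub_zero]
    · rw [max_eq_right h, max_eq_left (by linarith)]; ring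
  · rw [traceNorm_eq_sum hX, trace_conj_rdiag hU, trace_conj_rdiag hU, Complex.ofReal_re,
      Complex.ofReal_re, ← Finset.sum_add_distrib]
    refine Finset.sum_congr rfl fun i _ => ?_
    rcases le_total 0 (hX.eigenvalues i) with h | h
    · rw [max_eq_left h, max_eq_right (by linarith), add_zero, abs_of_nonneg h]
    · rw [max_eq_right h, max_eq_left (by linarith), zero_add, abs_of_nonpos h]

/-- The sign of a Hermitian operator attains the trace norm. -/
lemma exists_sign {X : Op A} (hX : X.IsHermitian) :
    ∃ H : Op A, H.IsHermitian ∧ (1 - H).PosSemidef ∧ (1 + H).PosSemidef ∧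
      (1 - H * H).PosSemidef ∧ (H * X).trace.re = traceNorm X := by
  have hU := eigenvectorUnitary_conjTranspose_mul hX
  have hU' := eigenvectorUnitary_mul_conjTranspose hX
  have h := eq_conj_rdiag_eigenvalues hX
  rw [traceNorm_eq_sum hX]
  set U : Matrix A A ℂ := (hX.eigenvectorUnitary : Matrix A A ℂ)
  set d := hX.eigenvalues
  have h1 := (conj_rdiag_one hU').symm
  have hs : ∀ i, SignType.sign (d i) = (0 : SignType) ∨ SignType.sign (d i) = (1 : SignType) ∨
      SignType.sign (d i) = (-1 : SignType) := fun i => by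
    rcases lt_trichotomy (d i) 0 with h | h | h
    · right; right; exact sign_neg h
    · left; rw [h]; exact sign_zero
    · right; left; exact sign_pos h
  refine ⟨U * rdiag (fun i => (SignType.sign (d i) : ℝ)) * Uᴴ, isHermitian_conj_rdiag _ _,
    ?_, ?_, ?_, ?_⟩
  · rw [h1, conj_rdiag_sub]
    refine posSemidef_conj_rdiag U fun i => ?_
    rcases hs i with h | h | h <;> simp [h]
  · rw [h1, conj_rdiag_add]
    refine posSemidef_conj_rdiag U fun i => ?_
    rcases hs i with h | h | h <;> simp [h]
  · rw [conj_rdiag_mul hU, h1, conj_rdiag_sub]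
    refine posSemidef_conj_rdiag U fun i => ?_
    rcases hs i with h | h | h <;> simp [h]
  · conv_lhs => rw [h]
    rw [conj_rdiag_mul hU, trace_conj_rdiag hU, Complex.ofReal_re]
    exact Finset.sum_congr rfl fun i _ => sign_mul_self (d i)

lemma re_trace_mul_le_of_effect {H P : Op A} (h : (1 - H).PosSemidef) (hP : P.PosSemidef) :
    (H * P).trace.re ≤ P.trace.re := by
  have := re_trace_mul_nonneg h hP
  rw [Matrix.sub_mul, Matrix.one_mul, Matrix.trace_sub, Complex.sub_re] at this
  linarith

lemma neg_le_re_trace_mul {H P : Op A} (h : (1 + H).PosSemidef) (hP : P.PosSemidef) :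
    -P.trace.re ≤ (H * P).trace.re := by
  have := re_trace_mul_nonneg h hP
  rw [Matrix.add_mul, Matrix.one_mul, Matrix.trace_add, Complex.add_re] at this
  linarith

lemma traceNorm_sub_le {P Q : Op A} (hP : P.PosSemidef) (hQ : Q.PosSemidef) :
    traceNorm (P - Q) ≤ P.trace.re + Q.trace.re := by
  obtain ⟨H, -, h1, h2, -, h3⟩ := exists_sign (hP.1.sub hQ.1)
  rw [← h3, Matrix.mul_sub, Matrix.trace_sub, Complex.sub_re]
  linarith [re_trace_mul_le_of_effect h1 hP, neg_le_re_trace_mul h2 hQ]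

lemma re_trace_mul_le_traceNorm {H X : Op A} (hX : X.IsHermitian) (h1 : (1 - H).PosSemidef)
    (h2 : (1 + H).PosSemidef) : (H * X).trace.re ≤ traceNorm X := by
  obtain ⟨P, Q, hP, hQ, rfl, h⟩ := exists_sub_eq hX
  rw [h, Matrix.mul_sub, Matrix.trace_sub, Complex.sub_re]
  linarith [re_trace_mul_le_of_effect h1 hP, neg_le_re_trace_mul h2 hQ]

lemma re_trace_effect_mul_le {E X : Op A} (hX : X.IsHermitian) (h0 : E.PosSemidef)
    (h1 : (1 - E).PosSemidef) : (E * X).trace.re ≤ traceNorm X :=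
  re_trace_mul_le_traceNorm hX h1 (Matrix.PosSemidef.one.add h0)

lemma traceNorm_add_le {X Y : Op A} (hX : X.IsHermitian) (hY : Y.IsHermitian) :
    traceNorm (X + Y) ≤ traceNorm X + traceNorm Y := by
  obtain ⟨H, -, h1, h2, -, h3⟩ := exists_sign (hX.add hY)
  rw [← h3, Matrix.mul_add, Matrix.trace_add, Complex.add_re]
  exact add_le_add (re_trace_mul_le_traceNorm hX h1 h2) (re_trace_mul_le_traceNorm hY h1 h2)

lemma traceNorm_zero : traceNorm (0 : Op A) = 0 := by
  refine le_antisymm ?_ (traceNorm_nonneg _)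
  simpa using traceNorm_sub_le (Matrix.PosSemidef.zero (n := A) (R := ℂ)) Matrix.PosSemidef.zero

lemma traceNorm_of_posSemidef {P : Op A} (hP : P.PosSemidef) : traceNorm P = P.trace.re := by
  refine le_antisymm ?_ ?_
  · simpa using traceNorm_sub_le hP Matrix.PosSemidef.zero
  · simpa using re_trace_effect_mul_le hP.1 Matrix.PosSemidef.one
      (by simpa using Matrix.PosSemidef.zero)

lemma traceNorm_neg {X : Op A} : traceNorm (-X) = traceNorm X := by simp [traceNorm]

lemma traceNorm_sub_comm (X Y : Op A) : traceNorm (X - Y) = traceNorm (Y - X) := by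
  rw [← traceNorm_neg, neg_sub]

lemma traceNorm_sub_le_add {X Y Z : Op A} (hX : X.IsHermitian) (hY : Y.IsHermitian)
    (hZ : Z.IsHermitian) : traceNorm (X - Z) ≤ traceNorm (X - Y) + traceNorm (Y - Z) := by
  rw [← sub_add_sub_cancel X Y Z]
  exact traceNorm_add_le (hX.sub hY) (hY.sub hZ)

lemma traceNorm_sum_le {κ : Type*} {X : κ → Op A} (s : Finset κ)
    (h : ∀ i ∈ s, (X i).IsHermitian) :
    traceNorm (∑ i ∈ s, X i) ≤ ∑ i ∈ s, traceNorm (X i) := by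
  classical
  induction s using Finset.induction_on with
  | empty => simp [traceNorm_zero]
  | insert i s hi ih =>
    rw [Finset.sum_insert hi, Finset.sum_insert hi]
    have h' : ∀ j ∈ s, (X j).IsHermitian := fun j hj => h j (Finset.mem_insert_of_mem hj)
    exact (traceNorm_add_le (h i (Finset.mem_insert_self _ _)) (isHermitian_sum s h')).trans
      (add_le_add le_rfl (ih h'))

lemma traceNorm_smul_le {X : Op A} (hX : X.IsHermitian) {c : ℝ} (hc : 0 ≤ c) :
    traceNorm ((c : ℂ) • X) ≤ c * traceNorm X := by
  obtain ⟨P, Q, hP, hQ, rfl, h⟩ := exists_sub_eq hX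
  rw [h, smul_sub]
  refine (traceNorm_sub_le (posSemidef_smul hP hc) (posSemidef_smul hQ hc)).trans_eq ?_
  rw [re_trace_smul, re_trace_smul]; ring

/-- The trace norm does not increase under completely positive trace-preserving maps. -/
lemma traceNorm_map_le {Φ : Op A →ₗ[ℂ] Op B} (h : CP Φ) (h' : TP Φ) {X : Op A}
    (hX : X.IsHermitian) : traceNorm (Φ X) ≤ traceNorm X := by
  obtain ⟨P, Q, hP, hQ, rfl, he⟩ := exists_sub_eq hX
  rw [he, map_sub]
  refine (traceNorm_sub_le (h.posSemidef hP) (h.posSemidef hQ)).trans_eq ?_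
  rw [h', h']

lemma traceNorm_kronecker_le {G : Op A} {Z : Op B} (hG : G.PosSemidef) (hZ : Z.IsHermitian) :
    traceNorm (G ⊗ₖ Z) ≤ G.trace.re * traceNorm Z := by
  obtain ⟨P, Q, hP, hQ, rfl, he⟩ := exists_sub_eq hZ
  have h : G ⊗ₖ (P - Q) = G ⊗ₖ P - G ⊗ₖ Q := by
    ext p q; simp [kroneckerMap_apply, mul_sub]
  rw [he, h]
  refine (traceNorm_sub_le (hG.kronecker hP) (hG.kronecker hQ)).trans_eq ?_
  rw [Matrix.trace_kronecker, Matrix.trace_kronecker, trace_eq_re hG.1, trace_eq_re hP.1,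
    trace_eq_re hQ.1, ← Complex.ofReal_mul, ← Complex.ofReal_mul]
  simp only [Complex.ofReal_re]
  ring

lemma traceNorm_sub_le_two {X Y : Op A} (hX : IsDensity X) (hY : IsDensity Y) :
    traceNorm (X - Y) ≤ 2 := by
  refine (traceNorm_sub_le hX.1 hY.1).trans_eq ?_
  rw [hX.2, hY.2]; norm_num

/-- Effects have square roots that act gently. -/
lemma exists_sqrt_effect {E : Op A} (h0 : E.PosSemidef) (h1 : (1 - E).PosSemidef) :
    ∃ S : Op A, S.PosSemidef ∧ S * S = E ∧ (1 - E - (1 - S) * (1 - S)).PosSemidef := by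
  have hX := h0.1
  have hU := eigenvectorUnitary_conjTranspose_mul hX
  have hU' := eigenvectorUnitary_mul_conjTranspose hX
  have h := eq_conj_rdiag_eigenvalues hX
  have hd0 : ∀ i, 0 ≤ hX.eigenvalues i := h0.eigenvalues_nonneg
  set U : Matrix A A ℂ := (hX.eigenvectorUnitary : Matrix A A ℂ)
  set d := hX.eigenvalues
  have h11 := (conj_rdiag_one hU').symm
  have hd1 : ∀ i, d i ≤ 1 := by
    intro i
    have h2 : Uᴴ * (1 - E) * U = rdiag fun i => 1 - d i := by
      rw [h, h11, conj_rdiag_sub]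
      calc _ = (Uᴴ * U) * rdiag (fun i => 1 - d i) * (Uᴴ * U) := by
            simp only [Matrix.mul_assoc]
        _ = _ := by rw [hU, Matrix.one_mul, Matrix.mul_one]
    have h3 := (h1.conjTranspose_mul_mul_same U).diag_nonneg (i := i)
    rw [h2] at h3
    simp only [rdiag, Matrix.diagonal_apply_eq] at h3
    linarith [Complex.zero_le_real.mp h3]
  refine ⟨U * rdiag (fun i => √(d i)) * Uᴴ, posSemidef_conj_rdiag U fun i => Real.sqrt_nonneg _,
    ?_, ?_⟩
  · rw [conj_rdiag_mul hU, h]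
    congr 3
    ext i
    rw [Real.mul_self_sqrt (hd0 i)]
  · have h4 : (1 : Op A) - U * rdiag (fun i => √(d i)) * Uᴴ =
        U * rdiag (fun i => 1 - √(d i)) * Uᴴ := by
      rw [h11, conj_rdiag_sub]
    rw [h4, conj_rdiag_mul hU, h, h11, conj_rdiag_sub, conj_rdiag_sub]
    refine posSemidef_conj_rdiag U fun i => ?_
    have h5 := Real.mul_self_sqrt (hd0 i)
    have h6 : √(d i) ≤ 1 := Real.sqrt_le_one.mpr (hd1 i)
    -- The scalar inequality `(1 - √d)² ≤ 1 - d`, valid for `0 ≤ d ≤ 1`.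
    nlinarith [Real.sqrt_nonneg (d i)]

/-- Gentle measurement. -/
lemma traceNorm_gentle {Γ E S : Op A} (hΓ : Γ.PosSemidef) (hΓ1 : Γ.trace.re ≤ 1)
    (h1 : (1 - E).PosSemidef) (hS : S.PosSemidef) (hSE : S * S = E)
    (hSg : (1 - E - (1 - S) * (1 - S)).PosSemidef) :
    traceNorm (S * Γ * S - Γ) ≤ 2 * √((1 - E) * Γ).trace.re := by
  obtain ⟨Y, rfl⟩ := exists_eq_conjTranspose_mul_self hΓ
  set Γ := Yᴴ * Y with hΓdef
  have hS' := hS.1.eq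
  have hherm : (Γ - S * Γ * S).IsHermitian :=
    hΓ.1.sub (by rw [Matrix.IsHermitian]; simp [hS', hΓ.1.eq, Matrix.mul_assoc])
  rw [traceNorm_sub_comm]
  obtain ⟨H, hH, -, -, h3, h4⟩ := exists_sign hherm
  rw [← h4]
  have hH2 : ∀ Z : Op A, Z.PosSemidef → (H * Z * H).trace.re ≤ Z.trace.re := by
    intro Z hZ
    rw [Matrix.trace_mul_comm, ← Matrix.mul_assoc]
    exact re_trace_mul_le_of_effect h3 hZ
  have hS1 : (1 - S)ᴴ = 1 - S := by simp [hS']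
  have hg : ((1 - S) * Γ * (1 - S)).trace.re ≤ ((1 - E) * Γ).trace.re := by
    have := re_trace_mul_nonneg hSg hΓ
    rw [Matrix.sub_mul, Matrix.trace_sub, Complex.sub_re] at this
    rw [Matrix.trace_mul_comm, ← Matrix.mul_assoc]
    linarith
  have hSΓ : (S * Γ * S).trace.re ≤ 1 := by
    rw [Matrix.trace_mul_comm, ← Matrix.mul_assoc, hSE]
    exact (re_trace_mul_le_of_effect h1 hΓ).trans hΓ1
  -- `Γ - SΓS = Γ(1 - S) + (1 - S)ΓS` with `Γ = YᴴY`. Cauchy–Schwarz bounds each term by a factor at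
  -- most `1` times the root of `tr (1 - E)Γ`, because `H² ≤ 1` and `(1 - S)² ≤ 1 - E`.
  have e : H * (Γ - S * Γ * S) = H * Yᴴ * (Y * (1 - S)) + H * (1 - S) * Yᴴ * (Y * S) := by
    rw [hΓdef]
    simp only [Matrix.mul_sub, Matrix.sub_mul, Matrix.mul_one, Matrix.mul_assoc]
    abel
  rw [e, Matrix.trace_add, Complex.add_re]
  have c1 := re_trace_conjTranspose_mul_le (Y * H) (Y * (1 - S))
  have c2 := re_trace_conjTranspose_mul_le (Y * (1 - S) * H) (Y * S)
  simp only [Matrix.conjTranspose_mul, hH.eq, hS1, hS'] at c1 c2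
  have a1 : (H * Yᴴ * (Y * H)).trace.re ≤ 1 := by
    rw [show H * Yᴴ * (Y * H) = H * Γ * H by rw [hΓdef]; simp only [Matrix.mul_assoc]]
    exact (hH2 Γ hΓ).trans hΓ1
  have a2 : ((1 - S) * Yᴴ * (Y * (1 - S))).trace.re ≤ ((1 - E) * Γ).trace.re := by
    rw [show (1 - S) * Yᴴ * (Y * (1 - S)) = (1 - S) * Γ * (1 - S) by
      rw [hΓdef]; simp only [Matrix.mul_assoc]]
    exact hg
  have a3 : (H * ((1 - S) * Yᴴ) * (Y * (1 - S) * H)).trace.re ≤ ((1 - E) * Γ).trace.re := by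
    rw [show H * ((1 - S) * Yᴴ) * (Y * (1 - S) * H) = H * ((1 - S) * Γ * (1 - S)) * H by
      rw [hΓdef]; simp only [Matrix.mul_assoc]]
    refine (hH2 _ ?_).trans hg
    have := hΓ.mul_mul_conjTranspose_same (1 - S)
    rwa [hS1] at this
  have a4 : (S * Yᴴ * (Y * S)).trace.re ≤ 1 := by
    rw [show S * Yᴴ * (Y * S) = S * Γ * S by rw [hΓdef]; simp only [Matrix.mul_assoc]]
    exact hSΓ
  have b1 := Real.sqrt_le_one.mpr a1
  have b2 := Real.sqrt_le_sqrt a2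
  have b3 := Real.sqrt_le_sqrt a3
  have b4 := Real.sqrt_le_one.mpr a4
  have c3 : (H * Yᴴ * (Y * (1 - S))).trace.re ≤ √((1 - E) * Γ).trace.re :=
    c1.trans ((mul_le_mul b1 b2 (Real.sqrt_nonneg _) zero_le_one).trans_eq (one_mul _))
  have c4 : (H * (1 - S) * Yᴴ * (Y * S)).trace.re ≤ √((1 - E) * Γ).trace.re := by
    rw [show H * (1 - S) * Yᴴ = H * ((1 - S) * Yᴴ) by simp only [Matrix.mul_assoc]]
    exact c2.trans ((mul_le_mul b3 b4 (Real.sqrt_nonneg _) (Real.sqrt_nonneg _)).trans_eq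
      (mul_one _))
  linarith

end TraceNorm

/-! ## Codes for a fixed message and their combination with a classical code -/

section Outer

variable {A B C D K κ ι : Type*} [Fintype A] [Fintype B] [Fintype K] [Fintype κ]

/-- Uniform average. -/
def avg (f : κ → Op A) : Op A := (((Fintype.card κ : ℝ)⁻¹ : ℝ) : ℂ) • ∑ s, f s

omit [Fintype A] in
lemma IsHermitian.avg {f : κ → Op A} (h : ∀ s, (f s).IsHermitian) : (avg f).IsHermitian :=
  isHermitian_smul (isHermitian_sum _ fun s _ => h s) _

omit [Fintype A] in
lemma avg_sub (f g : κ → Op A) : avg (fun s => f s - g s) = avg f - avg g := by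
  simp only [avg, Finset.sum_sub_distrib, smul_sub]

omit [Fintype A] in
lemma avg_const [Nonempty κ] (X : Op A) : avg (fun _ : κ => X) = X := by
  have : (Fintype.card κ : ℂ) ≠ 0 := Nat.cast_ne_zero.mpr Fintype.card_ne_zero
  rw [avg, Finset.sum_const, Finset.card_univ, ← Nat.cast_smul_eq_nsmul ℂ, smul_smul]
  push_cast
  rw [inv_mul_cancel₀ this, one_smul]

omit [Fintype A] [Fintype B] in
lemma map_avg (Φ : Op A →ₗ[ℂ] Op B) (f : κ → Op A) : Φ (avg f) = avg fun s => Φ (f s) := by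
  simp only [avg, map_smul, map_sum]

omit [Fintype A] in
lemma avg_equiv {κ' : Type*} [Fintype κ'] (e : κ ≃ κ') (f : κ' → Op A) :
    avg (fun s => f (e s)) = avg f := by
  simp only [avg, Fintype.card_congr e]
  rw [Equiv.sum_comp e f]

omit [Fintype A] in
lemma avg_prod {κ' : Type*} [Fintype κ'] (f : κ × κ' → Op A) :
    avg f = avg fun s => avg fun t => f (s, t) := by
  simp only [avg, Fintype.card_prod, Fintype.sum_prod_type, ← Finset.smul_sum, smul_smul]
  push_cast
  rw [mul_inv]

omit [Fintype A] in
lemma smul_sum_sum_eq_avg {S M : ℕ} (F : Fin S → Fin M → Op A) :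
    (1 / ((S : ℂ) * (M : ℂ))) • ∑ s, ∑ w, F s w = avg fun w => avg fun s => F s w := by
  rw [Finset.sum_comm]
  simp only [avg, ← Finset.smul_sum, smul_smul, Fintype.card_fin]
  push_cast
  rw [one_div, mul_inv, mul_comm]

omit [Fintype B] in
lemma trFstL_kronL (Z : Op A) (X : Op B) : trFstL (kronL Z X) = Z.trace • X :=
  trFst_kronecker Z X

omit [Fintype A] in
lemma trSndL_kronL (Z : Op A) (X : Op B) : trSndL (kronL Z X) = X.trace • Z :=
  trSnd_kronecker Z X

lemma traceNorm_avg_le [DecidableEq A] {f : κ → Op A} (h : ∀ s, (f s).IsHermitian) :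
    traceNorm (avg f) ≤ (Fintype.card κ : ℝ)⁻¹ * ∑ s, traceNorm (f s) :=
  (traceNorm_smul_le (isHermitian_sum _ fun s _ => h s) (by positivity)).trans
    (mul_le_mul_of_nonneg_left (traceNorm_sum_le _ fun s _ => h s) (by positivity))

lemma inv_card_mul_sum_le [Nonempty κ] {f : κ → ℝ} {c : ℝ} (h : ∀ s, f s ≤ c) :
    (Fintype.card κ : ℝ)⁻¹ * ∑ s, f s ≤ c := by
  have hc : (0 : ℝ) < Fintype.card κ := Nat.cast_pos.mpr Fintype.card_pos
  rw [inv_mul_le_iff₀ hc]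
  refine (Finset.sum_le_sum fun s _ => h s).trans_eq ?_
  simp

lemma IsDensity.avg [Nonempty κ] {f : κ → Op A} (h : ∀ s, IsDensity (f s)) :
    IsDensity (avg f) := by
  refine ⟨posSemidef_smul (Matrix.posSemidef_sum _ fun s _ => (h s).1) (by positivity), ?_⟩
  have : (Fintype.card κ : ℂ) ≠ 0 := Nat.cast_ne_zero.mpr Fintype.card_ne_zero
  simp only [QStego.avg, Matrix.trace_smul, Matrix.trace_sum, (h _).2]
  simp [this]

lemma IsDensity.kronecker {X : Op A} {Y : Op B} (hX : IsDensity X) (hY : IsDensity Y) :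
    IsDensity (X ⊗ₖ Y) :=
  ⟨hX.1.kronecker hY.1, by rw [Matrix.trace_kronecker, hX.2, hY.2, mul_one]⟩

lemma IsDensity.trFst {X : Op (A × B)} (hX : IsDensity X) : IsDensity (trFst X) :=
  ⟨CP.trFstL.posSemidef hX.1, by rw [trace_trFst, hX.2]⟩

lemma IsDensity.idTensor {X : Op (K × A)} (hX : IsDensity X) {Φ : Op A →ₗ[ℂ] Op B}
    (h : IsChannel Φ) : IsDensity (idTensor K Φ X) := by
  rw [idTensor_eq_mapTensor]
  exact ⟨(CP.id.mapTensor h.cp).posSemidef hX.1, ((TP.id.mapTensor h.tp) X).trans hX.2⟩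

/-- A code for entanglement sharing over `T` with keys in `κ`, generating `Ω` up to `e`,
with output state close to `ρ` up to `δ`. -/
def InnerCode [DecidableEq B] [Fintype C] [DecidableEq C] [DecidableEq K] (κ : Type*) [Fintype κ]
    (T : Op A →ₗ[ℂ] Op B) (Ω : Op (K × C)) (ρ : Op B) (e δ : ℝ) : Prop :=
  ∃ (g : κ → Op (K × A)) (D : κ → Op B →ₗ[ℂ] Op C),
    (∀ s, IsDensity (g s)) ∧ (∀ s, IsChannel (D s)) ∧
    traceNorm (avg (fun s => idTensor K (D s ∘ₗ T) (g s)) - Ω) ≤ e ∧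
    traceNorm (avg (fun s => T (trFst (g s))) - ρ) ≤ δ

lemma trace_one_kronecker_mul [DecidableEq K] (X : Op B) (Y : Op (K × B)) :
    (((1 : Op K) ⊗ₖ X) * Y).trace = (X * trFst Y).trace := by
  have : Matrix.traceLinearMap _ ℂ ℂ ∘ₗ LinearMap.mulLeft ℂ ((1 : Op K) ⊗ₖ X) =
      Matrix.traceLinearMap _ ℂ ℂ ∘ₗ LinearMap.mulLeft ℂ X ∘ₗ trFstL :=
    kronecker_ext fun P Q => by
      change (((1 : Op K) ⊗ₖ X) * (P ⊗ₖ Q)).trace = (X * trFst (P ⊗ₖ Q)).trace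
      rw [← Matrix.mul_kronecker_mul, Matrix.one_mul, Matrix.trace_kronecker, trFst_kronecker,
        Matrix.mul_smul, Matrix.trace_smul, smul_eq_mul]
  exact LinearMap.congr_fun this Y

lemma mapTensor_id_conjMap [DecidableEq K] (S : Matrix C B ℂ) :
    mapTensor (LinearMap.id : Op K →ₗ[ℂ] Op K) (conjMap S) = conjMap ((1 : Op K) ⊗ₖ S) := by
  rw [← mapTensor_conjMap]
  congr 1
  ext1 X
  simp

omit [Fintype B] [Fintype K] in
lemma one_sub_kronecker [DecidableEq K] [DecidableEq B] (X : Op B) :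
    1 - (1 : Op K) ⊗ₖ X = (1 : Op K) ⊗ₖ (1 - X) := by
  rw [← Matrix.one_kronecker_one]
  ext p q
  simp only [kroneckerMap_apply, Matrix.sub_apply, mul_sub]

/-- Applying the measurement `Λ` gently before the decoder of the right message. -/
lemma traceNorm_measured_sub_le [Fintype C] [DecidableEq C] [DecidableEq B] [DecidableEq K]
    [Fintype ι] [DecidableEq ι] {Λ S : ι → Op B} (hΛ : ∀ w, (Λ w).PosSemidef) (hΛ1 : ∑ w, Λ w = 1)
    (hS : ∀ w, (S w).PosSemidef) (hSΛ : ∀ w, S w * S w = Λ w)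
    (hSg : ∀ w, (1 - Λ w - (1 - S w) * (1 - S w)).PosSemidef)
    {D : ι → Op B →ₗ[ℂ] Op C} (hD : ∀ w, IsChannel (D w)) {Γ : Op (K × B)} (hΓ : IsDensity Γ)
    (w : ι) :
    traceNorm (idTensor K (⇑(∑ v, D v ∘ₗ conjMap (S v))) Γ - idTensor K (D w) Γ) ≤
      2 * √(1 - (Λ w * trFst Γ).trace.re) + (1 - (Λ w * trFst Γ).trace.re) := by
  set p := (Λ w * trFst Γ).trace.re
  let F : ι → Op (K × C) := fun v =>
    mapTensor LinearMap.id (D v) (((1 : Op K) ⊗ₖ S v) * Γ * ((1 : Op K) ⊗ₖ S v))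
  have hS' : ∀ v, ((1 : Op K) ⊗ₖ S v)ᴴ = (1 : Op K) ⊗ₖ S v := fun v => by
    rw [Matrix.conjTranspose_kronecker, (hS v).1.eq, Matrix.conjTranspose_one]
  have hmid : ∀ v, (((1 : Op K) ⊗ₖ S v) * Γ * ((1 : Op K) ⊗ₖ S v)).PosSemidef := fun v => by
    have := hΓ.1.mul_mul_conjTranspose_same ((1 : Op K) ⊗ₖ S v)
    rwa [hS' v] at this
  have e1 : idTensor K (⇑(∑ v, D v ∘ₗ conjMap (S v))) Γ = ∑ v, F v := by
    rw [idTensor_eq_mapTensor, mapTensor_sum_right, LinearMap.sum_apply]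
    refine Finset.sum_congr rfl fun v _ => ?_
    rw [show mapTensor (LinearMap.id : Op K →ₗ[ℂ] Op K) (D v ∘ₗ conjMap (S v)) =
      mapTensor LinearMap.id (D v) ∘ₗ mapTensor LinearMap.id (conjMap (S v)) by
        rw [← mapTensor_comp, LinearMap.id_comp], mapTensor_id_conjMap, LinearMap.comp_apply,
      conjMap_apply, hS' v]
  have hF : ∀ v, (F v).PosSemidef := fun v => (CP.id.mapTensor (hD v).cp).posSemidef (hmid v)
  have htr : ∀ v, (F v).trace = (Λ v * trFst Γ).trace := fun v => by
    rw [show (F v).trace = _ from (TP.id.mapTensor (hD v).tp) _, Matrix.mul_assoc,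
      Matrix.trace_mul_comm, Matrix.mul_assoc, Matrix.trace_mul_comm, ← Matrix.mul_kronecker_mul,
      Matrix.one_mul, hSΛ v, trace_one_kronecker_mul]
  have hsum : ∑ v, (Λ v * trFst Γ).trace.re = 1 := by
    rw [← Complex.re_sum, ← Matrix.trace_sum, ← Matrix.sum_mul, hΛ1, Matrix.one_mul,
      hΓ.trFst.2, Complex.one_re]
  -- The disturbance in the branch of the right outcome, plus the positive contributions of the
  -- wrong outcomes, of total trace `1 - p`.
  have e2 : idTensor K (⇑(∑ v, D v ∘ₗ conjMap (S v))) Γ - idTensor K (D w) Γ =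
      mapTensor LinearMap.id (D w) (((1 : Op K) ⊗ₖ S w) * Γ * ((1 : Op K) ⊗ₖ S w) - Γ) +
        ∑ v ∈ Finset.univ.erase w, F v := by
    rw [e1, ← Finset.add_sum_erase _ _ (Finset.mem_univ w), map_sub, idTensor_eq_mapTensor]
    abel
  have hle : (1 - Λ w).PosSemidef := by
    rw [← hΛ1, ← Finset.add_sum_erase _ _ (Finset.mem_univ w), add_sub_cancel_left]
    exact Matrix.posSemidef_sum _ fun v _ => hΛ v
  have hg : traceNorm (((1 : Op K) ⊗ₖ S w) * Γ * ((1 : Op K) ⊗ₖ S w) - Γ) ≤ 2 * √(1 - p) := by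
    have := traceNorm_gentle (E := (1 : Op K) ⊗ₖ Λ w) (S := (1 : Op K) ⊗ₖ S w) hΓ.1
      (by rw [hΓ.2]; simp) (by rw [one_sub_kronecker]; exact Matrix.PosSemidef.one.kronecker hle)
      (Matrix.PosSemidef.one.kronecker (hS w))
      (by rw [← Matrix.mul_kronecker_mul, Matrix.one_mul, hSΛ])
      (by
        rw [one_sub_kronecker, one_sub_kronecker, ← Matrix.mul_kronecker_mul, Matrix.one_mul]
        have : (1 : Op K) ⊗ₖ (1 - Λ w) - (1 : Op K) ⊗ₖ ((1 - S w) * (1 - S w)) =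
          (1 : Op K) ⊗ₖ (1 - Λ w - (1 - S w) * (1 - S w)) := by
          ext p q; simp only [kroneckerMap_apply, Matrix.sub_apply, mul_sub]
        rw [this]
        exact Matrix.PosSemidef.one.kronecker (hSg w))
    rwa [one_sub_kronecker, trace_one_kronecker_mul, Matrix.sub_mul, Matrix.one_mul,
      Matrix.trace_sub, Complex.sub_re, hΓ.trFst.2, Complex.one_re] at this
  rw [e2]
  have hherm := (hmid w).1.sub hΓ.1.1
  refine (traceNorm_add_le ((CP.id.mapTensor (hD w).cp).isHermitian hherm)
    (isHermitian_sum _ fun v _ => (hF v).1)).trans (add_le_add ?_ ?_)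
  · exact (traceNorm_map_le (CP.id.mapTensor (hD w).cp) (TP.id.mapTensor (hD w).tp) hherm).trans hg
  · rw [traceNorm_of_posSemidef (Matrix.posSemidef_sum _ fun v _ => hF v), Matrix.trace_sum,
      Complex.re_sum, ← hsum, ← Finset.add_sum_erase _ _ (Finset.mem_univ w), add_sub_cancel_left]
    simp only [htr, le_refl]

/-- Concavity of the square root, from Cauchy–Schwarz. It turns disturbances for single messages and
keys into one governed by the mean error. -/
lemma inv_card_mul_sum_sqrt_le [Nonempty κ] {f : κ → ℝ} (h : ∀ s, 0 ≤ f s) :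
    (Fintype.card κ : ℝ)⁻¹ * ∑ s, √(f s) ≤ √((Fintype.card κ : ℝ)⁻¹ * ∑ s, f s) := by
  have hc : (0 : ℝ) < Fintype.card κ := Nat.cast_pos.mpr Fintype.card_pos
  have h1 := Real.sum_sqrt_mul_sqrt_le (Finset.univ : Finset κ) (f := fun _ => 1) (g := f)
    (fun _ => zero_le_one) h
  simp only [Real.sqrt_one, one_mul, Finset.sum_const, Finset.card_univ, nsmul_eq_mul,
    mul_one] at h1
  refine Real.le_sqrt_of_sq_le ?_
  have h2 : (∑ s, √(f s)) ^ 2 ≤ Fintype.card κ * ∑ s, f s := by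
    have := pow_le_pow_left₀ (Finset.sum_nonneg fun s _ => Real.sqrt_nonneg _) h1 2
    rwa [mul_pow, Real.sq_sqrt hc.le, Real.sq_sqrt (Finset.sum_nonneg fun s _ => h s)] at this
  rw [mul_pow]
  calc ((Fintype.card κ : ℝ)⁻¹) ^ 2 * (∑ s, √(f s)) ^ 2
      ≤ ((Fintype.card κ : ℝ)⁻¹) ^ 2 * (Fintype.card κ * ∑ s, f s) := by gcongr
    _ = _ := by field_simp

lemma isDensity_maxEnt {M : ℕ} (hM : 1 ≤ M) : IsDensity (maxEnt M) := by
  refine ⟨Matrix.posSemidef_vecMulVec_self_star _, ?_⟩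
  have hM' : (0 : ℝ) < M := by exact_mod_cast hM
  simp only [maxEnt, ketbra, Matrix.trace, Matrix.diag, vecMulVec_apply, Pi.star_apply,
    Fintype.sum_prod_type, apply_ite star, star_zero, mul_ite, mul_zero, ite_mul, zero_mul]
  simp only [Finset.sum_ite_eq, Finset.mem_univ, if_true]
  simp only [Complex.star_def, Complex.conj_ofReal, ← Complex.ofReal_mul,
    Finset.sum_const, Finset.card_univ, Fintype.card_fin]
  rw [show 1 / √(M : ℝ) * (1 / √M) = (M : ℝ)⁻¹ by
    rw [div_mul_div_comm, one_mul, Real.mul_self_sqrt hM'.le, one_div]]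
  simp [mul_inv_cancel₀ (Nat.cast_ne_zero.mpr (Nat.one_le_iff_ne_zero.mp hM) : (M : ℂ) ≠ 0)]

/-- Combination of entanglement sharing codes for all messages with a measurement of the
message. -/
theorem exists_isCCESCode [DecidableEq B] {T : Op A →ₗ[ℂ] Op B} (hT : IsChannel T) {S M M' : ℕ}
    (hS : 1 ≤ S) (hM : 1 ≤ M) {Λ : Fin M → Op B} (hΛ : ∀ w, (Λ w).PosSemidef)
    (hΛ1 : ∑ w, Λ w = 1) {ρ : Fin M → Op B} (hρ : ∀ w, (ρ w).IsHermitian) {ε ζ e E : ℝ}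
    (hsucc : 1 - ε ≤ (1 / (M : ℝ)) * ∑ w, (Λ w * ρ w).trace.re)
    (hcode : ∀ w, InnerCode (Fin S) T (maxEnt M') (ρ w) e ζ)
    (hE : 2 * √(ε + ζ) + (ε + ζ) + e ≤ E) :
    ∃ (g : Fin S → Fin M → Op (Fin M' × A)) (D : Fin S → Op B →ₗ[ℂ] Op (Fin M × Fin M')),
      IsCCESCode T S M M' g D E ∧
      traceNorm (ccesOutput T S M M' g - (1 / (M : ℂ)) • ∑ w, ρ w) ≤ ζ := by
  have : Nonempty (Fin S) := ⟨⟨0, hS⟩⟩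
  have : Nonempty (Fin M) := ⟨⟨0, hM⟩⟩
  choose g D hg hD hent hcov using hcode
  have hle : ∀ w, (1 - Λ w).PosSemidef := fun w => by
    rw [← hΛ1, ← Finset.add_sum_erase _ _ (Finset.mem_univ w), add_sub_cancel_left]
    exact Matrix.posSemidef_sum _ fun v _ => hΛ v
  choose R hR hRΛ hRg using fun w => exists_sqrt_effect (hΛ w) (hle w)
  -- Bob measures `Λ` through its square roots `R`, records the outcome `w` and applies the
  -- entanglement decoder belonging to `w` and the key.
  let D' : Fin S → Op B →ₗ[ℂ] Op (Fin M × Fin M') := fun s =>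
    ∑ w, kronL (Matrix.single w w 1) ∘ₗ D w s ∘ₗ conjMap (R w)
  have htrF : ∀ s Y, trFst (D' s Y) = (∑ w, D w s ∘ₗ conjMap (R w)) Y := fun s Y => by
    change trFstL (D' s Y) = _
    simp only [D', LinearMap.sum_apply, map_sum]
    refine Finset.sum_congr rfl fun w _ => ?_
    rw [LinearMap.comp_apply, trFstL_kronL]; simp
  have htrS : ∀ s Y w, trSnd (D' s Y) w w = (Λ w * Y).trace := fun s Y w => by
    change trSndL (D' s Y) w w = _
    simp only [D', LinearMap.sum_apply, map_sum]
    rw [Matrix.sum_apply, Finset.sum_eq_single w]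
    · rw [LinearMap.comp_apply, trSndL_kronL, Matrix.smul_apply, Matrix.single_apply_same, smul_eq_mul, mul_one,
        LinearMap.comp_apply, (hD w s).tp, conjMap_apply, (hR w).1.eq, Matrix.trace_mul_comm,
        ← Matrix.mul_assoc, hRΛ]
    · intro v _ hv
      rw [LinearMap.comp_apply, trSndL_kronL, Matrix.smul_apply, Matrix.single_apply_of_ne _ _ _ _ _ (by tauto),
        smul_zero]
    · simp
  have hD' : ∀ s, IsChannel (D' s) := fun s => by
    refine CP.isChannel (CP.sum fun w => ?_) fun Y => ?_
    · refine (CP.kronL ?_).comp ((hD w s).cp.comp (CP.conj _))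
      rw [← Matrix.diagonal_single]
      refine Matrix.PosSemidef.diagonal fun i => ?_
      by_cases h : i = w
      · subst h; simp
      · simp [h]
    · rw [← trace_trSnd]
      have h1 : (trSnd (D' s Y)).trace = ∑ w, (Λ w * Y).trace :=
        Finset.sum_congr rfl fun w _ => htrS s Y w
      rw [h1, ← Matrix.trace_sum, ← Matrix.sum_mul, hΛ1, Matrix.one_mul]
  have hTh : ∀ s w, IsDensity (T (trFst (g w s))) := fun s w => hT.isDensity (hg w s).trFst
  have hρ' : ∀ w, (avg fun s => T (trFst (g w s))).IsHermitian :=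
    fun w => IsHermitian.avg fun s => (hTh s w).1.1
  let p : Fin M → Fin S → ℝ := fun w s => (Λ w * T (trFst (g w s))).trace.re
  have hpavg : ∀ w, (S : ℝ)⁻¹ * ∑ s, p w s = (Λ w * avg fun s => T (trFst (g w s))).trace.re := by
    intro w
    simp only [avg, Matrix.mul_smul, re_trace_smul, Matrix.mul_sum, Matrix.trace_sum,
      Complex.re_sum, Fintype.card_fin, p]
  have hp1 : ∀ w s, p w s ≤ 1 := fun w s => by
    have := re_trace_mul_le_of_effect (hle w) (hTh s w).1
    rwa [(hTh s w).2, Complex.one_re] at this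
  -- An effect cannot distinguish the key-averaged output from the cover output by more than their
  -- trace norm distance.
  have hpm : ∀ w, (Λ w * ρ w).trace.re - ζ ≤ (S : ℝ)⁻¹ * ∑ s, p w s := fun w => by
    rw [hpavg]
    have := re_trace_effect_mul_le ((hρ w).sub (hρ' w)) (hΛ w) (hle w)
    rw [Matrix.mul_sub, Matrix.trace_sub, Complex.sub_re, traceNorm_sub_comm] at this
    linarith [hcov w]
  have hM0 : (0 : ℝ) < M := by exact_mod_cast hM
  have hS0 : (0 : ℝ) < S := by exact_mod_cast hS
  have hpall : 1 - (ε + ζ) ≤ (M : ℝ)⁻¹ * ∑ w, (S : ℝ)⁻¹ * ∑ s, p w s := by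
    have : (M : ℝ)⁻¹ * ∑ w, ((Λ w * ρ w).trace.re - ζ) ≤
        (M : ℝ)⁻¹ * ∑ w, (S : ℝ)⁻¹ * ∑ s, p w s :=
      mul_le_mul_of_nonneg_left (Finset.sum_le_sum fun w _ => hpm w) (by positivity)
    rw [Finset.sum_sub_distrib, mul_sub, Finset.sum_const, Finset.card_univ, Fintype.card_fin,
      nsmul_eq_mul, inv_mul_cancel_left₀ hM0.ne'] at this
    rw [one_div] at hsucc
    linarith
  have hq : (M : ℝ)⁻¹ * ∑ w, (S : ℝ)⁻¹ * ∑ s, (1 - p w s) ≤ ε + ζ := by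
    simp only [Finset.sum_sub_distrib, mul_sub, Finset.sum_const, Finset.card_univ,
      Fintype.card_fin, nsmul_eq_mul, mul_one, inv_mul_cancel₀ hM0.ne', inv_mul_cancel₀ hS0.ne']
    linarith
  -- Concavity is applied twice, over keys and over messages, as only the mean of `1 - p w s` is
  -- controlled.
  have hq' : (M : ℝ)⁻¹ * ∑ w, (S : ℝ)⁻¹ * ∑ s, √(1 - p w s) ≤ √(ε + ζ) := by
    have h1 : ∀ w, (S : ℝ)⁻¹ * ∑ s, √(1 - p w s) ≤ √((S : ℝ)⁻¹ * ∑ s, (1 - p w s)) := fun w => by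
      have := inv_card_mul_sum_sqrt_le (f := fun s => 1 - p w s)
        (fun s => sub_nonneg.mpr (hp1 w s))
      rwa [Fintype.card_fin] at this
    have h2 := inv_card_mul_sum_sqrt_le (f := fun w => (S : ℝ)⁻¹ * ∑ s, (1 - p w s))
      (fun w => mul_nonneg (by positivity)
        (Finset.sum_nonneg fun s _ => sub_nonneg.mpr (hp1 w s)))
    rw [Fintype.card_fin] at h2
    exact (mul_le_mul_of_nonneg_left (Finset.sum_le_sum fun w _ => h1 w) (by positivity)).trans
      (h2.trans (Real.sqrt_le_sqrt hq))
  have hu : 0 ≤ ε + ζ := le_trans (mul_nonneg (by positivity) (Finset.sum_nonneg fun w _ =>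
    mul_nonneg (by positivity) (Finset.sum_nonneg fun s _ => sub_nonneg.mpr (hp1 w s)))) hq
  have he : 0 ≤ e := (traceNorm_nonneg _).trans (hent ⟨0, hM⟩)
  refine ⟨fun s w => g w s, D', ⟨fun s w => hg w s, hD', ?_, ?_⟩, ?_⟩
  · simp only [htrS]
    rw [Finset.sum_comm]
    have : (1 / ((S : ℝ) * M)) * ∑ w, ∑ s, (Λ w * T (trFst (g w s))).trace.re =
        (M : ℝ)⁻¹ * ∑ w, (S : ℝ)⁻¹ * ∑ s, p w s := by
      rw [← Finset.mul_sum, one_div, mul_inv]; ring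
    rw [this]
    linarith [Real.sqrt_nonneg (ε + ζ)]
  · rw [smul_sum_sum_eq_avg]
    have h1 : ∀ s, (fun Y => trFst (D' s (T Y))) =
        ⇑((∑ v, D v s ∘ₗ conjMap (R v)) ∘ₗ T) := fun s => funext fun Y => htrF s (T Y)
    let F : Fin M → Fin S → Op (Fin M' × Fin M') := fun w s =>
      idTensor (Fin M') (⇑(∑ v, D v s ∘ₗ conjMap (R v))) (idTensor (Fin M') T (g w s))
    let G : Fin M → Fin S → Op (Fin M' × Fin M') := fun w s =>
      idTensor (Fin M') (D w s) (idTensor (Fin M') T (g w s))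
    have hF : (fun w => avg fun s => idTensor (Fin M') (fun Y => trFst (D' s (T Y))) (g w s)) =
        fun w => avg fun s => F w s := by
      funext w
      congr 1
      funext s
      rw [h1 s]
      rfl
    rw [hF]
    have hΓ : ∀ w s, IsDensity (idTensor (Fin M') T (g w s)) := fun w s => (hg w s).idTensor hT
    have hFG : ∀ w s, traceNorm (F w s - G w s) ≤ 2 * √(1 - p w s) + (1 - p w s) := fun w s => by
      have := traceNorm_measured_sub_le hΛ hΛ1 hR hRΛ hRg (D := fun v => D v s)
        (fun v => hD v s) (hΓ w s) w
      rwa [trFst_idTensor] at this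
    have hFh : ∀ w s, (F w s).IsHermitian := fun w s => by
      refine (CP.id.mapTensor (CP.sum fun v => (hD v s).cp.comp (CP.conj _))).isHermitian ?_
      exact (hΓ w s).1.1
    have hGh : ∀ w s, (G w s).IsHermitian := fun w s => ((hΓ w s).idTensor (hD w s)).1.1
    have hΦh : (maxEnt M').IsHermitian := (Matrix.posSemidef_vecMulVec_self_star _).1
    have t1 : traceNorm ((avg fun w => avg fun s => F w s) - avg fun w => avg fun s => G w s) ≤
        2 * √(ε + ζ) + (ε + ζ) := by
      rw [← avg_sub]
      simp only [← avg_sub]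
      refine (traceNorm_avg_le fun w => IsHermitian.avg fun s => (hFh w s).sub (hGh w s)).trans ?_
      refine (mul_le_mul_of_nonneg_left (Finset.sum_le_sum fun w _ =>
        traceNorm_avg_le fun s => (hFh w s).sub (hGh w s)) (by positivity)).trans ?_
      refine (mul_le_mul_of_nonneg_left (Finset.sum_le_sum fun w _ =>
        mul_le_mul_of_nonneg_left (Finset.sum_le_sum fun s _ => hFG w s) (by positivity))
          (by positivity)).trans ?_
      simp only [Fintype.card_fin, Finset.sum_add_distrib, mul_add, ← Finset.mul_sum]
      have h3 : (M : ℝ)⁻¹ * ∑ w, (S : ℝ)⁻¹ * (2 * ∑ s, √(1 - p w s)) =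
          2 * ((M : ℝ)⁻¹ * ∑ w, (S : ℝ)⁻¹ * ∑ s, √(1 - p w s)) := by
        simp only [← Finset.mul_sum]; ring
      rw [← Finset.mul_sum] at hq hq'
      simp only [← Finset.mul_sum] at h3
      rw [h3]
      linarith
    have t2 : traceNorm ((avg fun w => avg fun s => G w s) - maxEnt M') ≤ e := by
      rw [← avg_const (κ := Fin M) (maxEnt M'), ← avg_sub]
      refine (traceNorm_avg_le fun w => (IsHermitian.avg (hGh w)).sub hΦh).trans ?_
      exact inv_card_mul_sum_le fun w => hent w
    refine (traceNorm_sub_le_add (IsHermitian.avg fun w => IsHermitian.avg (hFh w))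
      (IsHermitian.avg fun w => IsHermitian.avg (hGh w)) hΦh).trans ?_
    linarith
  · rw [ccesOutput, smul_sum_sum_eq_avg]
    have h2 : (1 / (M : ℂ)) • ∑ w, ρ w = avg ρ := by simp [avg]
    rw [h2, ← avg_sub]
    exact (traceNorm_avg_le fun w => (hρ' w).sub (hρ w)).trans
      (inv_card_mul_sum_le fun w => hcov w)

end Outer

/-! ## One-way protocols encrypted into a covert classical code -/

section Inner

variable {A B C D K Q A₁ A₂ B₁ B₂ K' Q' R κ : Type*}

lemma linearMap_sum_comp {ι V V' V'' : Type*} [AddCommMonoid V] [AddCommMonoid V']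
    [AddCommMonoid V''] [Module ℂ V] [Module ℂ V'] [Module ℂ V''] (s : Finset ι)
    (f : ι → V' →ₗ[ℂ] V'') (g : V →ₗ[ℂ] V') : (∑ i ∈ s, f i) ∘ₗ g = ∑ i ∈ s, f i ∘ₗ g := by
  ext x
  simp only [LinearMap.comp_apply, LinearMap.sum_apply]

lemma avg_sum {κ ι A : Type*} [Fintype κ] [Fintype A] (s : Finset ι) (f : ι → κ → Op A) :
    avg (fun x => ∑ i ∈ s, f i x) = ∑ i ∈ s, avg (f i) := by
  simp only [avg]
  rw [Finset.sum_comm, Finset.smul_sum]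

/-- Tensoring with a fixed operator on the right. -/
def kronR (Z : Op K) : Op A →ₗ[ℂ] Op (A × K) where
  toFun X := X ⊗ₖ Z
  map_add' X Y := by simp [Matrix.add_kronecker]
  map_smul' c X := by simp [Matrix.smul_kronecker]

/-- The tensor product of operators on `K × A₁` and `Q × A₂`, on `(K × Q) × (A₁ × A₂)`. -/
def box (X : Op (K × A₁)) (Y : Op (Q × A₂)) : Op ((K × Q) × (A₁ × A₂)) :=
  reindexL (Equiv.prodProdProdComm K A₁ Q A₂) (X ⊗ₖ Y)

lemma box_kronecker (X₁ : Op K) (Y₁ : Op A₁) (X₂ : Op Q) (Y₂ : Op A₂) :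
    box (X₁ ⊗ₖ Y₁) (X₂ ⊗ₖ Y₂) = (X₁ ⊗ₖ X₂) ⊗ₖ (Y₁ ⊗ₖ Y₂) := by
  ext p q
  simp only [box, reindexL_apply, kroneckerMap_apply, Equiv.prodProdProdComm_symm,
    Equiv.prodProdProdComm_apply]
  ring

/-- `box` is bilinear, so each of its arguments may be reduced to product operators in turn. -/
lemma box_ext_left {V : Type*} [AddCommMonoid V] [Module ℂ V] [Finite K] [Finite Q] [Finite A₁]
    [Finite A₂] {f g : Op ((K × Q) × (A₁ × A₂)) →ₗ[ℂ] V}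
    (h : ∀ (X₁ : Op K) (Y₁ : Op A₁) (X₂ : Op Q) (Y₂ : Op A₂),
      f ((X₁ ⊗ₖ X₂) ⊗ₖ (Y₁ ⊗ₖ Y₂)) = g ((X₁ ⊗ₖ X₂) ⊗ₖ (Y₁ ⊗ₖ Y₂)))
    (X : Op (K × A₁)) (Y : Op (Q × A₂)) : f (box X Y) = g (box X Y) := by
  let r := reindexL (Equiv.prodProdProdComm K A₁ Q A₂)
  have h1 : ∀ (X₁ : Op K) (Y₁ : Op A₁), f ∘ₗ r ∘ₗ kronL (X₁ ⊗ₖ Y₁) = g ∘ₗ r ∘ₗ kronL (X₁ ⊗ₖ Y₁) :=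
    fun X₁ Y₁ => kronecker_ext fun X₂ Y₂ => by
      change f (box (X₁ ⊗ₖ Y₁) (X₂ ⊗ₖ Y₂)) = g (box (X₁ ⊗ₖ Y₁) (X₂ ⊗ₖ Y₂))
      rw [box_kronecker, h]
  have h2 : f ∘ₗ r ∘ₗ kronR Y = g ∘ₗ r ∘ₗ kronR Y :=
    kronecker_ext fun X₁ Y₁ => LinearMap.congr_fun (h1 X₁ Y₁) Y
  exact LinearMap.congr_fun h2 X

lemma mapTensor_box [Finite K] [Finite Q] [Finite A₁] [Finite A₂] (V₁ : Op K →ₗ[ℂ] Op K')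
    (V₂ : Op Q →ₗ[ℂ] Op Q') (W₁ : Op A₁ →ₗ[ℂ] Op B₁) (W₂ : Op A₂ →ₗ[ℂ] Op B₂)
    (X : Op (K × A₁)) (Y : Op (Q × A₂)) :
    mapTensor (mapTensor V₁ V₂) (mapTensor W₁ W₂) (box X Y) =
      box (mapTensor V₁ W₁ X) (mapTensor V₂ W₂ Y) := by
  have h1 : mapTensor (mapTensor V₁ V₂) (mapTensor W₁ W₂) ∘ₗ
      reindexL (Equiv.prodProdProdComm K A₁ Q A₂) =
      reindexL (Equiv.prodProdProdComm K' B₁ Q' B₂) ∘ₗ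
        mapTensor (mapTensor V₁ W₁) (mapTensor V₂ W₂) := by
    refine LinearMap.ext fun Z => ?_
    have h2 := box_ext_left (f := mapTensor (mapTensor V₁ V₂) (mapTensor W₁ W₂))
      (g := reindexL (Equiv.prodProdProdComm K' B₁ Q' B₂) ∘ₗ
        mapTensor (mapTensor V₁ W₁) (mapTensor V₂ W₂) ∘ₗ
        reindexL (Equiv.prodProdProdComm K A₁ Q A₂).symm)
      (fun X₁ Y₁ X₂ Y₂ => by
        rw [← box_kronecker X₁ Y₁ X₂ Y₂]
        have e : reindexL (Equiv.prodProdProdComm K A₁ Q A₂).symm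
            (box (X₁ ⊗ₖ Y₁) (X₂ ⊗ₖ Y₂)) = (X₁ ⊗ₖ Y₁) ⊗ₖ (X₂ ⊗ₖ Y₂) := by
          ext p q; simp [box]
        rw [LinearMap.comp_apply, LinearMap.comp_apply, e]
        simp only [mapTensor_kronecker, box_kronecker]
        exact (box_kronecker _ _ _ _).symm)
    have h3 : ∀ X Y, (mapTensor (mapTensor V₁ V₂) (mapTensor W₁ W₂) ∘ₗ
        reindexL (Equiv.prodProdProdComm K A₁ Q A₂)) (X ⊗ₖ Y) =
        (reindexL (Equiv.prodProdProdComm K' B₁ Q' B₂) ∘ₗ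
        mapTensor (mapTensor V₁ W₁) (mapTensor V₂ W₂)) (X ⊗ₖ Y) := fun X Y => by
      refine (h2 X Y).trans ?_
      have e : reindexL (Equiv.prodProdProdComm K A₁ Q A₂).symm (box X Y) = X ⊗ₖ Y := by
        ext p q; simp [box]
      rw [LinearMap.comp_apply, LinearMap.comp_apply, e, LinearMap.comp_apply]
    exact LinearMap.congr_fun (kronecker_ext h3) Z
  have := LinearMap.congr_fun h1 (X ⊗ₖ Y)
  rw [LinearMap.comp_apply, LinearMap.comp_apply, mapTensor_kronecker] at this
  exact this

lemma mapTensor_id_id : mapTensor (LinearMap.id : Op K →ₗ[ℂ] Op K)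
    (LinearMap.id : Op A →ₗ[ℂ] Op A) = LinearMap.id := rfl

lemma trFst_box [Fintype K] [Fintype Q] (X : Op (K × A₁)) (Y : Op (Q × A₂)) :
    trFst (box X Y) = trFst X ⊗ₖ trFst Y := by
  ext p q
  simp only [trFst, box, reindexL_apply, kroneckerMap_apply, Equiv.prodProdProdComm_symm,
    Equiv.prodProdProdComm_apply, Fintype.sum_prod_type, Finset.sum_mul_sum]

variable [Fintype A] [Fintype B] [Fintype C] [Fintype D] [Fintype K] [Fintype Q] [Fintype A₁]
  [Fintype A₂] [Fintype B₁] [Fintype B₂] [Fintype K'] [Fintype Q'] [Fintype R] [Fintype κ]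

lemma trace_box (X : Op (K × A₁)) (Y : Op (Q × A₂)) :
    (box X Y).trace = X.trace * Y.trace := by
  rw [box, TP.reindexL, Matrix.trace_kronecker]

lemma posSemidef_box {X : Op (K × A₁)} {Y : Op (Q × A₂)} (hX : X.PosSemidef)
    (hY : Y.PosSemidef) : (box X Y).PosSemidef := (CP.reindexL _).posSemidef (hX.kronecker hY)

omit [Fintype A] [Fintype B] in
lemma isHermitian_kronecker {X : Op A} {Y : Op B} (hX : X.IsHermitian) (hY : Y.IsHermitian) :
    (X ⊗ₖ Y).IsHermitian := by
  rw [Matrix.IsHermitian, Matrix.conjTranspose_kronecker, hX.eq, hY.eq]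

lemma isHermitian_box {X : Op (K × A₁)} {Y : Op (Q × A₂)} (hX : X.IsHermitian)
    (hY : Y.IsHermitian) : (box X Y).IsHermitian :=
  (CP.reindexL _).isHermitian (isHermitian_kronecker hX hY)

lemma traceNorm_kronecker_le' [DecidableEq A] [DecidableEq B] {Z : Op A} {G : Op B}
    (hZ : Z.IsHermitian) (hG : G.PosSemidef) :
    traceNorm (Z ⊗ₖ G) ≤ G.trace.re * traceNorm Z := by
  have : Z ⊗ₖ G = reindexL (Equiv.prodComm B A) (G ⊗ₖ Z) := by
    ext p q; simp [kroneckerMap_apply, mul_comm]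
  rw [this]
  exact (traceNorm_map_le (CP.reindexL _) (TP.reindexL _) (isHermitian_kronecker hG.1 hZ)).trans
    (traceNorm_kronecker_le hG hZ)

section

variable [DecidableEq K] [DecidableEq Q] [DecidableEq A₁] [DecidableEq A₂]

lemma traceNorm_box_le {X : Op (K × A₁)} {Y : Op (Q × A₂)} (hX : X.PosSemidef)
    (hY : Y.IsHermitian) : traceNorm (box X Y) ≤ X.trace.re * traceNorm Y :=
  (traceNorm_map_le (CP.reindexL _) (TP.reindexL _) (isHermitian_kronecker hX.1 hY)).trans
    (traceNorm_kronecker_le hX hY)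

lemma traceNorm_box_le' {X : Op (K × A₁)} {Y : Op (Q × A₂)} (hX : X.IsHermitian)
    (hY : Y.PosSemidef) : traceNorm (box X Y) ≤ Y.trace.re * traceNorm X :=
  (traceNorm_map_le (CP.reindexL _) (TP.reindexL _) (isHermitian_kronecker hX hY.1)).trans
    (traceNorm_kronecker_le' hX hY)

end

omit [Fintype K] [Fintype Q] [Fintype A₁] [Fintype A₂] in
lemma box_sub (X : Op (K × A₁)) (Y Z : Op (Q × A₂)) : box X (Y - Z) = box X Y - box X Z := by
  ext p q; simp [box, mul_sub]

omit [Fintype K] [Fintype Q] [Fintype A₁] [Fintype A₂] in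
lemma sub_box (X Y : Op (K × A₁)) (Z : Op (Q × A₂)) : box (X - Y) Z = box X Z - box Y Z := by
  ext p q; simp [box, sub_mul]

omit [Fintype K] [Fintype Q] [Fintype A₁] [Fintype A₂] in
lemma sum_box (X : C → Op (K × A₁)) (Z : Op (Q × A₂)) :
    box (∑ c, X c) Z = ∑ c, box (X c) Z := by
  ext p q; simp [box, Matrix.sum_apply, Finset.sum_mul]

/-- `σ` can be transformed into `Ω`, up to `e`, with one-way communication of a message in `C`. -/
def OneWay [DecidableEq K] [DecidableEq K'] (C : Type*) [Fintype C] (σ : Op (R × B))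
    (Ω : Op (K × K')) (e : ℝ) : Prop :=
  ∃ (E : C → Op R →ₗ[ℂ] Op K) (D : C → Op B →ₗ[ℂ] Op K'), (∀ c, CP (E c)) ∧ TP (∑ c, E c) ∧
    (∀ c, IsChannel (D c)) ∧ traceNorm (∑ c, mapTensor (E c) (D c) σ - Ω) ≤ e

/-- A code with messages in `C` and keys in `κ` over `T`, generating in addition `Ψ`; the average
error is `δ` and the average output is `ζ`-close to `ρ`. -/
def CovertCode [DecidableEq B] [DecidableEq Q] [DecidableEq Q'] (C κ : Type*) [Fintype C]
    [Fintype κ] (T : Op A →ₗ[ℂ] Op B) (Ψ : Op (Q × Q')) (ρ : Op B) (δ ζ : ℝ) : Prop :=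
  ∃ (θ : C × κ → Op (Q × A)) (Υ : κ → C → Op B →ₗ[ℂ] Op Q'), (∀ x, IsDensity (θ x)) ∧
    (∀ k m, CP (Υ k m)) ∧ (∀ k, TP (∑ m, Υ k m)) ∧
    (Fintype.card (C × κ) : ℝ)⁻¹ *
      ∑ x : C × κ, traceNorm (idTensor Q (Υ x.2 x.1 ∘ₗ T) (θ x) - Ψ) ≤ δ ∧
    traceNorm (avg (fun x => T (trFst (θ x))) - ρ) ≤ ζ

/-- One-time pad encryption of the messages of a one-way protocol into a covert code. -/
theorem OneWay.innerCode [AddGroup C] [Nonempty κ] [DecidableEq K] [DecidableEq K']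
    [DecidableEq Q] [DecidableEq Q'] [DecidableEq B₁] [DecidableEq B₂]
    {T₁ : Op A₁ →ₗ[ℂ] Op B₁} {T₂ : Op A₂ →ₗ[ℂ] Op B₂} (hT₁ : IsChannel T₁) (hT₂ : IsChannel T₂)
    {ψ : Op (R × A₁)} (hψ : IsDensity ψ) {Ω : Op (K × K')} (hΩ : Ω.IsHermitian)
    {Ψ : Op (Q × Q')} (hΨ : IsDensity Ψ) {ρ : Op B₂} (hρ : ρ.IsHermitian) {e δ ζ : ℝ}
    (h1 : OneWay C (idTensor R T₁ ψ) Ω e) (h2 : CovertCode C κ T₂ Ψ ρ δ ζ) :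
    InnerCode (C × κ) (mapTensor T₁ T₂) (box Ω Ψ) (T₁ (trFst ψ) ⊗ₖ ρ) (e + 2 * δ) ζ := by
  classical
  obtain ⟨E, D, hE, hEt, hD, he⟩ := h1
  obtain ⟨θ, Υ, hθ, hΥ, hΥt, hδ, hζ⟩ := h2
  set σ := idTensor R T₁ ψ with hσ
  have hσd : IsDensity σ := hψ.idTensor hT₁
  have hneC : Nonempty C := ⟨0⟩
  -- Alice applies her instrument to `R` before transmission. `ω c` is the unnormalized state for
  -- outcome `c`, with the probability of `c` as its trace.
  let ω : C → Op (K × A₁) := fun c => mapTensor (E c) LinearMap.id ψ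
  have hω : ∀ c, (ω c).PosSemidef := fun c => ((hE c).mapTensor CP.id).posSemidef hψ.1
  have hωsum : ∑ c, ω c = mapTensor (∑ c, E c) LinearMap.id ψ := by
    rw [mapTensor_sum_left, LinearMap.sum_apply]
  -- The component `s.1` of the key encrypts the outcome `c`; `s.2` is the key of the covert code.
  -- Below, the branch of `Υ` that decodes `c + s.1` selects Bob's operation `D c`.
  let g : C × κ → Op ((K × Q) × (A₁ × A₂)) := fun s => ∑ c, box (ω c) (θ (c + s.1, s.2))
  let D' : C × κ → Op (B₁ × B₂) →ₗ[ℂ] Op (K' × Q') := fun s =>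
    ∑ c, mapTensor (D c) (Υ s.2 (c + s.1))
  have hg : ∀ s, IsDensity (g s) := fun s => by
    refine ⟨Matrix.posSemidef_sum _ fun c _ => posSemidef_box (hω c) (hθ _).1, ?_⟩
    simp only [g, Matrix.trace_sum, trace_box, (hθ _).2, mul_one]
    rw [← Matrix.trace_sum, hωsum, (hEt.mapTensor TP.id), hψ.2]
  have hD' : ∀ s, IsChannel (D' s) := fun s => by
    refine CP.isChannel (CP.sum fun c => (hD c).cp.mapTensor (hΥ _ _)) fun X => ?_
    simp only [D', LinearMap.sum_apply, Matrix.trace_sum]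
    simp only [← trace_trFst (mapTensor (D _) _ _), trFst_mapTensor (hD _).tp]
    rw [← trace_trFst X, ← hΥt s.2 (trFst X), LinearMap.sum_apply, Matrix.trace_sum]
    exact Equiv.sum_comp (Equiv.addRight s.1) fun m => (Υ s.2 m (trFst X)).trace
  let G : C → C → Op (K × K') := fun c c' => mapTensor (E c) (D c') σ
  let χ : κ → C → C → Op (Q × Q') := fun k m' m => idTensor Q (Υ k m' ∘ₗ T₂) (θ (m, k))
  have hG : ∀ c c', (G c c').PosSemidef := fun c c' =>
    ((hE c).mapTensor (hD c').cp).posSemidef hσd.1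
  have hχ : ∀ k m' m, (χ k m' m).PosSemidef := fun k m' m =>
    (CP.id.mapTensor ((hΥ k m').comp hT₂.cp)).posSemidef (hθ _).1
  let p : C → ℝ := fun c => (E c (trSnd σ)).trace.re
  -- Whatever value `c'` Bob decodes, his operation preserves the trace, so the weight is the
  -- probability of Alice's outcome.
  have hGp : ∀ c c', (G c c').trace.re = p c := fun c c' => by
    simp only [G, trace_mapTensor_of_right _ (hD c').tp, p]
  have hp0 : ∀ c, 0 ≤ p c := fun c => by rw [← hGp c c]; exact re_trace_nonneg (hG c c)
  have hp1 : ∑ c, p c = 1 := by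
    simp only [p]
    rw [← Complex.re_sum, ← Matrix.trace_sum, ← LinearMap.sum_apply, hEt, trace_trSnd, hσd.2,
      Complex.one_re]
  have hχ1 : ∀ k m, ∑ m', (χ k m' m).trace.re = 1 := fun k m => by
    have h3 : ∀ m', (χ k m' m).trace = (Υ k m' (T₂ (trFst (θ (m, k))))).trace := fun m' => by
      simp only [χ, ← trace_trFst (idTensor _ _ _), trFst_idTensor, LinearMap.comp_apply]
    simp only [h3]
    rw [← Complex.re_sum, ← Matrix.trace_sum, ← LinearMap.sum_apply, hΥt, hT₂.tp, trace_trFst,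
      (hθ _).2, Complex.one_re]
  let d : C × κ → ℝ := fun x => traceNorm (χ x.2 x.1 x.1 - Ψ)
  -- Here `c` is the value sent and `c'` the value decoded; the protocol works as intended on the
  -- terms with `c' = c`.
  have hout : ∀ s, idTensor (K × Q) (D' s ∘ₗ mapTensor T₁ T₂) (g s) =
      ∑ c, ∑ c', box (G c c') (χ s.2 (c' + s.1) (c + s.1)) := fun s => by
    rw [idTensor_eq_mapTensor]
    simp only [g, map_sum]
    refine Finset.sum_congr rfl fun c _ => ?_
    have : D' s ∘ₗ mapTensor T₁ T₂ = ∑ c', mapTensor (D c' ∘ₗ T₁) (Υ s.2 (c' + s.1) ∘ₗ T₂) := by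
      simp only [D', linearMap_sum_comp, ← mapTensor_comp]
    rw [this, mapTensor_sum_right, LinearMap.sum_apply]
    refine Finset.sum_congr rfl fun c' _ => ?_
    rw [← mapTensor_id_id, mapTensor_box]
    congr 1
    simp only [ω, G, σ, idTensor_eq_mapTensor, ← LinearMap.comp_apply, ← mapTensor_comp,
      LinearMap.comp_id, LinearMap.id_comp]
  have hd : ∀ s, traceNorm (idTensor (K × Q) (D' s ∘ₗ mapTensor T₁ T₂) (g s) -
      box (∑ c, G c c) Ψ) ≤ ∑ c, p c * (2 * d (c + s.1, s.2)) := fun s => by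
    rw [hout, sum_box, ← Finset.sum_sub_distrib]
    have hsplit : ∀ c, ∑ c', box (G c c') (χ s.2 (c' + s.1) (c + s.1)) - box (G c c) Ψ =
        box (G c c) (χ s.2 (c + s.1) (c + s.1) - Ψ) +
          ∑ c' ∈ Finset.univ.erase c, box (G c c') (χ s.2 (c' + s.1) (c + s.1)) := fun c => by
      rw [← Finset.add_sum_erase _ _ (Finset.mem_univ c), box_sub]
      abel
    have hP : ∀ c, (∑ c' ∈ Finset.univ.erase c,
        box (G c c') (χ s.2 (c' + s.1) (c + s.1))).PosSemidef := fun c =>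
      Matrix.posSemidef_sum _ fun c' _ => posSemidef_box (hG _ _) (hχ _ _ _)
    have hH : ∀ c, (χ s.2 (c + s.1) (c + s.1) - Ψ).IsHermitian := fun c =>
      (hχ _ _ _).1.sub hΨ.1.1
    have hHb : ∀ c, (box (G c c) (χ s.2 (c + s.1) (c + s.1) - Ψ)).IsHermitian := fun c =>
      isHermitian_box (hG c c).1 (hH c)
    simp only [hsplit]
    refine (traceNorm_sum_le _ fun c _ => (hHb c).add (hP c).1).trans
      (Finset.sum_le_sum fun c _ => ?_)
    refine (traceNorm_add_le (hHb c) (hP c).1).trans ?_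
    have t1 := traceNorm_box_le (hG c c) (hH c)
    rw [hGp] at t1
    -- The total weight of wrong decodings is `1` minus the trace of the correct branch, hence also
    -- at most the distance `d`. Together with `t1` this is the factor `2` before `δ`.
    have t2 : traceNorm (∑ c' ∈ Finset.univ.erase c,
        box (G c c') (χ s.2 (c' + s.1) (c + s.1))) ≤ p c * d (c + s.1, s.2) := by
      rw [traceNorm_of_posSemidef (hP c), Matrix.trace_sum, Complex.re_sum]
      have h4 : ∀ c', (box (G c c') (χ s.2 (c' + s.1) (c + s.1))).trace.re =
          p c * (χ s.2 (c' + s.1) (c + s.1)).trace.re := fun c' => by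
        rw [trace_box, trace_eq_re (hG c c').1, hGp, Complex.re_ofReal_mul]
      simp only [h4, ← Finset.mul_sum]
      refine mul_le_mul_of_nonneg_left ?_ (hp0 c)
      have h5 : ∑ c', (χ s.2 (c' + s.1) (c + s.1)).trace.re = 1 := by
        rw [← hχ1 s.2 (c + s.1)]
        exact Equiv.sum_comp (Equiv.addRight s.1) fun m' => (χ s.2 m' (c + s.1)).trace.re
      rw [← Finset.add_sum_erase _ _ (Finset.mem_univ c)] at h5
      have h6 := re_trace_effect_mul_le (E := 1) (hΨ.1.1.sub (hχ s.2 (c + s.1) (c + s.1)).1)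
        Matrix.PosSemidef.one (by simpa using Matrix.PosSemidef.zero)
      rw [Matrix.one_mul, Matrix.trace_sub, Complex.sub_re, hΨ.2, Complex.one_re,
        traceNorm_sub_comm] at h6
      simp only [d]
      linarith
    have : p c * (2 * d (c + s.1, s.2)) = p c * d (c + s.1, s.2) + p c * d (c + s.1, s.2) := by ring
    rw [this]
    exact add_le_add t1 t2
  -- Translation by `c` permutes the keys, so an average-error covert code suffices although the
  -- outcome `c` need not be uniform.
  have havg : ∀ c, ∑ s : C × κ, d (c + s.1, s.2) = ∑ s, d s := fun c =>
    Equiv.sum_comp ((Equiv.addLeft c).prodCongr (Equiv.refl κ)) d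
  have hoh : ∀ s, (idTensor (K × Q) (D' s ∘ₗ mapTensor T₁ T₂) (g s)).IsHermitian := fun s =>
    (CP.id.mapTensor ((hD' s).cp.comp (hT₁.cp.mapTensor hT₂.cp))).isHermitian (hg s).1.1
  have hsG : (∑ c, G c c).PosSemidef := Matrix.posSemidef_sum _ fun c _ => hG c c
  have hbox : (box (∑ c, G c c) Ψ).IsHermitian := isHermitian_box hsG.1 hΨ.1.1
  refine ⟨g, D', hg, hD', ?_, ?_⟩
  · refine (traceNorm_sub_le_add (IsHermitian.avg hoh) hbox
      (isHermitian_box hΩ hΨ.1.1)).trans ?_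
    rw [add_comm]
    refine add_le_add ?_ ?_
    · rw [← sub_box]
      refine (traceNorm_box_le' (hsG.1.sub hΩ) hΨ.1).trans ?_
      rw [hΨ.2, Complex.one_re, one_mul]
      exact he
    · rw [← avg_const (κ := C × κ) (box (∑ c, G c c) Ψ), ← avg_sub]
      refine (traceNorm_avg_le fun s => (hoh s).sub hbox).trans ?_
      refine (mul_le_mul_of_nonneg_left (Finset.sum_le_sum fun s _ => hd s)
        (by positivity)).trans ?_
      rw [Finset.sum_comm]
      simp only [← Finset.mul_sum, havg]
      rw [← Finset.sum_mul, hp1, one_mul]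
      calc _ = 2 * ((Fintype.card (C × κ) : ℝ)⁻¹ * ∑ x, d x) := by ring
        _ ≤ 2 * δ := by
          have : (Fintype.card (C × κ) : ℝ)⁻¹ * ∑ x, d x ≤ δ := hδ
          linarith
  · have hτ : ∀ s, mapTensor T₁ T₂ (trFst (g s)) =
        ∑ c, T₁ (trFst (ω c)) ⊗ₖ T₂ (trFst (θ (c + s.1, s.2))) := fun s => by
      have : trFst (g s) = ∑ c, trFst (ω c) ⊗ₖ trFst (θ (c + s.1, s.2)) := by
        change trFstL (g s) = _
        simp only [g, map_sum]
        exact Finset.sum_congr rfl fun c _ => trFst_box _ _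
      rw [this, map_sum]
      simp only [mapTensor_kronecker]
    -- The one-time pad: for every `c` the average over `s` gives the same second factor, so the
    -- blocks decouple and the first recombines to the exact marginal.
    have h7 : avg (fun s => mapTensor T₁ T₂ (trFst (g s))) =
        T₁ (trFst ψ) ⊗ₖ avg (fun x => T₂ (trFst (θ x))) := by
      have e1 : ∀ c, avg (fun s : C × κ => T₁ (trFst (ω c)) ⊗ₖ T₂ (trFst (θ (c + s.1, s.2)))) =
          T₁ (trFst (ω c)) ⊗ₖ avg (fun x => T₂ (trFst (θ x))) := fun c => by
        exact (avg_equiv ((Equiv.addLeft c).prodCongr (Equiv.refl κ))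
          fun x => T₁ (trFst (ω c)) ⊗ₖ T₂ (trFst (θ x))).trans
          (map_avg (kronL (T₁ (trFst (ω c)))) fun x => T₂ (trFst (θ x))).symm
      have e2 : ∑ c, T₁ (trFst (ω c)) = T₁ (trFst ψ) := by
        rw [← map_sum]
        congr 1
        change ∑ c, trFstL (ω c) = _
        rw [← map_sum, hωsum]
        exact trFst_mapTensor hEt _ ψ
      simp only [hτ]
      rw [← e2]
      have e3 : ∀ Z : Op B₂, (∑ c, T₁ (trFst (ω c))) ⊗ₖ Z = ∑ c, T₁ (trFst (ω c)) ⊗ₖ Z := fun Z =>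
        map_sum (kronR Z) _ _
      rw [e3]
      rw [avg_sum]
      exact Finset.sum_congr rfl fun c _ => e1 c
    have h8 : T₁ (trFst ψ) ⊗ₖ avg (fun x => T₂ (trFst (θ x))) - T₁ (trFst ψ) ⊗ₖ ρ =
        T₁ (trFst ψ) ⊗ₖ (avg (fun x => T₂ (trFst (θ x))) - ρ) :=
      (map_sub (kronL (T₁ (trFst ψ))) _ _).symm
    rw [h7, h8]
    have h9 := hT₁.isDensity hψ.trFst
    refine (traceNorm_kronecker_le h9.1
      ((IsHermitian.avg fun x => (hT₂.isDensity (hθ x).trFst).1.1).sub hρ)).trans ?_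
    rw [h9.2, Complex.one_re, one_mul]
    exact hζ

/-! ### Modifications of codes -/

/-- The second protocol as a whole is a trace-preserving completely positive map, so it does not
increase the error of the first, and the errors add. -/
lemma OneWay.comp {C' : Type*} [Fintype C'] [DecidableEq K] [DecidableEq K'] [DecidableEq Q]
    [DecidableEq Q'] {σ : Op (R × B)} (hσ : IsDensity σ) {Ω : Op (K × K')} (hΩ : Ω.IsHermitian)
    {Ω' : Op (Q × Q')} (hΩ' : Ω'.IsHermitian) {e e' : ℝ} (h : OneWay C σ Ω e)
    (h' : OneWay C' Ω Ω' e') : OneWay (C × C') σ Ω' (e + e') := by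
  obtain ⟨E, D, hE, hEt, hD, he⟩ := h
  obtain ⟨E', D', hE', hEt', hD', he'⟩ := h'
  let F : Op (K × K') →ₗ[ℂ] Op (Q × Q') := ∑ c', mapTensor (E' c') (D' c')
  have hF : CP F := CP.sum fun c' => (hE' c').mapTensor (hD' c').cp
  have hFt : TP F := fun X => by
    simp only [F, LinearMap.sum_apply, Matrix.trace_sum, trace_mapTensor_of_right _ (hD' _).tp]
    rw [← Matrix.trace_sum, ← LinearMap.sum_apply, hEt', trace_trSnd]
  have hG : (∑ c, mapTensor (E c) (D c) σ).IsHermitian :=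
    isHermitian_sum _ fun c _ => ((hE c).mapTensor (hD c).cp).isHermitian hσ.1.1
  refine ⟨fun x => E' x.2 ∘ₗ E x.1, fun x => D' x.2 ∘ₗ D x.1, fun x => (hE' _).comp (hE _), ?_,
    fun x => (hD' _).comp (hD _), ?_⟩
  · have : ∑ x : C × C', E' x.2 ∘ₗ E x.1 = (∑ c', E' c') ∘ₗ ∑ c, E c := by
      rw [Fintype.sum_prod_type, Finset.sum_comm, linearMap_sum_comp]
      exact Finset.sum_congr rfl fun c' _ => by
        ext1 X
        simp only [LinearMap.comp_apply, LinearMap.sum_apply, map_sum]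
    rw [this]
    exact hEt'.comp hEt
  · have : ∑ x : C × C', mapTensor (E' x.2 ∘ₗ E x.1) (D' x.2 ∘ₗ D x.1) σ =
        F (∑ c, mapTensor (E c) (D c) σ) := by
      simp only [mapTensor_comp, LinearMap.comp_apply]
      rw [Fintype.sum_prod_type, map_sum]
      simp only [F, LinearMap.sum_apply]
    rw [this]
    have hFΩ : (F Ω - Ω').IsHermitian := (hF.isHermitian hΩ).sub hΩ'
    have h3 : F (∑ c, mapTensor (E c) (D c) σ) - Ω' =
        F (∑ c, mapTensor (E c) (D c) σ - Ω) + (F Ω - Ω') := by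
      rw [map_sub]; abel
    rw [h3]
    refine (traceNorm_add_le (hF.isHermitian (hG.sub hΩ)) hFΩ).trans (add_le_add ?_ ?_)
    · exact (traceNorm_map_le hF hFt (hG.sub hΩ)).trans he
    · simpa only [F, LinearMap.sum_apply] using he'

/-- A protocol without communication is a protocol with any communication. -/
lemma OneWay.of_local [Nonempty C] [DecidableEq K] [DecidableEq K'] {σ : Op (R × B)}
    {Ω : Op (K × K')} {e : ℝ} {V : Op R →ₗ[ℂ] Op K} {W : Op B →ₗ[ℂ] Op K'} (hV : IsChannel V)
    (hW : IsChannel W) (h : traceNorm (mapTensor V W σ - Ω) ≤ e) : OneWay C σ Ω e := by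
  classical
  obtain ⟨c₀⟩ := ‹Nonempty C›
  have hs : ∑ c, (if c = c₀ then V else 0) = V := by simp
  refine ⟨fun c => if c = c₀ then V else 0, fun _ => W, fun c => ?_, by rw [hs]; exact hV.tp,
    fun _ => hW, ?_⟩
  · dsimp only
    split_ifs
    · exact hV.cp
    · exact CP.of_kraus (fun i : Fin 0 => i.elim0) (by simp)
  · rwa [← LinearMap.sum_apply, ← mapTensor_sum_left, hs]

/-- Alice's channel acts on the part she keeps, so the input marginal is untouched and the output of
the code stays the same. -/
lemma InnerCode.local [DecidableEq B] [DecidableEq C] [DecidableEq K] [DecidableEq K']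
    [DecidableEq D] {T : Op A →ₗ[ℂ] Op B} (hT : IsChannel T)
    {Ω : Op (K × C)} (hΩ : Ω.IsHermitian) {Ω' : Op (K' × D)} (hΩ' : Ω'.IsHermitian)
    {ρ : Op B} {e e' δ : ℝ} (h : InnerCode κ T Ω ρ e δ) {V : Op K →ₗ[ℂ] Op K'}
    {W : Op C →ₗ[ℂ] Op D} (hV : IsChannel V) (hW : IsChannel W)
    (he' : traceNorm (mapTensor V W Ω - Ω') ≤ e') : InnerCode κ T Ω' ρ (e + e') δ := by
  obtain ⟨g, F, hg, hF, he, hδ⟩ := h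
  have hVW := hV.cp.mapTensor hW.cp
  refine ⟨fun s => tensorId A V (g s), fun s => W ∘ₗ F s, fun s => ?_, fun s => hW.comp (hF s),
    ?_, ?_⟩
  · change IsDensity (mapTensor V LinearMap.id (g s))
    exact ⟨(hV.cp.mapTensor CP.id).posSemidef (hg s).1,
      ((hV.tp.mapTensor TP.id) _).trans (hg s).2⟩
  · have h1 : ∀ s, idTensor K' ((W ∘ₗ F s) ∘ₗ T) (tensorId A V (g s)) =
        mapTensor V W (idTensor K (F s ∘ₗ T) (g s)) := fun s => by
      simp only [tensorId_eq_mapTensor, idTensor_eq_mapTensor, ← LinearMap.comp_apply,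
        ← mapTensor_comp, LinearMap.comp_id, LinearMap.id_comp, LinearMap.comp_assoc]
    have hh : (avg fun s => idTensor K (F s ∘ₗ T) (g s)).IsHermitian := IsHermitian.avg fun s =>
      (CP.id.mapTensor ((hF s).cp.comp hT.cp)).isHermitian (hg s).1.1
    simp only [h1]
    rw [← map_avg]
    refine (traceNorm_sub_le_add (hVW.isHermitian hh) (hVW.isHermitian hΩ) hΩ').trans
      (add_le_add ?_ he')
    rw [← map_sub]
    exact (traceNorm_map_le hVW (hV.tp.mapTensor hW.tp) (hh.sub hΩ)).trans he
  · have : ∀ s, trFst (tensorId A V (g s)) = trFst (g s) := fun s =>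
      trFst_mapTensor hV.tp (LinearMap.id : Op A →ₗ[ℂ] Op A) (g s)
    simpa only [this] using hδ

lemma InnerCode.reindex_keys {κ' : Type*} [Fintype κ'] [DecidableEq B] [DecidableEq C]
    [DecidableEq K] {T : Op A →ₗ[ℂ] Op B} {Ω : Op (K × C)} {ρ : Op B} {e δ : ℝ}
    (h : InnerCode κ T Ω ρ e δ) (f : κ' ≃ κ) : InnerCode κ' T Ω ρ e δ := by
  obtain ⟨g, F, hg, hF, he, hδ⟩ := h
  refine ⟨fun s => g (f s), fun s => F (f s), fun s => hg _, fun s => hF _, ?_, ?_⟩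
  · rwa [avg_equiv f fun s => idTensor K (F s ∘ₗ T) (g s)]
  · rwa [avg_equiv f fun s => T (trFst (g s))]

lemma InnerCode.mono [DecidableEq B] [DecidableEq C] [DecidableEq K]
    {T : Op A →ₗ[ℂ] Op B} {Ω : Op (K × C)} {ρ : Op B} {e e' δ : ℝ}
    (h : InnerCode κ T Ω ρ e δ) (hle : e ≤ e') : InnerCode κ T Ω ρ e' δ := by
  obtain ⟨g, F, hg, hF, he, hδ⟩ := h
  exact ⟨g, F, hg, hF, he.trans hle, hδ⟩

/-- Relabelling of the input and output spaces of the channel. -/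
lemma InnerCode.reindex [DecidableEq B] [DecidableEq C] [DecidableEq K] [DecidableEq B₁]
    {T : Op A →ₗ[ℂ] Op B} (hT : IsChannel T) {Ω : Op (K × C)} {ρ : Op B} (hρ : ρ.IsHermitian)
    {e δ : ℝ} (h : InnerCode κ T Ω ρ e δ) (f : A ≃ A₁) (f' : B ≃ B₁)
    {T' : Op A₁ →ₗ[ℂ] Op B₁} (hT' : T' ∘ₗ reindexL f = reindexL f' ∘ₗ T) :
    InnerCode κ T' Ω (reindexL f' ρ) e δ := by
  obtain ⟨g, F, hg, hF, he, hδ⟩ := h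
  have h0 : reindexL f'.symm ∘ₗ reindexL f' = LinearMap.id := by ext X; simp
  refine ⟨fun s => idTensor K (reindexL f) (g s), fun s => F s ∘ₗ reindexL f'.symm, fun s =>
    (hg s).idTensor ((CP.reindexL f).isChannel (TP.reindexL f)), fun s => (hF s).comp
    ((CP.reindexL _).isChannel (TP.reindexL _)), ?_, ?_⟩
  · have h1 : ∀ s, idTensor K ((F s ∘ₗ reindexL f'.symm) ∘ₗ T') (idTensor K (reindexL f) (g s)) =
        idTensor K (F s ∘ₗ T) (g s) := fun s => by
      simp only [idTensor_eq_mapTensor, ← LinearMap.comp_apply, ← mapTensor_comp,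
        LinearMap.comp_assoc, hT', LinearMap.id_comp]
      rw [← LinearMap.comp_assoc T (reindexL f') (reindexL f'.symm), h0, LinearMap.id_comp]
    simpa only [h1] using he
  · have h2 : ∀ s, T' (trFst (idTensor K (reindexL f) (g s))) =
        reindexL f' (T (trFst (g s))) := fun s => by
      rw [trFst_idTensor]
      exact LinearMap.congr_fun hT' _
    simp only [h2]
    rw [← map_avg, ← map_sub]
    exact (traceNorm_map_le (CP.reindexL _) (TP.reindexL _)
      ((IsHermitian.avg fun s => (hT.isDensity (hg s).trFst).1.1).sub hρ)).trans hδ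

/-- The average over a disjoint union is a convex combination; the second part is charged `c` times
its share of the index set. -/
lemma traceNorm_avg_sumElim_le {X κ' : Type*} [Fintype κ'] [Nonempty κ] [Fintype X]
    [DecidableEq X] {f : κ ⊕ κ' → Op X} {Z : Op X} {c : ℝ} (hf : ∀ s, (f s).IsHermitian)
    (hZ : Z.IsHermitian) (hc : ∀ s, traceNorm (f (Sum.inr s) - Z) ≤ c) :
    traceNorm (avg f - Z) ≤ traceNorm (avg (fun s => f (Sum.inl s)) - Z) +
      c * (Fintype.card κ' / (Fintype.card κ + Fintype.card κ')) := by
  have hk : (0 : ℝ) < Fintype.card κ := Nat.cast_pos.mpr Fintype.card_pos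
  have hk' : (0 : ℝ) ≤ Fintype.card κ' := Nat.cast_nonneg _
  have h0 : avg f - Z = avg fun s => f s - Z := by rw [avg_sub, avg_const]
  have h0' : avg (fun s => f (Sum.inl s)) - Z = avg fun s : κ => f (Sum.inl s) - Z := by
    rw [avg_sub, avg_const]
  have hcard : (Fintype.card (κ ⊕ κ') : ℝ) = Fintype.card κ + Fintype.card κ' := by
    rw [Fintype.card_sum]; push_cast; rfl
  set a : ℝ := (Fintype.card κ : ℝ) with ha
  set b : ℝ := (Fintype.card κ' : ℝ) with hb
  have h1 : avg f - Z = ((a / (a + b) : ℝ) : ℂ) • (avg (fun s => f (Sum.inl s)) - Z) +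
      (((a + b)⁻¹ : ℝ) : ℂ) • ∑ s, (f (Sum.inr s) - Z) := by
    rw [h0, h0']
    simp only [avg, smul_smul, ← Complex.ofReal_mul, hcard, ← ha]
    rw [Fintype.sum_sum_type, smul_add, div_mul_eq_mul_div, mul_inv_cancel₀ hk.ne', one_div]
  have hH : (avg (fun s => f (Sum.inl s)) - Z).IsHermitian :=
    (IsHermitian.avg fun s => hf _).sub hZ
  have hS : (∑ s, (f (Sum.inr s) - Z)).IsHermitian :=
    isHermitian_sum _ fun s _ => (hf _).sub hZ
  rw [h1]
  refine (traceNorm_add_le (isHermitian_smul hH _) (isHermitian_smul hS _)).trans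
    (add_le_add ?_ ?_)
  · refine (traceNorm_smul_le hH (by positivity)).trans ?_
    refine mul_le_of_le_one_left (traceNorm_nonneg _) ?_
    rw [div_le_one (by positivity)]
    linarith
  · refine (traceNorm_smul_le hS (by positivity)).trans ?_
    have h2 : traceNorm (∑ s, (f (Sum.inr s) - Z)) ≤ b * c := by
      refine (traceNorm_sum_le _ fun s _ => (hf _).sub hZ).trans ?_
      refine (Finset.sum_le_sum fun s _ => hc s).trans_eq ?_
      simp [hb]
    refine (mul_le_mul_of_nonneg_left h2 (by positivity)).trans_eq ?_
    ring

/-- Additional key values on which nothing but the cover is sent. -/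
lemma InnerCode.pad {κ' : Type*} [Fintype κ'] [Nonempty κ] [DecidableEq B] [DecidableEq C]
    [DecidableEq K] {T : Op A →ₗ[ℂ] Op B} (hT : IsChannel T) {Ω : Op (K × C)} (hΩ : IsDensity Ω)
    {e δ : ℝ} {α : Op A} (hα : IsDensity α) (h : InnerCode κ T Ω (T α) e δ) :
    InnerCode (κ ⊕ κ') T Ω (T α)
      (e + 2 * (Fintype.card κ' / (Fintype.card κ + Fintype.card κ'))) δ := by
  obtain ⟨g, F, hg, hF, he, hδ⟩ := h
  obtain ⟨s₀⟩ := ‹Nonempty κ›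
  have hs₀ : Nonempty κ := ⟨s₀⟩
  have hz : IsDensity (trSnd (g s₀)) :=
    ⟨CP.trSndL.posSemidef (hg s₀).1, by rw [trace_trSnd, (hg s₀).2]⟩
  -- With an additional key value the channel input is exactly `α`, which leaves the output bound
  -- unchanged; the entanglement fails there, at a cost of at most `2`.
  let g' : κ ⊕ κ' → Op (K × A) := Sum.elim g fun _ => trSnd (g s₀) ⊗ₖ α
  let F' : κ ⊕ κ' → Op B →ₗ[ℂ] Op C := Sum.elim F fun _ => F s₀
  have hg' : ∀ s, IsDensity (g' s) := by
    rintro (s | s)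
    · exact hg s
    · exact hz.kronecker hα
  have hF' : ∀ s, IsChannel (F' s) := by
    rintro (s | s)
    · exact hF s
    · exact hF s₀
  refine ⟨g', F', hg', hF', ?_, ?_⟩
  · have hd : ∀ s, IsDensity (idTensor K (F' s ∘ₗ T) (g' s)) := fun s =>
      (hg' s).idTensor ((hF' s).comp hT)
    refine (traceNorm_avg_sumElim_le (f := fun s => idTensor K (F' s ∘ₗ T) (g' s)) (c := 2) (fun s => (hd s).1.1) hΩ.1.1
      (fun s => traceNorm_sub_le_two (hd _) hΩ)).trans ?_
    exact add_le_add he le_rfl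
  · refine (traceNorm_avg_sumElim_le (f := fun s => T (trFst (g' s))) (c := 0)
      (fun s => (hT.isDensity (hg' s).trFst).1.1) (hT.isDensity hα).1.1 (fun s => ?_)).trans ?_
    · have : trFst (g' (Sum.inr s)) = α := by
        change trFst (trSnd (g s₀) ⊗ₖ α) = α
        rw [trFst_kronecker, hz.2, one_smul]
      change traceNorm (T (trFst (g' (Sum.inr s))) - T α) ≤ 0
      rw [this, sub_self, traceNorm_zero]
    · rw [zero_mul, add_zero]
      exact hδ

end Inner

/-! ## Distillation codes as one-way protocols, conversions of maximally entangled states -/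

section Conversion

lemma CP.of_conjMap_sum {A B ι : Type*} [Fintype A] [Fintype ι] (V : ι → Matrix B A ℂ) :
    CP (∑ i, conjMap (V i)) := CP.sum fun i => CP.conj (V i)

lemma TP.of_conjMap_sum {A B ι : Type*} [Fintype A] [DecidableEq A] [Fintype B] [Fintype ι]
    {V : ι → Matrix B A ℂ} (h : ∑ i, (V i)ᴴ * V i = 1) : TP (∑ i, conjMap (V i)) := fun X => by
  rw [LinearMap.sum_apply, Matrix.trace_sum]
  simp only [conjMap_apply]
  have : ∀ i, (V i * X * (V i)ᴴ).trace = ((V i)ᴴ * V i * X).trace := fun i => by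
    rw [Matrix.trace_mul_comm, Matrix.mul_assoc]
  simp only [this]
  rw [← Matrix.trace_sum, ← Finset.sum_mul, h, Matrix.one_mul]

lemma conjMap_ketbra {A B : Type*} [Fintype A] (V : Matrix B A ℂ) (φ : A → ℂ) :
    conjMap V (ketbra φ) = ketbra (V *ᵥ φ) := by
  rw [conjMap_apply, ketbra, ketbra, Matrix.mul_vecMulVec, Matrix.vecMulVec_mul,
    Matrix.star_mulVec]

/-- Distillation codes are one-way protocols. -/
lemma IsEDCode.oneWay {R B : Type*} [Fintype R] [Fintype B] {M L : ℕ}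
    {σ : Op (R × B)} {e : ℝ} {E : Op R →ₗ[ℂ] Op (Fin L × Fin M)}
    {D : Op (Fin L × B) →ₗ[ℂ] Op (Fin M)} (h : IsEDCode M L σ e E D) :
    OneWay (Fin L) σ (maxEnt M) e := by
  -- `V c` reads out the diagonal block with label `c`; the resulting maps `F c` form Alice's
  -- instrument.
  let V : Fin L → Matrix (Fin M) (Fin L × Fin M) ℂ := fun c =>
    Matrix.of fun i p => if (c, i) = p then 1 else 0
  have hV : ∀ c X i j, conjMap (V c) X i j = X (c, i) (c, j) := fun c X i j => by
    simp [V, Matrix.mul_apply, apply_ite]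
  let F : Fin L → Op R →ₗ[ℂ] Op (Fin M) := fun c => conjMap (V c) ∘ₗ E
  let G : Fin L → Op B →ₗ[ℂ] Op (Fin M) := fun c => D ∘ₗ kronL (Matrix.single c c 1)
  have hpsd : ∀ c : Fin L, (Matrix.single c c (1 : ℂ)).PosSemidef := fun c => by
    have := posSemidef_rdiag (d := Pi.single c (1 : ℝ)) fun i => by
      by_cases h : i = c
      · subst h; simp
      · simp [h]
    convert this using 1
    ext i j
    by_cases h : i = j
    · subst h
      by_cases h' : i = c
      · subst h'; simp [rdiag]
      · simp [rdiag, h', Ne.symm h']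
    · by_cases h' : c = i
      · subst h'; simp [rdiag, h]
      · simp [rdiag, h, h']
  have hk : ∀ c : Fin L, TP (kronL (Matrix.single c c 1) : Op B →ₗ[ℂ] Op (Fin L × B)) :=
    fun c X => by
      change ((Matrix.single c c (1 : ℂ)) ⊗ₖ X).trace = _
      rw [Matrix.trace_kronecker, Matrix.trace_single_eq_same, one_mul]
  let e' : (Fin L × Fin M) × B ≃ Fin M × Fin L × B :=
    ⟨fun p => (p.1.2, p.1.1, p.2), fun p => ((p.2.1, p.1), p.2.2), fun _ => rfl, fun _ => rfl⟩
  have key : idTensorL (Fin M) D ∘ₗ reindexL e' ∘ₗ tensorIdL B E =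
      ∑ c, mapTensor (F c) (G c) := by
    refine kronecker_ext fun X Y => ?_
    have h1 : reindexL e' (E X ⊗ₖ Y) =
        ∑ c, F c X ⊗ₖ ((Matrix.single c c (1 : ℂ)) ⊗ₖ Y) := by
      ext ⟨i, c, b⟩ ⟨j, d, b'⟩
      rw [Matrix.sum_apply]
      simp only [reindexL_apply, kroneckerMap_apply]
      change E X (c, i) (d, j) * Y b b' = _
      have h2 : ∀ x, F x X i j = E X (x, i) (x, j) := fun x => hV x _ i j
      simp only [h2]
      rw [Finset.sum_eq_single c]
      -- Off-diagonal blocks vanish because the encoder is classical on its message; only therefore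
      -- is it determined by the instrument.
      · by_cases hcd : c = d
        · subst hcd; simp
        · rw [h.classical _ _ _ _ _ hcd]; simp [hcd]
      · intro x _ hx
        simp [hx]
      · simp
    have h3 : tensorIdL B E (X ⊗ₖ Y) = E X ⊗ₖ Y := mapTensor_kronecker E LinearMap.id X Y
    have h4 : ∀ (P : Op (Fin M)) (Q : Op (Fin L × B)), idTensorL (Fin M) D (P ⊗ₖ Q) = P ⊗ₖ D Q :=
      fun P Q => mapTensor_kronecker LinearMap.id D P Q
    rw [LinearMap.comp_apply, LinearMap.comp_apply, h3, h1, map_sum, LinearMap.sum_apply]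
    refine Finset.sum_congr rfl fun c _ => ?_
    rw [h4, mapTensor_kronecker]
    rfl
  refine ⟨F, G, fun c => (CP.conj _).comp h.encoder.cp, fun X => ?_, fun c =>
    h.decoder.comp ((CP.kronL (hpsd c)).isChannel (hk c)), ?_⟩
  · rw [LinearMap.sum_apply, ← h.encoder.tracePreserving X]
    simp only [Matrix.trace, Matrix.diag, Matrix.sum_apply]
    rw [Finset.sum_comm, Fintype.sum_prod_type]
    exact Finset.sum_congr rfl fun c _ => Finset.sum_congr rfl fun i _ => hV c _ i i
  · rw [← LinearMap.sum_apply, ← key]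
    exact h.error

/-- The transpose trick: an operator on one half of the maximally entangled vector can be moved to
the other half as its transpose. -/
lemma mulVec_maxEnt {m N : ℕ} (V W : Matrix (Fin m) (Fin N) ℂ) (p : Fin m × Fin m) :
    ((V ⊗ₖ W) *ᵥ fun p : Fin N × Fin N => if p.1 = p.2 then ((1 / √(N : ℝ) : ℝ) : ℂ) else 0) p =
      (V * Wᵀ) p.1 p.2 * ((1 / √(N : ℝ) : ℝ) : ℂ) := by
  simp only [Matrix.mulVec, dotProduct, Fintype.sum_prod_type, kroneckerMap_apply, mul_ite,
    mul_zero, Finset.sum_ite_eq, Finset.mem_univ, if_true, Matrix.mul_apply, Matrix.transpose_apply,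
    Finset.sum_mul]

/-- Used for matching outcomes of Alice and Bob: the smaller state arises perfectly, and the scalar
is the probability of this event. -/
lemma mapTensor_conjMap_maxEnt {m N : ℕ} (hm : 1 ≤ m) {V W : Matrix (Fin m) (Fin N) ℂ} {c : ℝ}
    (h : V * Wᵀ = (c : ℂ) • 1) :
    mapTensor (conjMap V) (conjMap W) (maxEnt N) = ((c ^ 2 * m / N : ℝ) : ℂ) • maxEnt m := by
  rw [mapTensor_conjMap, maxEnt, conjMap_ketbra]
  ext p q
  have hm' : (0 : ℝ) < m := by exact_mod_cast hm
  simp only [ketbra, Matrix.vecMulVec_apply, Pi.star_apply, mulVec_maxEnt, h, maxEnt,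
    Matrix.smul_apply, Matrix.one_apply, smul_eq_mul]
  by_cases h1 : p.1 = p.2
  · by_cases h2 : q.1 = q.2
    · simp only [h1, h2, if_true, mul_one]
      simp only [← Complex.ofReal_mul, Complex.star_def, Complex.conj_ofReal]
      congr 1
      rw [mul_mul_mul_comm, one_div, one_div, ← mul_inv, ← mul_inv,
        Real.mul_self_sqrt (by positivity), Real.mul_self_sqrt hm'.le]
      field_simp
    · simp [h2]
  · simp [h1]

/-- `X - Y = (X - wY) - (1 - w)Y`, a difference of two positive operators of trace `1 - w`. -/
lemma traceNorm_sub_le_of_dominates {A : Type*} [Fintype A] [DecidableEq A] {X Y : Op A}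
    (hX : X.trace = 1) (hY : IsDensity Y) {w : ℝ} (h : (X - (w : ℂ) • Y).PosSemidef) :
    traceNorm (X - Y) ≤ 2 * (1 - w) := by
  have htr : (X - (w : ℂ) • Y).trace.re = 1 - w := by
    rw [Matrix.trace_sub, Matrix.trace_smul, hX, hY.2]; simp
  have hw : 0 ≤ 1 - w := htr ▸ re_trace_nonneg h
  have e : X - Y = (X - (w : ℂ) • Y) - ((1 - w : ℝ) : ℂ) • Y := by
    push_cast; rw [sub_smul, one_smul]; abel
  rw [e]
  refine (traceNorm_sub_le h (posSemidef_smul hY.1 hw)).trans_eq ?_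
  rw [htr, re_trace_smul, hY.2, Complex.one_re]
  ring

/-- The partial isometry of the `j`-th window of length `m` in `n` consecutive copies of `Fin N`. -/
def window (n N m j : ℕ) : Matrix (Fin m) (Fin N) ℂ :=
  Matrix.of fun p x => if j * m + p < n * N ∧ (j * m + p) % N = x then 1 else 0

lemma sum_fin_mul_add {α : Type*} [AddCommMonoid α] (a b : ℕ) (F : ℕ → α) :
    ∑ j : Fin a, ∑ p : Fin b, F (j * b + p) = ∑ i ∈ Finset.range (a * b), F i := by
  rw [Finset.sum_range, ← Fintype.sum_prod_type' fun (j : Fin a) (p : Fin b) => F (j * b + p),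
    ← Equiv.sum_comp finProdFinEquiv]
  refine Finset.sum_congr rfl fun x _ => ?_
  congr 1
  simp [finProdFinEquiv, mul_comm, add_comm]

/-- A window is no longer than one copy of `Fin N`, so it meets no symbol twice, even where it wraps
around. -/
lemma window_inj {N m j : ℕ} (hmN : m ≤ N) {p q : Fin m}
    (h : (j * m + p) % N = (j * m + q) % N) : p = q := by
  have hpN := p.2.trans_le hmN
  have hqN := q.2.trans_le hmN
  have h1 : (p : ℕ) ≡ q [MOD N] := Nat.ModEq.add_left_cancel' (j * m) h
  exact Fin.ext (Nat.ModEq.eq_of_lt_of_lt h1 hpN hqN)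

lemma window_mul_transpose {n N m j : ℕ} (hmN : m ≤ N) (hj : (j + 1) * m ≤ n * N) :
    window n N m j * (window n N m j)ᵀ = 1 := by
  have hj' : ∀ p : Fin m, j * m + p < n * N := fun p =>
    lt_of_lt_of_le (by have := p.2; nlinarith) hj
  ext p q
  have hN : 0 < N := (Nat.zero_le _).trans_lt (p.2.trans_le hmN)
  simp only [window, Matrix.mul_apply, Matrix.transpose_apply, Matrix.of_apply, hj', true_and,
    mul_ite, mul_one, mul_zero]
  rw [Finset.sum_eq_single ⟨(j * m + q) % N, Nat.mod_lt _ hN⟩]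
  · by_cases h : p = q
    · subst h; simp
    · rw [Matrix.one_apply_ne h, if_pos rfl, if_neg fun h' => h (window_inj hmN h')]
  · intro x _ hx
    rw [if_neg]
    intro h
    exact hx (Fin.ext h.symm)
  · simp

lemma window_conjTranspose_mul_apply {n N m j : ℕ} (x y : Fin N) :
    ((window n N m j)ᴴ * window n N m j) x y =
      if x = y then ∑ p : Fin m,
        (if j * m + p < n * N ∧ (j * m + p) % N = x then (1 : ℂ) else 0) else 0 := by
  simp only [window, Matrix.mul_apply, Matrix.conjTranspose_apply, Matrix.of_apply]
  split_ifs with h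
  · subst h
    refine Finset.sum_congr rfl fun p _ => ?_
    split_ifs <;> simp
  · refine Finset.sum_eq_zero fun p _ => ?_
    by_cases h1 : j * m + p < n * N ∧ (j * m + p) % N = y
    · rw [if_neg fun h2 => h (Fin.ext (h2.2.symm.trans h1.2))]
      simp
    · rw [if_neg h1, mul_zero]

/-- The windows tile `n` copies of `Fin N`, in which each symbol occurs `n` times. Windows beyond
the end are zero. -/
lemma sum_window {n N m J : ℕ} (hJ : n * N ≤ J * m) :
    ∑ j : Fin J, (window n N m j)ᴴ * window n N m j = (n : ℂ) • 1 := by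
  ext x y
  rw [Matrix.sum_apply]
  simp only [window_conjTranspose_mul_apply, Matrix.smul_apply, smul_eq_mul, Matrix.one_apply]
  split_ifs with h
  · subst h
    rw [sum_fin_mul_add J m fun i => if i < n * N ∧ i % N = x then (1 : ℂ) else 0]
    have h1 : ∑ i ∈ Finset.range (J * m), (if i < n * N ∧ i % N = x then (1 : ℂ) else 0) =
        ∑ i ∈ Finset.range (n * N), if i % N = x then (1 : ℂ) else 0 := by
      rw [← Finset.sum_subset (Finset.range_subset_range.mpr hJ)]
      · refine Finset.sum_congr rfl fun i hi => ?_
        simp [Finset.mem_range.mp hi]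
      · intro i _ hi
        rw [if_neg fun h => hi (Finset.mem_range.mpr h.1)]
    rw [h1, ← sum_fin_mul_add n N fun i => if i % N = x then (1 : ℂ) else 0]
    have h2 : ∀ (c : Fin n) (z : Fin N), (c * N + z : ℕ) % N = z := fun c z => by
      rw [mul_comm, Nat.mul_add_mod, Nat.mod_eq_of_lt z.2]
    simp only [h2, Fin.val_inj, Finset.sum_ite_eq', Finset.mem_univ, if_true]
    simp
  · simp

/-- The weight of the complete windows. -/
lemma sum_complete_windows {n N m J : ℕ} (hn : 1 ≤ n) (hm : 1 ≤ m) (hmN : m ≤ N)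
    (hJ : n * N ≤ J * m) :
    1 - m / (n * N : ℝ) ≤ ∑ j : Fin J, if (j + 1 : ℕ) * m ≤ n * N then (m / (n * N) : ℝ) else 0 := by
  have hN : (0 : ℝ) < n * N := by exact_mod_cast Nat.mul_pos hn (hm.trans hmN)
  have hm0 : 0 < m := hm
  set q := n * N / m with hq
  -- `q = ⌊nN/m⌋` is the number of complete windows. Fewer than `m` positions remain, which have
  -- weight at most `m/(nN)`.
  have hqJ : q ≤ J := by
    rw [hq]; exact (Nat.div_le_div_right hJ).trans_eq (Nat.mul_div_cancel _ hm0)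
  have h1 : ∀ j : ℕ, (j + 1) * m ≤ n * N ↔ j < q := fun j => by
    rw [hq, Nat.lt_iff_add_one_le, Nat.le_div_iff_mul_le hm0]
  simp only [h1]
  rw [← Finset.sum_range fun j => if j < q then (m / (n * N) : ℝ) else 0,
    ← Finset.sum_filter]
  have h2 : (Finset.range J).filter (fun j => j < q) = Finset.range q := by
    ext j; simp only [Finset.mem_filter, Finset.mem_range]; omega
  rw [h2, Finset.sum_const, Finset.card_range, nsmul_eq_mul, ← mul_div_assoc, sub_le_iff_le_add,
    ← add_div, le_div_iff₀ hN, one_mul]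
  have h3 : n * N < (q + 1) * m := by
    have := Nat.lt_div_mul_add (a := n * N) hm0
    rw [← hq] at this
    linarith
  have h4 : ((n * N : ℕ) : ℝ) ≤ ((q + 1) * m : ℕ) := by exact_mod_cast h3.le
  push_cast at h4
  linarith

/-- Basis vectors outside the support of `W` are sent to a fixed vector. The correction is
completely positive, so it can only add a positive term to an output. -/
lemma exists_channel_extending {m N : ℕ} (hm : 1 ≤ m) (W : Matrix (Fin m) (Fin N) ℂ)
    (s : Fin N → Prop) (hW : Wᴴ * W = Matrix.diagonal fun x => open Classical in
      if s x then 1 else 0) :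
    ∃ Z : Op (Fin N) →ₗ[ℂ] Op (Fin m), CP Z ∧ IsChannel (conjMap W + Z) := by
  classical
  let G : Fin N → Matrix (Fin m) (Fin N) ℂ := fun x =>
    if s x then 0 else Matrix.single ⟨0, hm⟩ x 1
  have hZ : CP (∑ x, conjMap (G x)) := CP.of_conjMap_sum G
  let V : Option (Fin N) → Matrix (Fin m) (Fin N) ℂ := fun o => o.elim W G
  have hV : conjMap W + ∑ x, conjMap (G x) = ∑ o, conjMap (V o) := by
    rw [Fintype.sum_option]; rfl
  refine ⟨_, hZ, ?_⟩
  rw [hV]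
  refine (CP.of_conjMap_sum V).isChannel (TP.of_conjMap_sum ?_)
  rw [Fintype.sum_option]
  change Wᴴ * W + ∑ x, (G x)ᴴ * G x = 1
  have h1 : ∀ x, (G x)ᴴ * G x = Matrix.single x x (if s x then 0 else 1) := fun x => by
    by_cases h : s x
    · simp [G, h]
    · simp [G, h, Matrix.conjTranspose_single]
  simp only [h1, hW]
  ext x y
  rw [Matrix.add_apply, Matrix.sum_apply]
  by_cases hxy : x = y
  · subst hxy
    rw [Finset.sum_eq_single x]
    · by_cases h : s x <;> simp [h]
    · intro b _ hb; simp [hb]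
    · simp
  · rw [Matrix.one_apply_ne hxy, Matrix.diagonal_apply_ne _ hxy, zero_add]
    refine Finset.sum_eq_zero fun z _ => ?_
    rw [Matrix.single_apply, if_neg]
    rintro ⟨h1, h2⟩
    exact hxy (h1.symm.trans h2)

/-- Two local channels shrink a maximally entangled state. -/
lemma exists_compression {m N : ℕ} (hm : 1 ≤ m) (hmN : m ≤ N) :
    ∃ V : Op (Fin N) →ₗ[ℂ] Op (Fin m), IsChannel V ∧
      traceNorm (mapTensor V V (maxEnt N) - maxEnt m) ≤ 2 * (m / N) := by
  have hN : 1 ≤ N := hm.trans hmN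
  -- A single copy of `Fin N` is cut into windows. Since `m ≥ 1`, `N` windows are enough; a generous
  -- number does no harm because the surplus ones are zero.
  have hJ : 1 * N ≤ N * m := by nlinarith
  let V : Op (Fin N) →ₗ[ℂ] Op (Fin m) := ∑ j : Fin N, conjMap (window 1 N m j)
  have hV : IsChannel V := (CP.of_conjMap_sum _).isChannel
    (TP.of_conjMap_sum ((sum_window hJ).trans (by simp)))
  refine ⟨V, hV, ?_⟩
  have hΦ := isDensity_maxEnt hN
  have h1 := sum_complete_windows le_rfl hm hmN hJ
  have hX : (mapTensor V V (maxEnt N)).trace = 1 := ((hV.tp.mapTensor hV.tp) _).trans hΦ.2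
  set w : ℝ := ∑ j : Fin N, if (j + 1 : ℕ) * m ≤ 1 * N then (m / ((1 : ℕ) * N) : ℝ) else 0
  have hd : (mapTensor V V (maxEnt N) - (w : ℂ) • maxEnt m).PosSemidef := by
    have e1 : mapTensor V V (maxEnt N) =
        ∑ j : Fin N, ∑ k : Fin N, mapTensor (conjMap (window 1 N m j))
          (conjMap (window 1 N m k)) (maxEnt N) := by
      simp only [V, mapTensor_sum_left, LinearMap.sum_apply]
      refine Finset.sum_congr rfl fun j _ => ?_
      rw [mapTensor_sum_right, LinearMap.sum_apply]
    have e2 : (w : ℂ) • maxEnt m = ∑ j : Fin N,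
        ((if (j + 1 : ℕ) * m ≤ 1 * N then (m / ((1 : ℕ) * N) : ℝ) else 0 : ℝ) : ℂ) • maxEnt m := by
      rw [← Finset.sum_smul, ← Complex.ofReal_sum]
    rw [e1, e2, ← Finset.sum_sub_distrib]
    refine Matrix.posSemidef_sum _ fun j _ => ?_
    have hpos : ∀ k : Fin N, (mapTensor (conjMap (window 1 N m j))
        (conjMap (window 1 N m k)) (maxEnt N)).PosSemidef := fun k =>
      ((CP.conj _).mapTensor (CP.conj _)).posSemidef hΦ.1
    -- Only equal outcomes on both sides are needed; the other terms are positive and may be dropped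
    -- in a lower bound.
    rw [← Finset.add_sum_erase _ _ (Finset.mem_univ j), add_sub_right_comm]
    refine Matrix.PosSemidef.add ?_ (Matrix.posSemidef_sum _ fun k _ => hpos k)
    split_ifs with h
    · rw [mapTensor_conjMap_maxEnt hm (c := 1)
        ((window_mul_transpose hmN h).trans (by simp))]
      simp [Matrix.PosSemidef.zero]
    · simpa using hpos j
  refine (traceNorm_sub_le_of_dominates hX (isDensity_maxEnt hm) hd).trans ?_
  rw [Nat.cast_one, one_mul] at h1
  linarith

lemma isHermitian_maxEnt (m : ℕ) : (maxEnt m).IsHermitian := by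
  exact (Matrix.posSemidef_vecMulVec_self_star _).1

/-- Communication of `n ^ 2` symbols shrinks a maximally entangled state to any size. -/
lemma oneWay_maxEnt {m N n : ℕ} (hn : 1 ≤ n) (hm : 1 ≤ m) (hmN : m ≤ N) :
    OneWay (Fin (n ^ 2)) (maxEnt N) (maxEnt m) (2 / n) := by
  have hN : 1 ≤ N := hm.trans hmN
  have hN' : (0 : ℝ) < N := by exact_mod_cast hN
  have hm' : (0 : ℝ) < m := by exact_mod_cast hm
  have hn' : (0 : ℝ) < n := by exact_mod_cast hn
  -- For `N ≥ nm` the error `2m/N` of the local compression is already at most `2/n`. Otherwise `n ^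
  -- 2` windows of length `m` cover `n` copies of `Fin N`.
  rcases le_or_gt (n * m) N with hle | hlt
  · obtain ⟨V, hV, h⟩ := exists_compression hm hmN
    have : Nonempty (Fin (n ^ 2)) := ⟨⟨0, by positivity⟩⟩
    refine OneWay.of_local hV hV (h.trans ?_)
    rw [← mul_div_assoc, div_le_div_iff₀ hN' hn']
    have : (n * m : ℝ) ≤ N := by exact_mod_cast hle
    nlinarith
  · have hJ : n * N ≤ n ^ 2 * m := by nlinarith
    have hex : ∀ j : Fin (n ^ 2), ∃ Z : Op (Fin N) →ₗ[ℂ] Op (Fin m), CP Z ∧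
        IsChannel (conjMap (window n N m j) + Z) := fun j => by
      classical
      refine exists_channel_extending hm _
        (fun x => ∃ p : Fin m, j * m + p < n * N ∧ (j * m + p : ℕ) % N = x) ?_
      ext x y
      rw [window_conjTranspose_mul_apply, Matrix.diagonal_apply]
      split_ifs with h1 h2
      · obtain ⟨p, hp⟩ := h2
        rw [Finset.sum_eq_single p, if_pos hp]
        · intro q _ hq
          rw [if_neg fun h => hq (window_inj hmN (h.2.trans hp.2.symm))]
        · simp
      · refine Finset.sum_eq_zero fun p _ => ?_
        rw [if_neg fun h => h2 ⟨p, h⟩]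
      · rfl
    choose Z hZ hch using hex
    -- Alice measures the window and announces `j`; the factor `1/√n` compensates for the `n`-fold
    -- covering. Only an incomplete window spoils the state, with probability at most `m/(nN) ≤
    -- 1/n`.
    let V : Fin (n ^ 2) → Op (Fin N) →ₗ[ℂ] Op (Fin m) := fun j =>
      conjMap (((1 / √(n : ℝ) : ℝ) : ℂ) • window n N m j)
    have hcc : ((1 / √(n : ℝ) : ℝ) : ℂ) * ((1 / √(n : ℝ) : ℝ) : ℂ) = ((1 / n : ℝ) : ℂ) := by
      rw [← Complex.ofReal_mul]
      congr 1
      rw [div_mul_div_comm, Real.mul_self_sqrt hn'.le, one_mul]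
    have hVt : TP (∑ j, V j) := by
      refine TP.of_conjMap_sum ?_
      simp only [Matrix.conjTranspose_smul, Matrix.smul_mul, Matrix.mul_smul, smul_smul,
        Complex.star_def, Complex.conj_ofReal, hcc]
      rw [← Finset.smul_sum, sum_window hJ, smul_smul]
      push_cast
      rw [one_div, inv_mul_cancel₀ (by exact_mod_cast hn'.ne'), one_smul]
    have hΦ := isDensity_maxEnt hN
    refine ⟨V, fun j => conjMap (window n N m j) + Z j, fun j => CP.conj _, hVt, hch, ?_⟩
    have hX : (∑ j, mapTensor (V j) (conjMap (window n N m j) + Z j) (maxEnt N)).trace = 1 := by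
      rw [Matrix.trace_sum]
      simp only [trace_mapTensor_of_right _ (hch _).tp]
      rw [← Matrix.trace_sum, ← LinearMap.sum_apply, hVt, trace_trSnd, hΦ.2]
    have h1 := sum_complete_windows hn hm hmN hJ
    set w : ℝ := ∑ j : Fin (n ^ 2), if (j + 1 : ℕ) * m ≤ n * N then (m / (n * N) : ℝ) else 0
    have hd : (∑ j, mapTensor (V j) (conjMap (window n N m j) + Z j) (maxEnt N) -
        (w : ℂ) • maxEnt m).PosSemidef := by
      have e2 : (w : ℂ) • maxEnt m = ∑ j : Fin (n ^ 2),
          ((if (j + 1 : ℕ) * m ≤ n * N then (m / (n * N) : ℝ) else 0 : ℝ) : ℂ) • maxEnt m := by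
        rw [← Finset.sum_smul, ← Complex.ofReal_sum]
      rw [e2, ← Finset.sum_sub_distrib]
      refine Matrix.posSemidef_sum _ fun j _ => ?_
      have e3 : mapTensor (V j) (conjMap (window n N m j) + Z j) (maxEnt N) =
          mapTensor (V j) (conjMap (window n N m j)) (maxEnt N) +
            mapTensor (V j) (Z j) (maxEnt N) := by
        have := mapTensor_sum_right (Finset.univ : Finset Bool) (V j)
          (fun b => if b then conjMap (window n N m j) else Z j)
        simp only [Fintype.sum_bool, if_true, Bool.false_eq_true, if_false] at this
        rw [this]
        rfl
      rw [e3, add_sub_right_comm]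
      refine Matrix.PosSemidef.add ?_ (((CP.conj _).mapTensor (hZ j)).posSemidef hΦ.1)
      split_ifs with h
      · rw [mapTensor_conjMap_maxEnt hm (c := 1 / √(n : ℝ))
          (by rw [Matrix.smul_mul, window_mul_transpose hmN h])]
        have : (1 / √(n : ℝ)) ^ 2 * m / N = m / (n * N) := by
          rw [div_pow, Real.sq_sqrt hn'.le]
          field_simp
        rw [this, sub_self]
        exact Matrix.PosSemidef.zero
      · simpa using ((CP.conj _).mapTensor (CP.conj _)).posSemidef hΦ.1
    refine (traceNorm_sub_le_of_dominates hX (isDensity_maxEnt hm) hd).trans ?_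
    have h2 : (m / (n * N) : ℝ) ≤ 1 / n := by
      rw [div_le_div_iff₀ (by positivity) hn']
      have : (m : ℝ) ≤ N := by exact_mod_cast hmN
      nlinarith
    have h3 : (2 / n : ℝ) = 2 * (1 / n) := by ring
    rw [h3]
    linarith

/-- Products of maximally entangled states. -/
lemma mapTensor_reindexL_box_maxEnt (m q : ℕ) :
    mapTensor (reindexL (finProdFinEquiv (m := m) (n := q))) (reindexL finProdFinEquiv)
      (box (maxEnt m) (maxEnt q)) = maxEnt (m * q) := by
  have h : mapTensor (reindexL (finProdFinEquiv (m := m) (n := q)))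
      (reindexL (finProdFinEquiv (m := m) (n := q))) =
      reindexL (finProdFinEquiv.prodCongr finProdFinEquiv) :=
    kronecker_ext fun X Y => by
      rw [mapTensor_kronecker]
      ext p q
      simp [kroneckerMap_apply]
  rw [h]
  ext p q
  obtain ⟨⟨p₁, p₂⟩, rfl⟩ := (finProdFinEquiv.prodCongr finProdFinEquiv).surjective p
  obtain ⟨⟨q₁, q₂⟩, rfl⟩ := (finProdFinEquiv.prodCongr finProdFinEquiv).surjective q
  simp only [reindexL_apply, box, kroneckerMap_apply,
    Equiv.prodProdProdComm_symm, Equiv.prodProdProdComm_apply, maxEnt, ketbra,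
    Matrix.vecMulVec_apply, Pi.star_apply, Equiv.prodCongr_apply, Prod.map,
    EmbeddingLike.apply_eq_iff_eq, Prod.ext_iff]
  by_cases h1 : p₁.1 = p₂.1 <;> by_cases h2 : p₁.2 = p₂.2 <;> by_cases h3 : q₁.1 = q₂.1 <;>
    by_cases h4 : q₁.2 = q₂.2 <;> simp [h1, h2, h3, h4]
  ring

end Conversion

/-! ## Real powers, hypothesis testing and the square-root measurement -/

section Testing

variable {A B ι : Type*} [Fintype A] [DecidableEq A] [Fintype B] [DecidableEq B] [Fintype ι]

open scoped MatrixOrder Matrix.Norms.L2Operator in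
/-- Operator monotonicity of real powers. -/
lemma posSemidef_rpow_sub_rpow {X Y : Op A} (hX : X.PosSemidef) (h : (Y - X).PosSemidef) {s : ℝ}
    (hs : s ∈ Set.Icc (0 : ℝ) 1) : (rpow Y s - rpow X s).PosSemidef := by
  have hY : Y.PosSemidef := by simpa using h.add hX
  have h1 := CFC.monotone_rpow (A := Op A) hs (Matrix.le_iff.mpr h : X ≤ Y)
  simp only [CFC.rpow_eq_cfc_real (Matrix.nonneg_iff_posSemidef.mpr hX),
    CFC.rpow_eq_cfc_real (Matrix.nonneg_iff_posSemidef.mpr hY)] at h1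
  exact Matrix.le_iff.mp h1

lemma rpow_conj_rdiag [DecidableEq ι] {U : Matrix A ι ℂ} (hU : Uᴴ * U = 1) (hU' : U * Uᴴ = 1)
    (d : ι → ℝ) (p : ℝ) : rpow (U * rdiag d * Uᴴ) p = U * rdiag (fun i => d i ^ p) * Uᴴ :=
  cfc_conj_rdiag hU hU' d _

/-- Spectral decomposition of a positive operator. -/
lemma exists_spectral {X : Op A} (hX : X.PosSemidef) :
    ∃ (U : Op A) (d : A → ℝ), Uᴴ * U = 1 ∧ U * Uᴴ = 1 ∧ (∀ i, 0 ≤ d i) ∧ X = U * rdiag d * Uᴴ :=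
  ⟨_, hX.1.eigenvalues, eigenvectorUnitary_conjTranspose_mul hX.1,
    eigenvectorUnitary_mul_conjTranspose hX.1, hX.eigenvalues_nonneg,
    eq_conj_rdiag_eigenvalues hX.1⟩

lemma posSemidef_rpow {X : Op A} (hX : X.PosSemidef) (p : ℝ) : (rpow X p).PosSemidef := by
  obtain ⟨U, d, hU, hU', hd, rfl⟩ := exists_spectral hX
  rw [rpow_conj_rdiag hU hU']
  exact posSemidef_conj_rdiag U fun i => Real.rpow_nonneg (hd i) p

lemma rpow_one {X : Op A} (hX : X.PosSemidef) : rpow X 1 = X := by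
  obtain ⟨U, d, hU, hU', hd, rfl⟩ := exists_spectral hX
  rw [rpow_conj_rdiag hU hU']
  simp only [Real.rpow_one]

/-- The two conditions concern the kernel, since `0 ^ 0 = 1` while other powers of `0` vanish. -/
lemma rpow_mul_rpow {X : Op A} (hX : X.PosSemidef) {p q : ℝ} (hp : p ≠ 0) (h : p + q ≠ 0) :
    rpow X p * rpow X q = rpow X (p + q) := by
  obtain ⟨U, d, hU, hU', hd, rfl⟩ := exists_spectral hX
  simp only [rpow_conj_rdiag hU hU']
  rw [conj_rdiag_mul hU]
  congr 3
  funext i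
  rcases (hd i).eq_or_lt with h0 | h0
  · rw [← h0, Real.zero_rpow hp, Real.zero_rpow h, zero_mul]
  · rw [Real.rpow_add h0]

lemma rpow_smul {X : Op A} (hX : X.PosSemidef) {c : ℝ} (hc : 0 ≤ c) (p : ℝ) :
    rpow ((c : ℂ) • X) p = ((c ^ p : ℝ) : ℂ) • rpow X p := by
  obtain ⟨U, d, hU, hU', hd, rfl⟩ := exists_spectral hX
  have h1 : ∀ (c : ℝ) (d : A → ℝ), (c : ℂ) • (U * rdiag d * Uᴴ) =
      U * rdiag (fun i => c * d i) * Uᴴ := fun c d => by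
    rw [← Matrix.smul_mul, ← Matrix.mul_smul, rdiag, rdiag, ← Matrix.diagonal_smul]
    congr 3
    funext i
    simp
  rw [h1, rpow_conj_rdiag hU hU', rpow_conj_rdiag hU hU', h1]
  congr 3
  funext i
  rw [Real.mul_rpow hc (hd i)]

/-- Positive definite fractional powers. -/
lemma exists_quarter_power {X : Op A} (hX : X.PosSemidef) {η : ℝ} (hη : 0 < η) :
    ∃ S S' : Op A, S.PosSemidef ∧ S'.PosSemidef ∧ S * S' = 1 ∧ S' * S = 1 ∧
      S * S * (S * S) = X + (η : ℂ) • 1 := by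
  obtain ⟨U, d, hU, hU', hd, rfl⟩ := exists_spectral hX
  have hp : ∀ i, 0 < d i + η := fun i => add_pos_of_nonneg_of_pos (hd i) hη
  refine ⟨U * rdiag (fun i => (d i + η) ^ (1 / 4 : ℝ)) * Uᴴ,
    U * rdiag (fun i => (d i + η) ^ (-(1 / 4 : ℝ))) * Uᴴ,
    posSemidef_conj_rdiag U fun i => (Real.rpow_pos_of_pos (hp i) _).le,
    posSemidef_conj_rdiag U fun i => (Real.rpow_pos_of_pos (hp i) _).le, ?_, ?_, ?_⟩
  · rw [conj_rdiag_mul hU, ← conj_rdiag_one hU']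
    congr 3
    funext i
    rw [← Real.rpow_add (hp i), add_neg_cancel, Real.rpow_zero]
  · rw [conj_rdiag_mul hU, ← conj_rdiag_one hU']
    congr 3
    funext i
    rw [← Real.rpow_add (hp i), neg_add_cancel, Real.rpow_zero]
  · simp only [conj_rdiag_mul hU]
    have h1 : (η : ℂ) • (1 : Op A) = U * rdiag (fun _ => η) * Uᴴ := by
      have : rdiag (fun _ : A => η) = (η : ℂ) • 1 := by
        ext i j; simp [rdiag, Matrix.one_apply, Matrix.diagonal_apply]
      rw [this, Matrix.mul_smul, Matrix.smul_mul, Matrix.mul_one, hU']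
    rw [h1, conj_rdiag_add]
    congr 3
    funext i
    simp only [← Real.rpow_add (hp i)]
    norm_num

omit [DecidableEq A] in
lemma re_trace_mul_mono {X Y Z : Op A} (h : (Y - X).PosSemidef) (hZ : Z.PosSemidef) :
    (X * Z).trace.re ≤ (Y * Z).trace.re := by
  have := re_trace_mul_nonneg h hZ
  rw [Matrix.sub_mul, Matrix.trace_sub, Complex.sub_re] at this
  linarith

omit [DecidableEq A] in
lemma re_trace_mul_comm (X Y : Op A) : (X * Y).trace.re = (Y * X).trace.re := by
  rw [Matrix.trace_mul_comm]

/-- A test with the quantum Chernoff bound on the sum of the errors. -/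
lemma exists_test {X Y : Op A} (hX : X.PosSemidef) (hY : Y.PosSemidef) {s : ℝ}
    (hs : s ∈ Set.Ioo (0 : ℝ) 1) :
    ∃ E : Op A, E.PosSemidef ∧ (1 - E).PosSemidef ∧
      ((1 - E) * X).trace.re + (E * Y).trace.re ≤ (rpow Y s * rpow X (1 - s)).trace.re := by
  have hs1 : s ∈ Set.Icc (0 : ℝ) 1 := ⟨hs.1.le, hs.2.le⟩
  have hs2 : 1 - s ∈ Set.Icc (0 : ℝ) 1 := ⟨by linarith [hs.2], by linarith [hs.1]⟩
  have hXY := hX.1.sub hY.1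
  obtain ⟨H, hH, h1, h2, -, h4⟩ := exists_sign hXY
  obtain ⟨P, Q, hP, hQ, hPQ, hn⟩ := exists_sub_eq hXY
  have hhalf : ∀ Z : Op A, Z.PosSemidef → (((1 / 2 : ℝ) : ℂ) • Z).PosSemidef := fun Z hZ =>
    posSemidef_smul hZ (by norm_num)
  have e1 : (1 : Op A) - ((1 / 2 : ℝ) : ℂ) • (1 + H) = ((1 / 2 : ℝ) : ℂ) • (1 - H) := by
    push_cast
    module
  -- The optimal test, with `H` in the role of the sign of `X - Y`.
  refine ⟨((1 / 2 : ℝ) : ℂ) • (1 + H), hhalf _ h2, by rw [e1]; exact hhalf _ h1, ?_⟩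
  rw [e1, Matrix.smul_mul, Matrix.smul_mul, re_trace_smul, re_trace_smul, Matrix.sub_mul,
    Matrix.add_mul, Matrix.one_mul, Matrix.one_mul, Matrix.trace_sub, Matrix.trace_add,
    Complex.sub_re, Complex.add_re]
  have e2 : (H * X).trace.re - (H * Y).trace.re = P.trace.re + Q.trace.re := by
    rw [← hn, ← h4, Matrix.mul_sub, Matrix.trace_sub, Complex.sub_re]
  have e3 : X.trace.re - Y.trace.re = P.trace.re - Q.trace.re := by
    rw [← Complex.sub_re, ← Matrix.trace_sub, hPQ, Matrix.trace_sub, Complex.sub_re]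
  -- the sum of the errors is `tr X - tr P`
  suffices h : X.trace.re - P.trace.re ≤ (rpow Y s * rpow X (1 - s)).trace.re by linarith
  -- `Y + P = X + Q` dominates both `X` and `Y`; operator monotonicity lets its powers replace
  -- theirs.
  have hG : (Y + P).PosSemidef := hY.add hP
  have hGX : ((Y + P) - X).PosSemidef := by
    have : (Y + P) - X = Q := by
      have : X = Y + (P - Q) := by rw [← hPQ]; abel
      rw [this]; abel
    rwa [this]
  have hGY : ((Y + P) - Y).PosSemidef := by rwa [add_sub_cancel_left]
  have hpow : ∀ Z : Op A, Z.PosSemidef → rpow Z s * rpow Z (1 - s) = Z := fun Z hZ => by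
    rw [rpow_mul_rpow hZ hs.1.ne' (by simp), add_sub_cancel, rpow_one hZ]
  have k1 : X.trace.re ≤ (rpow (Y + P) s * rpow X (1 - s)).trace.re := by
    have := re_trace_mul_mono (posSemidef_rpow_sub_rpow hX hGX hs1) (posSemidef_rpow hX (1 - s))
    rwa [hpow X hX] at this
  have k2 : Y.trace.re ≤ (rpow Y s * rpow (Y + P) (1 - s)).trace.re := by
    have := re_trace_mul_mono (posSemidef_rpow_sub_rpow hY hGY hs2) (posSemidef_rpow hY s)
    rwa [re_trace_mul_comm, hpow Y hY, re_trace_mul_comm] at this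
  -- The trace of a product of two positive differences. Its mixed terms are those bounded by `k1`
  -- and `k2`, and what remains is the claim.
  have k3 := re_trace_mul_nonneg (posSemidef_rpow_sub_rpow hY hGY hs1)
    (posSemidef_rpow_sub_rpow hX hGX hs2)
  rw [Matrix.sub_mul, Matrix.mul_sub, Matrix.mul_sub, hpow _ hG] at k3
  simp only [Matrix.trace_sub, Matrix.trace_add, Complex.sub_re, Complex.add_re] at k3
  linarith

/-- The inequality of Hayashi and Nagaoka, for a regularized square-root measurement. -/
lemma exists_sqrt_measurement (S : ι → Op A) (hS : ∀ i, (S i).PosSemidef)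
    (hS1 : ∀ i, (1 - S i).PosSemidef) {η : ℝ} (hη : 0 < η) :
    ∃ Λ : ι → Op A, (∀ i, (Λ i).PosSemidef) ∧ (1 - ∑ i, Λ i).PosSemidef ∧
      ∀ i, (((2 : ℝ) : ℂ) • (1 - S i) + ((4 : ℝ) : ℂ) • (∑ j, S j - S i + (η : ℂ) • 1) -
        (1 - Λ i)).PosSemidef := by
  have hW : (∑ i, S i).PosSemidef := Matrix.posSemidef_sum _ fun i _ => hS i
  obtain ⟨R, R', hR, hR', h1, h2, h3⟩ := exists_quarter_power hW hη
  set X := ∑ i, S i + (η : ℂ) • (1 : Op A) with hX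
  have hη1 : ((η : ℂ) • (1 : Op A)).PosSemidef := posSemidef_smul Matrix.PosSemidef.one hη.le
  let Q := R * R
  let Γ := R' * R'
  have hQh : Qᴴ = Q := by simp [Q, hR.1.eq]
  have hΓh : Γᴴ = Γ := by simp [Γ, hR'.1.eq]
  have hQΓ : Q * Γ = 1 := by
    calc R * R * (R' * R') = R * (R * R') * R' := by simp only [Matrix.mul_assoc]
      _ = 1 := by rw [h1, Matrix.mul_one, h1]
  have hΓQ : Γ * Q = 1 := by
    calc R' * R' * (R * R) = R' * (R' * R) * R := by simp only [Matrix.mul_assoc]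
      _ = 1 := by rw [h2, Matrix.mul_one, h2]
  have hQX : Q * Q = X := h3
  have hΓX : Γ * X * Γ = 1 := by
    calc Γ * X * Γ = (Γ * Q) * (Q * Γ) := by rw [← hQX]; simp only [Matrix.mul_assoc]
      _ = 1 := by rw [hΓQ, hQΓ, Matrix.one_mul]
  have hQpsd : Q.PosSemidef := by
    have := Matrix.posSemidef_conjTranspose_mul_self R
    rwa [hR.1.eq] at this
  have hXpsd : X.PosSemidef := hW.add hη1
  have hconj : ∀ Z : Op A, Z.PosSemidef → (Γ * Z * Γ).PosSemidef := fun Z hZ => by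
    have := hZ.mul_mul_conjTranspose_same Γ
    rwa [hΓh] at this
  refine ⟨fun i => Γ * S i * Γ, fun i => hconj _ (hS i), ?_, fun i => ?_⟩
  · have e : 1 - ∑ i, Γ * S i * Γ = Γ * ((η : ℂ) • 1) * Γ := by
      rw [← Finset.sum_mul, ← Finset.mul_sum, sub_eq_iff_eq_add, ← Matrix.add_mul,
        ← Matrix.mul_add, add_comm, ← hX, hΓX]
    rw [e]
    exact hconj _ hη1
  · set T := ∑ j, S j - S i + (η : ℂ) • (1 : Op A) with hT
    have hXT : X = S i + T := by rw [hX, hT]; abel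
    have hTpsd : T.PosSemidef := by
      refine Matrix.PosSemidef.add ?_ hη1
      classical
      rw [← Finset.add_sum_erase _ _ (Finset.mem_univ i), add_sub_cancel_left]
      exact Matrix.posSemidef_sum _ fun j _ => hS j
    -- `Q = X^{1/2} ≥ (S i)^{1/2} ≥ S i`: monotonicity of the square root, followed by `0 ≤ S i ≤
    -- 1`.
    have hQS : (Q - S i).PosSemidef := by
      have m1 := posSemidef_rpow_sub_rpow (hS i) (Y := X)
        (by rw [hXT, add_sub_cancel_left]; exact hTpsd) (s := 1 / 2) ⟨by norm_num, by norm_num⟩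
      have m2 : rpow X (1 / 2) = Q := by
        obtain ⟨U, d, hU, hU', hd, hQd⟩ := exists_spectral hQpsd
        rw [← hQX, hQd, conj_rdiag_mul hU, rpow_conj_rdiag hU hU']
        congr 3
        funext j
        rw [← Real.sqrt_eq_rpow, Real.sqrt_mul_self (hd j)]
      have m3 : (rpow (S i) (1 / 2) - S i).PosSemidef := by
        have hSi := hS i
        have hSi1 := hS1 i
        set Z := S i
        obtain ⟨V, hV, hVV, hVg⟩ := exists_sqrt_effect hSi hSi1
        have n2 : rpow Z (1 / 2) = V := by
          obtain ⟨U, d, hU, hU', hd, hVd⟩ := exists_spectral hV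
          rw [← hVV, hVd, conj_rdiag_mul hU, rpow_conj_rdiag hU hU']
          congr 3
          funext j
          rw [← Real.sqrt_eq_rpow, Real.sqrt_mul_self (hd j)]
        have n3 : (V - Z) = ((1 / 2 : ℝ) : ℂ) • (1 - Z - (1 - V) * (1 - V)) := by
          simp only [Matrix.sub_mul, Matrix.mul_sub, Matrix.one_mul, Matrix.mul_one, hVV]
          push_cast
          module
        rw [n2, n3]
        exact posSemidef_smul hVg (by norm_num)
      rw [m2] at m1
      simpa using m1.add m3
    have e1 : (1 : Op A) - Γ * S i * Γ = Γ * T * Γ := by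
      rw [← hΓX, hXT, Matrix.mul_add, Matrix.add_mul]
      abel
    -- the difference of the two sides as a sum of positive terms
    have e2 : ((2 : ℝ) : ℂ) • (1 - S i) + ((4 : ℝ) : ℂ) • T - (1 - Γ * S i * Γ) =
        (Γ - 1 - 1) * T * (Γ - 1 - 1) + (((2 : ℝ) : ℂ) • ((Γ - 1) * S i * (Γ - 1)) +
          ((4 : ℝ) : ℂ) • (Q - S i)) := by
      have e3 : (Γ - 1) * X * (Γ - 1) = 1 - (2 : ℂ) • Q + X := by
        have : (Γ - 1) * Q = 1 - Q := by rw [Matrix.sub_mul, hΓQ, Matrix.one_mul]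
        have h' : Q * (Γ - 1) = 1 - Q := by rw [Matrix.mul_sub, hQΓ, Matrix.mul_one]
        calc (Γ - 1) * X * (Γ - 1) = (Γ - 1) * Q * (Q * (Γ - 1)) := by
              rw [← hQX]; simp only [Matrix.mul_assoc]
          _ = _ := by
              rw [this, h']
              simp only [Matrix.sub_mul, Matrix.mul_sub, Matrix.one_mul, Matrix.mul_one, hQX]
              module
      have e4 : (Γ - 1) * S i * (Γ - 1) = 1 - (2 : ℂ) • Q + X - (Γ - 1) * T * (Γ - 1) := by
        rw [← e3, hXT, Matrix.mul_add, Matrix.add_mul]; abel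
      rw [e1, e4, hXT]
      simp only [Matrix.sub_mul, Matrix.mul_sub, Matrix.one_mul, Matrix.mul_one]
      push_cast
      module
    rw [e2]
    have hd : ∀ Z : Op A, Zᴴ = Z → ∀ Y : Op A, Y.PosSemidef → (Z * Y * Z).PosSemidef :=
      fun Z hZ Y hY => by
        have := hY.mul_mul_conjTranspose_same Z
        rwa [hZ] at this
    refine (hd _ (by simp [hΓh]) _ hTpsd).add ((posSemidef_smul (hd _ (by simp [hΓh]) _ (hS i))
      (by norm_num)).add (posSemidef_smul hQS (by norm_num)))

end Testing

/-! ## Pinching -/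

section Pinching

variable {A B ι : Type*} [Fintype A] [DecidableEq A] [Fintype B] [DecidableEq B]

/-- An eigenbasis of `ρ` in which the blocks of `σ` on the eigenspaces of `ρ` are diagonal. -/
lemma exists_joint_basis {ρ σ : Op A} (hρ : ρ.IsHermitian) (hσ : σ.IsHermitian) :
    ∃ (V : Op A) (μ : A → ℝ), Vᴴ * V = 1 ∧ V * Vᴴ = 1 ∧ ρ = V * rdiag μ * Vᴴ ∧
      (Finset.univ.image μ).card = numEig ρ ∧
      ∀ i j, i ≠ j → μ i = μ j → (Vᴴ * σ * V) i j = 0 := by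
  classical
  set d := hρ.eigenvalues with hd
  have hU := eigenvectorUnitary_conjTranspose_mul hρ
  have hU' := eigenvectorUnitary_mul_conjTranspose hρ
  have hρU := eq_conj_rdiag_eigenvalues hρ
  rw [← hd] at hρU
  set U : Op A := (hρ.eigenvectorUnitary : Matrix A A ℂ)
  -- Eigenvectors of `ρ` are grouped by eigenvalue and each diagonal block of `σ` is diagonalized
  -- separately. The block diagonal unitary `Y` commutes with the eigenvalue matrix of `ρ`, so the
  -- new basis is still an eigenbasis.
  let F : A → Set.range d := Set.rangeFactorization d
  let e : (Σ v : Set.range d, {i // F i = v}) ≃ A := Equiv.sigmaFiberEquiv F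
  have he : ∀ x, d (e x) = x.1 := fun ⟨v, i, hi⟩ => congrArg Subtype.val hi
  let τ : Op (Σ v : Set.range d, {i // F i = v}) := (Uᴴ * σ * U).submatrix e e
  have hτ : τ.IsHermitian := (by
    have := Matrix.isHermitian_mul_mul_conjTranspose Uᴴ hσ
    rw [Matrix.conjTranspose_conjTranspose] at this
    exact this : (Uᴴ * σ * U).IsHermitian).submatrix e
  have hb : ∀ v, (Matrix.blockDiag' τ v).IsHermitian := fun v => by
    rw [Matrix.IsHermitian, ← Matrix.blockDiag'_conjTranspose, hτ.eq]
  let W : ∀ v : Set.range d, Op {i // F i = v} := fun v => ((hb v).eigenvectorUnitary : Matrix _ _ ℂ)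
  have hW : ∀ v, (W v)ᴴ * W v = 1 := fun v => eigenvectorUnitary_conjTranspose_mul (hb v)
  have hW' : ∀ v, W v * (W v)ᴴ = 1 := fun v => eigenvectorUnitary_mul_conjTranspose (hb v)
  let Y : Op (Σ v : Set.range d, {i // F i = v}) := Matrix.blockDiagonal' W
  have hY : Yᴴ * Y = 1 := by
    rw [Matrix.blockDiagonal'_conjTranspose, ← Matrix.blockDiagonal'_mul]
    simp only [hW]
    exact Matrix.blockDiagonal'_one
  have hY' : Y * Yᴴ = 1 := by
    rw [Matrix.blockDiagonal'_conjTranspose, ← Matrix.blockDiagonal'_mul]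
    simp only [hW']
    exact Matrix.blockDiagonal'_one
  have hYd : Y * rdiag (fun x => (x.1 : ℝ)) * Yᴴ = rdiag (fun x => (x.1 : ℝ)) := by
    have h1 : rdiag (fun x : Σ v : Set.range d, {i // F i = v} => (x.1 : ℝ)) * Yᴴ =
        Yᴴ * rdiag (fun x => (x.1 : ℝ)) := by
      ext x y
      rw [rdiag, Matrix.diagonal_mul, Matrix.mul_diagonal, mul_comm]
      by_cases h : x.1 = y.1
      · rw [h]
      · have : Yᴴ x y = 0 := by
          refine (congrArg star ?_).trans (star_zero ℂ)
          exact (Matrix.blockDiagonal'_apply W y x).trans (dif_neg (Ne.symm h))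
        rw [this, zero_mul, zero_mul]
    rw [Matrix.mul_assoc, h1, ← Matrix.mul_assoc, hY', Matrix.one_mul]
  let E : Op A := (Y.submatrix e.symm e.symm)
  have hE : Eᴴ * E = 1 := by
    rw [Matrix.conjTranspose_submatrix, Matrix.submatrix_mul_equiv, hY, Matrix.submatrix_one_equiv]
  have hE' : E * Eᴴ = 1 := by
    rw [Matrix.conjTranspose_submatrix, Matrix.submatrix_mul_equiv, hY', Matrix.submatrix_one_equiv]
  have hdd : rdiag d = (rdiag (fun x : Σ v : Set.range d, {i // F i = v} => (x.1 : ℝ))).submatrix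
      e.symm e.symm := by
    rw [rdiag, rdiag, Matrix.submatrix_diagonal_equiv]
    refine congrArg Matrix.diagonal (funext fun i => ?_)
    exact congrArg (fun r : ℝ => (r : ℂ))
      ((congrArg d (e.apply_symm_apply i).symm).trans (he (e.symm i)))
  have hEd : E * rdiag d * Eᴴ = rdiag d := by
    rw [hdd, Matrix.conjTranspose_submatrix, Matrix.submatrix_mul_equiv,
      Matrix.submatrix_mul_equiv, hYd]
  refine ⟨U * E, d, ?_, ?_, ?_, ?_, ?_⟩
  · rw [Matrix.conjTranspose_mul]
    calc Eᴴ * Uᴴ * (U * E) = Eᴴ * (Uᴴ * U) * E := by simp only [Matrix.mul_assoc]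
      _ = 1 := by rw [hU, Matrix.mul_one, hE]
  · rw [Matrix.conjTranspose_mul]
    calc U * E * (Eᴴ * Uᴴ) = U * (E * Eᴴ) * Uᴴ := by simp only [Matrix.mul_assoc]
      _ = 1 := by rw [hE', Matrix.mul_one, hU']
  · rw [Matrix.conjTranspose_mul]
    calc ρ = U * (E * rdiag d * Eᴴ) * Uᴴ := by rw [hEd, ← hρU]
      _ = _ := by simp only [Matrix.mul_assoc]
  · rw [numEig, hρ.spectrum_eq_image_range,
      Set.ncard_image_of_injective _ RCLike.ofReal_injective, ← hd]
    rw [← Set.ncard_coe_finset]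
    simp
  · intro i j hij hd'
    have h1 : (U * E)ᴴ * σ * (U * E) = (Yᴴ * τ * Y).submatrix e.symm e.symm := by
      have : Uᴴ * σ * U = τ.submatrix e.symm e.symm := by
        ext; simp [τ]
      calc (U * E)ᴴ * σ * (U * E) = Eᴴ * (Uᴴ * σ * U) * E := by
            rw [Matrix.conjTranspose_mul]; simp only [Matrix.mul_assoc]
        _ = _ := by
            rw [this, Matrix.conjTranspose_submatrix, Matrix.submatrix_mul_equiv,
              Matrix.submatrix_mul_equiv]
    rw [h1, Matrix.submatrix_apply]
    obtain ⟨⟨v, k⟩, rfl⟩ := e.surjective i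
    obtain ⟨⟨v', l⟩, rfl⟩ := e.surjective j
    rw [Equiv.symm_apply_apply, Equiv.symm_apply_apply]
    have hv : v = v' := by
      rw [he, he] at hd'; exact Subtype.ext hd'
    subst hv
    have h2 : (Yᴴ * τ * Y) ⟨v, k⟩ ⟨v, l⟩ = ((W v)ᴴ * Matrix.blockDiag' τ v * W v) k l := by
      simp only [Matrix.mul_apply, Fintype.sum_sigma, Y, Matrix.conjTranspose_apply]
      rw [Finset.sum_eq_single v]
      · refine Finset.sum_congr rfl fun x _ => ?_
        rw [Matrix.blockDiagonal'_apply_eq]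
        congr 1
        rw [Finset.sum_eq_single v]
        · refine Finset.sum_congr rfl fun y _ => ?_
          rw [Matrix.blockDiagonal'_apply_eq]
          rfl
        · intro w _ hw
          refine Finset.sum_eq_zero fun y _ => ?_
          rw [Matrix.blockDiagonal'_apply_ne _ _ _ hw, star_zero, zero_mul]
        · simp
      · intro w _ hw
        refine Finset.sum_eq_zero fun x _ => ?_
        rw [Matrix.blockDiagonal'_apply_ne _ _ _ hw, mul_zero]
      · simp
    rw [h2]
    have h3 : (W v)ᴴ * Matrix.blockDiag' τ v * W v = rdiag (hb v).eigenvalues := by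
      have := eq_conj_rdiag_eigenvalues (hb v)
      calc (W v)ᴴ * Matrix.blockDiag' τ v * W v =
          (W v)ᴴ * (W v * rdiag (hb v).eigenvalues * (W v)ᴴ) * W v := by rw [← this]
        _ = ((W v)ᴴ * W v) * rdiag (hb v).eigenvalues * ((W v)ᴴ * W v) := by
            simp only [Matrix.mul_assoc]
        _ = _ := by rw [hW, Matrix.one_mul, Matrix.mul_one]
    rw [h3, rdiag, Matrix.diagonal_apply_ne]
    rintro rfl
    exact hij rfl

-- Operator convexity of `Z ↦ ZᴴZ`: the difference is half the sum of the squares of all `Z k - Z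
-- l`.
omit [DecidableEq A] in
lemma posSemidef_card_smul_sum_sub [Fintype ι] (Z : ι → Op A) :
    ((Fintype.card ι : ℂ) • ∑ k, (Z k)ᴴ * Z k - (∑ k, Z k)ᴴ * ∑ k, Z k).PosSemidef := by
  have e : (Fintype.card ι : ℂ) • ∑ k, (Z k)ᴴ * Z k - (∑ k, Z k)ᴴ * ∑ k, Z k =
      ((1 / 2 : ℝ) : ℂ) • ∑ k, ∑ l, (Z k - Z l)ᴴ * (Z k - Z l) := by
    have h1 : ∑ k, ∑ l, (Z k - Z l)ᴴ * (Z k - Z l) =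
        (Fintype.card ι : ℂ) • (∑ k, (Z k)ᴴ * Z k) - (∑ k, Z k)ᴴ * (∑ k, Z k) -
          (∑ k, Z k)ᴴ * (∑ k, Z k) + (Fintype.card ι : ℂ) • ∑ k, (Z k)ᴴ * Z k := by
      simp only [Matrix.conjTranspose_sub, Matrix.sub_mul, Matrix.mul_sub,
        Finset.sum_sub_distrib, Finset.sum_const, Finset.card_univ, Matrix.conjTranspose_sum,
        Finset.sum_mul_sum, ← Finset.smul_sum, Nat.cast_smul_eq_nsmul]
      rw [Finset.sum_comm (f := fun k l => (Z l)ᴴ * Z k)]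
      abel
    rw [h1]
    push_cast
    module
  rw [e]
  exact posSemidef_smul (Matrix.posSemidef_sum _ fun k _ => Matrix.posSemidef_sum _ fun l _ =>
    Matrix.posSemidef_conjTranspose_mul_self _) (by norm_num)

/-- The pinching inequality, for a positive matrix with diagonal blocks. -/
lemma posSemidef_pinching {Y : Op A} (hY : Y.PosSemidef) (μ : A → ℝ)
    (hd : ∀ i j, i ≠ j → μ i = μ j → Y i j = 0) :
    (((Finset.univ.image μ).card : ℂ) • Matrix.diagonal (fun i => Y i i) - Y).PosSemidef := by
  obtain ⟨Z, hZ⟩ := exists_eq_conjTranspose_mul_self hY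
  -- Projections onto the level sets of `μ`. They split `Z` into as many summands as `μ` has values,
  -- and by `hd` the corresponding pinching of `Y = ZᴴZ` is its diagonal.
  let P : Finset.univ.image μ → Op A := fun v => rdiag fun i => if μ i = v then 1 else 0
  have hP : ∑ v, P v = 1 := by
    ext i j
    rw [Matrix.sum_apply]
    by_cases h : i = j
    · subst h
      have : ∀ v : Finset.univ.image μ, P v i i = if v = ⟨μ i, by simp⟩ then 1 else 0 := fun v => by
        simp only [P, rdiag, Matrix.diagonal_apply_eq, Subtype.ext_iff, eq_comm (a := μ i)]
        split_ifs <;> simp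
      simp only [this, Finset.sum_ite_eq', Finset.mem_univ, if_true, Matrix.one_apply_eq]
    · simp [P, rdiag, h]
  have h := posSemidef_card_smul_sum_sub fun v => Z * P v
  have e1 : ∑ v, Z * P v = Z := by rw [← Finset.mul_sum, hP, Matrix.mul_one]
  have e2 : ∑ v, (Z * P v)ᴴ * (Z * P v) = Matrix.diagonal fun i => Y i i := by
    have : ∀ v, (Z * P v)ᴴ * (Z * P v) = P v * Y * P v := fun v => by
      have hPh : (P v)ᴴ = P v := (posSemidef_rdiag fun i => by split_ifs <;> norm_num).1
      rw [Matrix.conjTranspose_mul, hPh, hZ]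
      simp only [Matrix.mul_assoc]
    simp only [this]
    ext i j
    rw [Matrix.sum_apply]
    have h2 : ∀ v, (P v * Y * P v) i j =
        if v = ⟨μ i, by simp⟩ then (if μ i = μ j then Y i j else 0) else 0 := fun v => by
      simp only [P, rdiag, Matrix.diagonal_mul, Matrix.mul_diagonal, Subtype.ext_iff]
      by_cases h3 : μ i = v
      · by_cases h4 : μ j = v
        · simp [h3, h4]
        · simp [h3, h4, Ne.symm h4]
      · simp [h3, Ne.symm h3]
    simp only [h2, Finset.sum_ite_eq', Finset.mem_univ, if_true]
    by_cases hij : i = j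
    · subst hij; simp
    · rw [Matrix.diagonal_apply_ne _ hij]
      split_ifs with h5
      · exact hd i j hij h5
      · rfl
  rw [e1, e2, ← hZ, Fintype.card_coe] at h
  exact h

/-- Jensen's inequality for the diagonal of a power. -/
lemma rpow_diag_le {σ : Op A} (hσ : σ.PosSemidef) {V : Op A} (hV : Vᴴ * V = 1) {p : ℝ}
    (hp : 1 ≤ p) (i : A) :
    ((Vᴴ * σ * V) i i).re ^ p ≤ ((Vᴴ * rpow σ p * V) i i).re := by
  obtain ⟨U, d, hU, hU', hd, rfl⟩ := exists_spectral hσ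
  rw [rpow_conj_rdiag hU hU']
  -- A diagonal entry of a function of `σ` is a mean of its values on the spectrum, with weights
  -- that do not depend on the function.
  have h1 : ∀ c : A → ℝ, ((Vᴴ * (U * rdiag c * Uᴴ) * V) i i).re =
      ∑ k, ‖(Uᴴ * V) k i‖ ^ 2 * c k := fun c => by
    have e : Vᴴ * (U * rdiag c * Uᴴ) * V = (Uᴴ * V)ᴴ * rdiag c * (Uᴴ * V) := by
      rw [Matrix.conjTranspose_mul, Matrix.conjTranspose_conjTranspose]
      simp only [Matrix.mul_assoc]
    rw [e, Matrix.mul_apply, Complex.re_sum]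
    refine Finset.sum_congr rfl fun k _ => ?_
    rw [rdiag, Matrix.mul_diagonal, Matrix.conjTranspose_apply, mul_right_comm, Complex.star_def,
      ← Complex.normSq_eq_conj_mul_self, ← Complex.ofReal_mul, Complex.ofReal_re,
      Complex.normSq_eq_norm_sq]
  rw [h1, h1]
  refine Real.rpow_arith_mean_le_arith_mean_rpow _ _ _ (fun k _ => by positivity) ?_
    (fun k _ => hd k) hp
  have h2 := h1 fun _ => 1
  rw [conj_rdiag_one hU', Matrix.mul_one, hV] at h2
  simpa using h2.symm

/-- Truncation of `σ` to the directions in which it is at most `c ρ`. -/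
lemma exists_truncation {ρ σ : Op A} (hρ : ρ.PosSemidef) (hσ : σ.PosSemidef) {p : ℝ} (hp : 0 < p)
    (hle : (ρ - (p : ℂ) • σ).PosSemidef) {c s : ℝ} (hc : 0 < c) (hs : 0 < s) :
    ∃ E : Op A, E.PosSemidef ∧ E * E = E ∧ (1 - E).PosSemidef ∧
      ((1 - E) * σ).trace.re ≤ c ^ (-s) * (rpow σ (1 + s) * rpow ρ (-s)).trace.re ∧
      (((numEig ρ * c : ℝ) : ℂ) • ρ - E * σ * E).PosSemidef := by
  classical
  obtain ⟨V, μ, hV, hV', hρV, hcard, hdiag⟩ := exists_joint_basis hρ.1 hσ.1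
  set τ := Vᴴ * σ * V with hτ
  have hconj : ∀ X : Op A, X.PosSemidef → (Vᴴ * X * V).PosSemidef := fun X hX => by
    have := hX.mul_mul_conjTranspose_same Vᴴ
    rwa [Matrix.conjTranspose_conjTranspose] at this
  have hVτ : σ = V * τ * Vᴴ := by
    calc σ = (V * Vᴴ) * σ * (V * Vᴴ) := by rw [hV', Matrix.one_mul, Matrix.mul_one]
      _ = _ := by simp only [hτ, Matrix.mul_assoc]
  have hτp : τ.PosSemidef := hconj σ hσ
  have hVρ : Vᴴ * ρ * V = rdiag μ := by
    rw [hρV]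
    calc Vᴴ * (V * rdiag μ * Vᴴ) * V = (Vᴴ * V) * rdiag μ * (Vᴴ * V) := by
          simp only [Matrix.mul_assoc]
      _ = _ := by rw [hV, Matrix.one_mul, Matrix.mul_one]
  let t : A → ℝ := fun i => (τ i i).re
  have hdnn : ∀ (X : Op A), X.PosSemidef → ∀ i, 0 ≤ (X i i).re := fun X hX i =>
    (Complex.nonneg_iff.mp (hX.diag_nonneg)).1
  have ht : ∀ i, 0 ≤ t i := hdnn _ hτp
  have htτ : ∀ i, τ i i = (t i : ℂ) := fun i => (Complex.conj_eq_iff_re.mp (hτp.1.apply i i)).symm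
  have hμ : ∀ i, 0 ≤ μ i := fun i => by
    have := hdnn _ (hconj ρ hρ) i
    rw [hVρ] at this
    simpa [rdiag] using this
  have hμt : ∀ i, p * t i ≤ μ i := fun i => by
    have := hdnn _ (hconj _ hle) i
    rw [Matrix.mul_sub, Matrix.sub_mul, hVρ, Matrix.mul_smul, Matrix.smul_mul, ← hτ] at this
    simpa [rdiag, htτ] using this
  -- In the joint basis this is a classical likelihood-ratio cut-off. The lost mass is bounded by
  -- Markov's inequality, with `rpow_diag_le` replacing `t i ^ (1 + s)` by an entry of `σ^{1+s}`.
  let g : A → ℝ := fun i => if t i ≤ c * μ i then 1 else 0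
  have hg0 : ∀ i, 0 ≤ g i := fun i => by dsimp only [g]; split_ifs <;> norm_num
  have hg1 : ∀ i, g i ≤ 1 := fun i => by dsimp only [g]; split_ifs <;> norm_num
  have hgg : ∀ i, g i * g i = g i := fun i => by dsimp only [g]; split_ifs <;> norm_num
  have hsub : 1 - V * rdiag g * Vᴴ = V * rdiag (fun i => 1 - g i) * Vᴴ := by
    rw [← conj_rdiag_one hV', conj_rdiag_sub]
  refine ⟨V * rdiag g * Vᴴ, posSemidef_conj_rdiag V hg0, ?_, ?_, ?_, ?_⟩
  · rw [conj_rdiag_mul hV]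
    simp only [hgg]
  · rw [hsub]
    exact posSemidef_conj_rdiag V fun i => sub_nonneg.mpr (hg1 i)
  · have e1 : ∀ d : A → ℝ, ∀ X : Op A, ((V * rdiag d * Vᴴ) * X).trace.re =
        ∑ i, d i * ((Vᴴ * X * V) i i).re := fun d X => by
      have : ((V * rdiag d * Vᴴ) * X).trace = (rdiag d * (Vᴴ * X * V)).trace := by
        rw [Matrix.mul_assoc, Matrix.mul_assoc, Matrix.trace_mul_comm]
        simp only [Matrix.mul_assoc]
      rw [this, Matrix.trace, Complex.re_sum]
      refine Finset.sum_congr rfl fun i _ => ?_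
      rw [Matrix.diag_apply, rdiag, Matrix.diagonal_mul, Complex.re_ofReal_mul]
    rw [hsub, e1, re_trace_mul_comm (rpow σ (1 + s)), hρV, rpow_conj_rdiag hV hV', e1,
      Finset.mul_sum]
    refine Finset.sum_le_sum fun i _ => ?_
    have hJ := rpow_diag_le hσ hV (p := 1 + s) (by linarith) i
    rw [← hτ] at hJ ⊢
    change t i ^ (1 + s) ≤ _ at hJ
    have hr : 0 ≤ ((Vᴴ * rpow σ (1 + s) * V) i i).re :=
      (Real.rpow_nonneg (ht i) _).trans hJ
    have hcs : 0 ≤ c ^ (-s) := (Real.rpow_pos_of_pos hc _).le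
    by_cases h : t i ≤ c * μ i
    · simp only [g, h, if_true, sub_self, zero_mul]
      exact mul_nonneg hcs (mul_nonneg (Real.rpow_nonneg (hμ i) _) hr)
    · simp only [g, h, if_false, sub_zero, one_mul]
      have hti : 0 < t i := by
        refine lt_of_le_of_lt (mul_nonneg hc.le (hμ i)) (not_le.mp h)
      -- The domination `p σ ≤ ρ` excludes `μ i = 0`, where the convention `0 ^ (-s) = 0` would make
      -- the bound fail.
      have hμi : 0 < μ i := lt_of_lt_of_le (mul_pos hp hti) (hμt i)
      have h1 : 1 ≤ c ^ (-s) * (μ i ^ (-s) * t i ^ s) := by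
        rw [← mul_assoc, ← Real.mul_rpow hc.le hμi.le, Real.rpow_neg (by positivity),
          inv_mul_eq_div, one_le_div (by positivity)]
        exact Real.rpow_le_rpow (by positivity) (not_le.mp h).le hs.le
      calc t i ≤ t i * (c ^ (-s) * (μ i ^ (-s) * t i ^ s)) := le_mul_of_one_le_right hti.le h1
        _ = c ^ (-s) * (μ i ^ (-s) * t i ^ (1 + s)) := by
            rw [Real.rpow_add hti, Real.rpow_one]; ring
        _ ≤ _ := by gcongr
  · set Y := rdiag g * τ * rdiag g with hYdef
    have hgh : (rdiag g)ᴴ = rdiag g := (posSemidef_rdiag hg0).1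
    have hY : Y.PosSemidef := by
      have := hτp.mul_mul_conjTranspose_same (rdiag g)
      rwa [hgh] at this
    have hYa : ∀ i j, Y i j = g i * τ i j * g j := fun i j => by
      rw [hYdef, rdiag, Matrix.mul_diagonal, Matrix.diagonal_mul]
    have hpin := posSemidef_pinching hY μ fun i j hij h => by
      rw [hYa, hdiag i j hij h, mul_zero, zero_mul]
    have e1 : (V * rdiag g * Vᴴ) * σ * (V * rdiag g * Vᴴ) = V * Y * Vᴴ := by
      rw [hVτ, conj_mul_conj hV, conj_mul_conj hV]
    -- Pinching bounds `Y` by `numEig ρ` times its diagonal, and the cut-off bounds the diagonal by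
    -- `c μ`.
    have e2 : ((numEig ρ * c : ℝ) : ℂ) • ρ - V * Y * Vᴴ =
        V * ((((Finset.univ.image μ).card : ℂ) • Matrix.diagonal (fun i => Y i i) - Y) +
          (((Finset.univ.image μ).card : ℝ) : ℂ) • rdiag (fun i => c * μ i - g i * t i)) * Vᴴ := by
      have : ((numEig ρ * c : ℝ) : ℂ) • ρ = V * (((numEig ρ * c : ℝ) : ℂ) • rdiag μ) * Vᴴ := by
        rw [Matrix.mul_smul, Matrix.smul_mul, ← hρV]
      rw [this, ← Matrix.sub_mul, ← Matrix.mul_sub, hcard]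
      congr 2
      ext i j
      by_cases hij : i = j
      · subst hij
        simp only [Matrix.sub_apply, Matrix.add_apply, Matrix.smul_apply, rdiag,
          Matrix.diagonal_apply_eq, hYa, htτ, smul_eq_mul]
        have := congrArg (fun x : ℝ => (x : ℂ)) (hgg i)
        push_cast at this ⊢
        linear_combination (-(numEig ρ : ℂ) * (t i : ℂ)) * this
      · simp [rdiag, hij]
    rw [e1, e2]
    refine Matrix.PosSemidef.mul_mul_conjTranspose_same (hpin.add (posSemidef_smul
      (posSemidef_rdiag fun i => ?_) (Nat.cast_nonneg _))) V
    by_cases h : t i ≤ c * μ i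
    · simp only [g, h, if_true, one_mul, sub_nonneg]
    · simp only [g, h, if_false, zero_mul, sub_zero]
      exact mul_nonneg hc.le (hμ i)

end Pinching

/-! ## Classical-quantum states and tests -/

section CQ

variable {B : Type*} [Fintype B] [DecidableEq B] {m : ℕ}

omit [DecidableEq B] in
lemma cqState_mul (P P' : Fin m → ℝ) (σ σ' : Fin m → Op B) :
    cqState P σ * cqState P' σ' = cqState (fun x => P x * P' x) fun x => σ x * σ' x := by
  ext ⟨x, b⟩ ⟨y, b'⟩
  simp only [Matrix.mul_apply, cqState, Fintype.sum_prod_type]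
  rw [Finset.sum_eq_single x (fun z _ hz => by simp [Ne.symm hz]) (by simp)]
  by_cases h : x = y
  · subst h
    simp only [if_true, Complex.ofReal_mul, Finset.mul_sum]
    exact Finset.sum_congr rfl fun z _ => by ring
  · simp [h]

omit [DecidableEq B] in
lemma trace_cqState (P : Fin m → ℝ) (σ : Fin m → Op B) :
    (cqState P σ).trace = ∑ x, (P x : ℂ) * (σ x).trace := by
  simp only [Matrix.trace, Matrix.diag, cqState, Fintype.sum_prod_type, if_true, Finset.mul_sum]

omit [Fintype B] [DecidableEq B] in
lemma trFst_cqState (P : Fin m → ℝ) (σ : Fin m → Op B) :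
    trFst (cqState P σ) = ∑ x, (P x : ℂ) • σ x := by
  ext b b'
  simp [trFst, cqState, Matrix.sum_apply]

omit [DecidableEq B] in
lemma prodMarginals_cqState (P : Fin m → ℝ) {σ : Fin m → Op B} (hσ : ∀ x, (σ x).trace = 1) :
    prodMarginals (cqState P σ) = cqState P fun _ => ∑ x, (P x : ℂ) • σ x := by
  ext ⟨x, b⟩ ⟨y, b'⟩
  rw [prodMarginals, kroneckerMap_apply, trFst_cqState]
  by_cases h : x = y
  · subst h
    have : trSnd (cqState P σ) x x = P x := by
      have h1 := hσ x
      simp only [Matrix.trace, Matrix.diag] at h1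
      simp only [trSnd, cqState, if_true]
      rw [← Finset.mul_sum, h1, mul_one]
    simp [this, cqState]
  · have : trSnd (cqState P σ) x y = 0 := by simp [trSnd, cqState, h]
    simp [this, cqState, h]

lemma rpow_cqState {P : Fin m → ℝ} (hP : ∀ x, 0 ≤ P x) {σ : Fin m → Op B}
    (hσ : ∀ x, (σ x).PosSemidef) (p : ℝ) :
    rpow (cqState P σ) p = cqState (fun x => P x ^ p) fun x => rpow (σ x) p := by
  choose U d hU hU' hd hσd using fun x => exists_spectral (hσ x)
  let V : Op (Fin m × B) := cqState (fun _ => 1) U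
  have hVc : Vᴴ = cqState (fun _ => 1) fun x => (U x)ᴴ := by
    ext ⟨x, b⟩ ⟨y, b'⟩
    simp only [V, Matrix.conjTranspose_apply, cqState]
    by_cases h : x = y
    · subst h; simp
    · simp [h, Ne.symm h]
  have hone : (cqState (fun _ => 1) fun _ => 1 : Op (Fin m × B)) = 1 := by
    ext ⟨x, b⟩ ⟨y, b'⟩
    by_cases h : x = y <;> simp [cqState, h, Matrix.one_apply]
  have hV : Vᴴ * V = 1 := by
    rw [hVc, cqState_mul]
    simp only [hU, mul_one]
    exact hone
  have hV' : V * Vᴴ = 1 := by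
    rw [hVc, cqState_mul]
    simp only [hU', mul_one]
    exact hone
  have hdec : ∀ (Q : Fin m → ℝ) (c : Fin m → B → ℝ),
      cqState Q (fun x => U x * rdiag (c x) * (U x)ᴴ) =
        V * rdiag (fun q => Q q.1 * c q.1 q.2) * Vᴴ := fun Q c => by
    have : rdiag (fun q : Fin m × B => Q q.1 * c q.1 q.2) = cqState Q fun x => rdiag (c x) := by
      ext ⟨x, b⟩ ⟨y, b'⟩
      by_cases h : x = y <;> by_cases h' : b = b' <;> simp [cqState, h, h', rdiag]
    rw [this, hVc, cqState_mul, cqState_mul]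
    simp only [one_mul, mul_one]
  have h1 : cqState P σ = cqState P fun x => U x * rdiag (d x) * (U x)ᴴ :=
    congrArg (cqState P) (funext hσd)
  have h2 : (fun x => rpow (σ x) p) = fun x => U x * rdiag (fun i => d x i ^ p) * (U x)ᴴ :=
    funext fun x => by rw [hσd x, rpow_conj_rdiag (hU x) (hU' x)]
  rw [h1, h2, hdec, hdec, rpow_conj_rdiag hV hV']
  congr 3
  funext q
  exact Real.mul_rpow (hP _) (hd _ _)

/-- The trace in the definition of `mutualInfoH`. -/
lemma trace_mutualInfoH {P : Fin m → ℝ} (hP : ∀ x, 0 ≤ P x) {σ : Fin m → Op B}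
    (hσ : ∀ x, IsDensity (σ x)) (a : ℝ) :
    (cqState P σ * rpow (prodMarginals (cqState P σ)) (a / 2) * rpow (cqState P σ) (-a) *
      rpow (prodMarginals (cqState P σ)) (a / 2)).trace.re =
    ∑ x, P x * (σ x * rpow (∑ x, (P x : ℂ) • σ x) (a / 2) * rpow (σ x) (-a) *
      rpow (∑ x, (P x : ℂ) • σ x) (a / 2)).trace.re := by
  have hρ : (∑ x, (P x : ℂ) • σ x).PosSemidef :=
    Matrix.posSemidef_sum _ fun x _ => posSemidef_smul (hσ x).1 (hP x)
  rw [prodMarginals_cqState P fun x => (hσ x).2, rpow_cqState hP fun _ => hρ,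
    rpow_cqState hP fun x => (hσ x).1, cqState_mul, cqState_mul, cqState_mul, trace_cqState,
    Complex.re_sum]
  refine Finset.sum_congr rfl fun x _ => ?_
  rw [Complex.re_ofReal_mul]
  congr 1
  -- For `P x > 0` the powers `a/2`, `-a`, `a/2` of `P x` cancel; for `P x = 0` both sides vanish.
  rcases (hP x).eq_or_lt with h | h
  · rw [← h]; ring
  · rw [mul_assoc, mul_assoc, ← Real.rpow_add h, ← Real.rpow_add h]
    have : a / 2 + (-a + a / 2) = 0 := by ring
    rw [this, Real.rpow_zero, mul_one]

/-- Cauchy–Schwarz against `σ^{1/2}`, which has Hilbert–Schmidt norm `1`. It passes from the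
Chernoff quantity with exponent `b` to the trace in `mutualInfoH` with `a = 2b`. -/
lemma sq_trace_rpow_mul_rpow_le {σ ρ : Op B} (hσ : IsDensity σ) (hρ : ρ.PosSemidef) {b : ℝ}
    (hb : 0 < b) (hb' : b < 1 / 2) :
    (rpow ρ b * rpow σ (1 - b)).trace.re ^ 2 ≤
      (σ * rpow ρ b * rpow σ (-(2 * b)) * rpow ρ b).trace.re := by
  have hh : ∀ p, (rpow σ p)ᴴ = rpow σ p := fun p => (posSemidef_rpow hσ.1 p).1
  have hh' : (rpow ρ b)ᴴ = rpow ρ b := (posSemidef_rpow hρ b).1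
  have e1 : rpow σ (1 / 2) * rpow σ (1 / 2) = σ := by
    rw [rpow_mul_rpow hσ.1 (by norm_num) (by norm_num)]
    norm_num
    exact rpow_one hσ.1
  have e2 : rpow σ (-b) * rpow σ (-b) = rpow σ (-(2 * b)) := by
    rw [rpow_mul_rpow hσ.1 (by linarith) (by linarith)]
    congr 1; ring
  have e3 : rpow σ (1 / 2) * (rpow σ (1 / 2) * rpow σ (-b)) = rpow σ (1 - b) := by
    rw [rpow_mul_rpow hσ.1 (by norm_num) (by linarith), rpow_mul_rpow hσ.1 (by norm_num)
      (by linarith)]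
    congr 1; ring
  have h := re_trace_conjTranspose_mul_le (rpow σ (1 / 2))
    (rpow σ (-b) * rpow ρ b * rpow σ (1 / 2))
  rw [hh, e1, hσ.2, Complex.one_re, Real.sqrt_one, one_mul] at h
  have f1 : (rpow σ (1 / 2) * (rpow σ (-b) * rpow ρ b * rpow σ (1 / 2))).trace.re =
      (rpow ρ b * rpow σ (1 - b)).trace.re := by
    rw [← e3, re_trace_mul_comm (rpow ρ b), re_trace_mul_comm (rpow σ (1 / 2))]
    rw [Matrix.mul_assoc, e1, Matrix.mul_assoc, re_trace_mul_comm, Matrix.mul_assoc,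
      ← Matrix.mul_assoc (rpow σ (1 / 2)) (rpow σ (1 / 2)), e1, re_trace_mul_comm,
      Matrix.mul_assoc, re_trace_mul_comm, Matrix.mul_assoc, re_trace_mul_comm, Matrix.mul_assoc]
  have f2 : ((rpow σ (-b) * rpow ρ b * rpow σ (1 / 2))ᴴ *
      (rpow σ (-b) * rpow ρ b * rpow σ (1 / 2))).trace.re =
      (σ * rpow ρ b * rpow σ (-(2 * b)) * rpow ρ b).trace.re := by
    rw [Matrix.conjTranspose_mul, Matrix.conjTranspose_mul, hh, hh, hh']
    calc _ = (rpow σ (1 / 2) * (rpow ρ b * (rpow σ (-b) * rpow σ (-b)) * rpow ρ b *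
          rpow σ (1 / 2))).trace.re := by simp only [Matrix.mul_assoc]
      _ = ((rpow σ (1 / 2) * rpow σ (1 / 2)) * rpow ρ b * (rpow σ (-b) * rpow σ (-b)) *
          rpow ρ b).trace.re := by
          rw [← Matrix.mul_assoc, re_trace_mul_comm]; simp only [Matrix.mul_assoc]
      _ = _ := by rw [e1, e2]
  rw [f1, f2] at h
  have h0 := re_trace_mul_nonneg (posSemidef_rpow hρ b) (posSemidef_rpow hσ.1 (1 - b))
  calc _ ≤ √(σ * rpow ρ b * rpow σ (-(2 * b)) * rpow ρ b).trace.re ^ 2 := by gcongr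
    _ = _ := Real.sq_sqrt (f2 ▸ re_trace_nonneg (Matrix.posSemidef_conjTranspose_mul_self _))

/-- Weighted Jensen inequality for the square root. -/
lemma sum_mul_sqrt_le {ι : Type*} [Fintype ι] {w f : ι → ℝ} (hw : ∀ i, 0 ≤ w i)
    (hw1 : ∑ i, w i = 1) (hf : ∀ i, 0 ≤ f i) : ∑ i, w i * √(f i) ≤ √(∑ i, w i * f i) := by
  refine Real.le_sqrt_of_sq_le ?_
  have := Real.pow_arith_mean_le_arith_mean_pow_of_even Finset.univ w (fun i => √(f i))
    (fun i _ => hw i) hw1 even_two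
  simpa only [Real.sq_sqrt (hf _)] using this

/-- Tests that distinguish the states of an ensemble from their mean. -/
lemma exists_packing_tests {P : Fin m → ℝ} (hP : ∀ x, 0 ≤ P x) (hP1 : ∑ x, P x = 1)
    {σ : Fin m → Op B} (hσ : ∀ x, IsDensity (σ x)) {a T : ℝ} (ha : a ∈ Set.Ioo (0 : ℝ) 1)
    (hT : 0 ≤ T) :
    ∃ E : Fin m → Op B, (∀ x, (E x).PosSemidef) ∧ (∀ x, (1 - E x).PosSemidef) ∧
      ∑ x, P x * ((1 - E x) * σ x).trace.re +
        T * ∑ x, P x * (E x * ∑ y, (P y : ℂ) • σ y).trace.re ≤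
      T ^ (a / 2) * √(cqState P σ * rpow (prodMarginals (cqState P σ)) (a / 2) *
        rpow (cqState P σ) (-a) * rpow (prodMarginals (cqState P σ)) (a / 2)).trace.re := by
  set ρ := ∑ y, (P y : ℂ) • σ y with hρdef
  have hρ : ρ.PosSemidef := Matrix.posSemidef_sum _ fun x _ => posSemidef_smul (hσ x).1 (hP x)
  have hb : a / 2 ∈ Set.Ioo (0 : ℝ) 1 := ⟨by linarith [ha.1], by linarith [ha.2]⟩
  -- Each state is tested against `T` times the mean, so that false acceptance is weighted by the
  -- number `T` of competing codewords.
  choose E hE hE' hEt using fun x => exists_test (hσ x).1 (posSemidef_smul hρ hT) hb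
  refine ⟨E, hE, hE', ?_⟩
  rw [trace_mutualInfoH hP hσ, ← hρdef]
  have h0 : ∀ x, 0 ≤ (rpow ρ (a / 2) * rpow (σ x) (1 - a / 2)).trace.re := fun x =>
    re_trace_mul_nonneg (posSemidef_rpow hρ _) (posSemidef_rpow (hσ x).1 _)
  calc _ = ∑ x, P x * (((1 - E x) * σ x).trace.re + (E x * ((T : ℂ) • ρ)).trace.re) := by
        rw [Finset.mul_sum, ← Finset.sum_add_distrib]
        refine Finset.sum_congr rfl fun x _ => ?_
        rw [Matrix.mul_smul, re_trace_smul]; ring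
    _ ≤ ∑ x, P x * (T ^ (a / 2) * (rpow ρ (a / 2) * rpow (σ x) (1 - a / 2)).trace.re) := by
        refine Finset.sum_le_sum fun x _ => mul_le_mul_of_nonneg_left ((hEt x).trans_eq ?_) (hP x)
        rw [rpow_smul hρ hT, Matrix.smul_mul, re_trace_smul]
    _ = T ^ (a / 2) * ∑ x, P x * (rpow ρ (a / 2) * rpow (σ x) (1 - a / 2)).trace.re := by
        rw [Finset.mul_sum]
        exact Finset.sum_congr rfl fun x _ => by ring
    _ ≤ _ := by
        refine mul_le_mul_of_nonneg_left ?_ (Real.rpow_nonneg hT _)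
        have hq : ∀ x, (rpow ρ (a / 2) * rpow (σ x) (1 - a / 2)).trace.re ^ 2 ≤
            (σ x * rpow ρ (a / 2) * rpow (σ x) (-a) * rpow ρ (a / 2)).trace.re := fun x => by
          have := sq_trace_rpow_mul_rpow_le (hσ x) hρ hb.1 (by linarith [ha.2])
          rwa [mul_div_cancel₀ a two_ne_zero] at this
        refine le_trans ?_ (Real.sqrt_le_sqrt (Finset.sum_le_sum fun x _ =>
          mul_le_mul_of_nonneg_left (hq x) (hP x)))
        refine le_trans (le_of_eq ?_) (sum_mul_sqrt_le hP hP1 fun x => sq_nonneg _)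
        exact Finset.sum_congr rfl fun x _ => by rw [Real.sqrt_sq (h0 x)]

end CQ

/-! ## Random codebooks -/

section Codebook

variable {B X I : Type*} [Fintype B] [DecidableEq B] [Fintype X] [Fintype I] [DecidableEq I]

/-- The products `∏ P (x i)` are the distribution of a codebook of independent codewords. Only this
normalization and the marginals of one and of two codewords are needed below. -/
lemma sum_prod_weight {P : X → ℝ} (hP1 : ∑ x, P x = 1) :
    ∑ x : I → X, ∏ i, P (x i) = 1 := by
  have h := Finset.prod_univ_sum (fun _ : I => (Finset.univ : Finset X)) fun _ x => P x
  rw [Fintype.piFinset_univ] at h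
  rw [← h]
  simp [hP1]

lemma sum_weight_split (P : X → ℝ) (i : I) (f : X → ({j // j ≠ i} → X) → ℝ) :
    ∑ x : I → X, (∏ k, P (x k)) * f (x i) (fun j => x j) =
      ∑ a, P a * ∑ y : {j // j ≠ i} → X, (∏ k, P (y k)) * f a y := by
  rw [← Equiv.sum_comp (Equiv.funSplitAt i X).symm, Fintype.sum_prod_type]
  refine Finset.sum_congr rfl fun a _ => ?_
  rw [Finset.mul_sum]
  refine Finset.sum_congr rfl fun y _ => ?_
  have h1 : (Equiv.funSplitAt i X).symm (a, y) i = a := by simp [Equiv.funSplitAt]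
  have h2 : ∀ j : {j // j ≠ i}, (Equiv.funSplitAt i X).symm (a, y) j = y j := fun j => by
    simp [Equiv.funSplitAt, j.2]
  rw [Fintype.prod_eq_mul_prod_subtype_ne _ i, h1]
  simp only [h2]
  ring

lemma expect_one {P : X → ℝ} (hP1 : ∑ x, P x = 1) (i : I) (f : X → ℝ) :
    ∑ x : I → X, (∏ k, P (x k)) * f (x i) = ∑ a, P a * f a := by
  rw [sum_weight_split P i fun a _ => f a]
  refine Finset.sum_congr rfl fun a _ => ?_
  rw [← Finset.sum_mul, sum_prod_weight hP1, one_mul]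

lemma expect_two {P : X → ℝ} (hP1 : ∑ x, P x = 1) {i j : I} (hij : j ≠ i) (h : X → X → ℝ) :
    ∑ x : I → X, (∏ k, P (x k)) * h (x i) (x j) = ∑ a, P a * ∑ b, P b * h a b := by
  rw [sum_weight_split P i fun a y => h a (y ⟨j, hij⟩)]
  refine Finset.sum_congr rfl fun a _ => ?_
  rw [expect_one hP1 (⟨j, hij⟩ : {j // j ≠ i}) (h a)]

lemma exists_le_of_sum_mul_le {ι : Type*} [Fintype ι] {w f : ι → ℝ} {c : ℝ} (hw : ∀ i, 0 ≤ w i)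
    (hw1 : ∑ i, w i = 1) (h : ∑ i, w i * f i ≤ c) : ∃ i, f i ≤ c := by
  by_contra! hc
  have hex : ∃ i, 0 < w i := by
    by_contra! h0
    have : ∑ i, w i ≤ 0 := Finset.sum_nonpos fun i _ => h0 i
    linarith
  obtain ⟨i, hi⟩ := hex
  have : ∑ i, w i * c < ∑ i, w i * f i :=
    Finset.sum_lt_sum (fun i _ => mul_le_mul_of_nonneg_left (hc i).le (hw i))
      ⟨i, Finset.mem_univ _, mul_lt_mul_of_pos_left (hc i) hi⟩
  rw [← Finset.sum_mul, hw1, one_mul] at this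
  linarith

/-- With `S = R^{1/4}` and its inverse `S'`, inserting `S S'` on both sides of `Z` in `tr HZ` and
applying Cauchy–Schwarz replaces the trace norm by a weighted quadratic form, for which variances
can be computed. -/
lemma traceNorm_le_of_weight {S S' R Z : Op B} (hS : S.PosSemidef) (hS' : S'.PosSemidef)
    (h1 : S * S' = 1) (h2 : S' * S = 1) (hR : S * S * (S * S) = R) (hZ : Z.IsHermitian) :
    traceNorm Z ≤ √R.trace.re * √(Z * (S' * S') * (Z * (S' * S'))).trace.re := by
  obtain ⟨H, hH, -, -, hHH, hHZ⟩ := exists_sign hZ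
  have hSh := hS.1.eq
  have hSh' := hS'.1.eq
  have hHh := hH.eq
  have e1 : (H * Z).trace.re = ((S * H * S)ᴴ * (S' * Z * S')).trace.re := by
    rw [Matrix.conjTranspose_mul, Matrix.conjTranspose_mul, hSh, hHh]
    calc (H * Z).trace.re = (H * (S * S') * Z * (S' * S)).trace.re := by
          rw [h1, h2, Matrix.mul_one, Matrix.mul_one]
      _ = (H * (S * S') * Z * S' * S).trace.re := by simp only [Matrix.mul_assoc]
      _ = _ := by rw [re_trace_mul_comm]; simp only [Matrix.mul_assoc]
  rw [← hHZ, e1]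
  refine (re_trace_conjTranspose_mul_le _ _).trans ?_
  refine mul_le_mul (Real.sqrt_le_sqrt ?_) (le_of_eq ?_) (Real.sqrt_nonneg _) (Real.sqrt_nonneg _)
  · have hQ : (S * S)ᴴ = S * S := by rw [Matrix.conjTranspose_mul, hSh]
    -- The inner product of `R^{1/2}H` and `HR^{1/2}`. Both have squared norm `tr H²R ≤ tr R`, so a
    -- second application of Cauchy–Schwarz bounds it.
    have e2 : ((S * H * S)ᴴ * (S * H * S)).trace.re =
        ((S * S * H)ᴴ * (H * (S * S))).trace.re := by
      rw [Matrix.conjTranspose_mul, Matrix.conjTranspose_mul, Matrix.conjTranspose_mul, hSh, hHh,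
        hQ]
      calc (S * (H * S) * (S * H * S)).trace.re = (S * (H * (S * S) * H * S)).trace.re := by
            simp only [Matrix.mul_assoc]
        _ = _ := by rw [re_trace_mul_comm]; simp only [Matrix.mul_assoc]
    have hRp : R.PosSemidef := by
      have := Matrix.posSemidef_conjTranspose_mul_self (S * S)
      rwa [hQ, hR] at this
    have hRH : (H * H * R).trace.re ≤ R.trace.re := re_trace_mul_le_of_effect hHH hRp
    have e3 : ((S * S * H)ᴴ * (S * S * H)).trace.re = (H * H * R).trace.re := by
      rw [Matrix.conjTranspose_mul, hQ, hHh, ← hR]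
      calc (H * (S * S) * (S * S * H)).trace.re = (H * (S * S * (S * S)) * H).trace.re := by
            simp only [Matrix.mul_assoc]
        _ = _ := by rw [re_trace_mul_comm]; simp only [Matrix.mul_assoc]
    have e4 : ((H * (S * S))ᴴ * (H * (S * S))).trace.re = (H * H * R).trace.re := by
      rw [Matrix.conjTranspose_mul, hQ, hHh, ← hR]
      calc (S * S * H * (H * (S * S))).trace.re = (S * S * (H * H * (S * S))).trace.re := by
            simp only [Matrix.mul_assoc]
        _ = _ := by rw [re_trace_mul_comm]; simp only [Matrix.mul_assoc]
    rw [e2]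
    refine (re_trace_conjTranspose_mul_le _ _).trans ?_
    have h0 : 0 ≤ (H * H * R).trace.re :=
      e3 ▸ re_trace_nonneg (Matrix.posSemidef_conjTranspose_mul_self _)
    rw [e3, e4, Real.mul_self_sqrt h0]
    exact hRH
  · congr 1
    rw [Matrix.conjTranspose_mul, Matrix.conjTranspose_mul, hSh', hZ.eq]
    calc (S' * (Z * S') * (S' * Z * S')).trace.re =
        (S' * (Z * (S' * S') * Z * S')).trace.re := by simp only [Matrix.mul_assoc]
      _ = _ := by rw [re_trace_mul_comm]; simp only [Matrix.mul_assoc]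

/-- The mean of a random sample of operators bounded by `c ρ` concentrates. -/
lemma expect_traceNorm_avg_sub_le [Nonempty I] {P : X → ℝ} (hP : ∀ x, 0 ≤ P x)
    (hP1 : ∑ x, P x = 1) {ρ : Op B} (hρ : IsDensity ρ) {Y : X → Op B}
    (hY : ∀ x, (Y x).PosSemidef) (hY1 : ∀ x, (Y x).trace.re ≤ 1) {c : ℝ} (hc : 0 ≤ c)
    (hle : ∀ x, ((c : ℂ) • ρ - Y x).PosSemidef) :
    ∑ x : I → X, (∏ k, P (x k)) * traceNorm (avg (fun i => Y (x i)) - ∑ a, (P a : ℂ) • Y a) ≤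
      √(2 * (c / Fintype.card I)) := by
  have hne : Nonempty B := by
    by_contra h
    rw [not_nonempty_iff] at h
    have := hρ.2
    simp [Matrix.trace] at this
  have hd : (0 : ℝ) < Fintype.card B := Nat.cast_pos.mpr Fintype.card_pos
  have hN : (0 : ℝ) < Fintype.card I := Nat.cast_pos.mpr Fintype.card_pos
  -- Adding `1/dim` makes the weight invertible while its trace only grows to `2`.
  obtain ⟨S, S', hS, hS', h1, h2, h3⟩ := exists_quarter_power hρ.1 (inv_pos.mpr hd)
  set R := ρ + (((Fintype.card B : ℝ)⁻¹ : ℝ) : ℂ) • (1 : Op B) with hR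
  have hRtr : R.trace.re = 2 := by
    rw [hR, Matrix.trace_add, Complex.add_re, re_trace_smul, hρ.2, Matrix.trace_one]
    simp only [Complex.one_re, Complex.natCast_re]
    rw [inv_mul_cancel₀ hd.ne']
    norm_num
  set T := S' * S' with hT
  set Ym := ∑ a, (P a : ℂ) • Y a with hYm
  have hYmh : Ym.IsHermitian := isHermitian_sum _ fun a _ => isHermitian_smul (hY a).1 _
  let D : X → Op B := fun a => Y a - Ym
  let q : Op B → Op B → ℝ := fun U V => (U * T * (V * T)).trace.re
  have hTh : T.IsHermitian := by rw [Matrix.IsHermitian, hT, Matrix.conjTranspose_mul, hS'.1.eq]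
  have hTp : T.PosSemidef := by
    have := Matrix.posSemidef_conjTranspose_mul_self S'
    rwa [hS'.1.eq] at this
  have hqs : ∀ (F : X → Op B) (V : Op B),
      q (∑ a, (P a : ℂ) • F a) V = ∑ a, P a * q (F a) V := fun F V => by
    simp only [q, Finset.sum_mul, Matrix.trace_sum, Complex.re_sum, Matrix.smul_mul, re_trace_smul]
  have hqc : ∀ U V, q U V = q V U := fun U V => re_trace_mul_comm _ _
  have hqnn : ∀ U : Op B, U.IsHermitian → 0 ≤ q U U := fun U hU => by
    have e : q U U = ((S' * U * S')ᴴ * (S' * U * S')).trace.re := by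
      rw [Matrix.conjTranspose_mul, Matrix.conjTranspose_mul, hS'.1.eq, hU.eq]
      calc (U * T * (U * T)).trace.re = ((U * T * U * S') * S').trace.re := by
            rw [hT]; simp only [Matrix.mul_assoc]
        _ = _ := by rw [re_trace_mul_comm, hT]; simp only [Matrix.mul_assoc]
    rw [e]
    exact re_trace_nonneg (Matrix.posSemidef_conjTranspose_mul_self _)
  have hDsum : ∑ a, (P a : ℂ) • D a = 0 := by
    simp only [D, smul_sub, Finset.sum_sub_distrib, ← hYm]
    rw [← Finset.sum_smul, ← Complex.ofReal_sum, hP1, Complex.ofReal_one, one_smul, sub_self]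
  have hDq : ∀ V, ∑ a, P a * q (D a) V = 0 := fun V => by
    rw [← hqs, hDsum]
    simp [q]
  have hqsub : ∀ U V W, q (U - V) W = q U W - q V W := fun U V W => by
    simp only [q, Matrix.sub_mul, Matrix.trace_sub, Complex.sub_re]
  -- `Y ≤ cR` and `T R T = 1` give `tr (Y T Y T) ≤ c tr Y ≤ c`.
  have hqY : ∀ a, q (Y a) (Y a) ≤ c := fun a => by
    have hTYT : (T * Y a * T).PosSemidef := by
      have := (hY a).mul_mul_conjTranspose_same T
      rwa [hTh.eq] at this
    have hcR : ((c : ℂ) • R - Y a).PosSemidef := by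
      have : (c : ℂ) • R - Y a = ((c : ℂ) • ρ - Y a) +
          ((c * (Fintype.card B : ℝ)⁻¹ : ℝ) : ℂ) • (1 : Op B) := by
        rw [hR, smul_add, smul_smul, ← Complex.ofReal_mul]; abel
      rw [this]
      exact (hle a).add (posSemidef_smul Matrix.PosSemidef.one (by positivity))
    have h4 := re_trace_mul_mono hcR hTYT
    have e1 : (Y a * (T * Y a * T)).trace.re = q (Y a) (Y a) := by
      simp only [q, Matrix.mul_assoc]
    have e2 : ((c : ℂ) • R * (T * Y a * T)).trace.re = c * (Y a).trace.re := by
      rw [Matrix.smul_mul, re_trace_smul, ← h3]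
      have f1 : T * (S * S * (S * S)) * T = 1 := by
        calc S' * S' * (S * S * (S * S)) * (S' * S') =
            S' * (S' * S) * S * S * (S * S') * S' := by simp only [Matrix.mul_assoc]
          _ = (S' * S) * (S * S') := by
              rw [h1, h2, Matrix.mul_one, Matrix.mul_one]; simp only [Matrix.mul_assoc, h1, h2, Matrix.mul_one]
          _ = 1 := by rw [h1, h2, Matrix.one_mul]
      congr 1
      calc (S * S * (S * S) * (T * Y a * T)).trace.re =
          (S * S * (S * S) * T * Y a * T).trace.re := by simp only [Matrix.mul_assoc]
        _ = (T * (S * S * (S * S)) * T * Y a).trace.re := by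
            rw [re_trace_mul_comm]; simp only [Matrix.mul_assoc]
        _ = _ := by rw [f1, Matrix.one_mul]
    rw [e1, e2] at h4
    exact h4.trans (mul_le_of_le_one_right hc (hY1 a))
  have hvar : ∑ a, P a * q (D a) (D a) ≤ c := by
    have e1 : ∀ a, P a * q (D a) (D a) = P a * q (Y a) (Y a) - P a * q (Y a) Ym -
        P a * q (D a) Ym := fun a => by
      have : q (D a) (D a) = q (Y a) (Y a) - q (Y a) Ym - q (D a) Ym := by
        have f1 : q (D a) (D a) = q (Y a) (D a) - q Ym (D a) := hqsub _ _ _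
        have f2 : q (Y a) (D a) = q (Y a) (Y a) - q (Y a) Ym := by
          rw [hqc (Y a) (D a), hqsub, hqc Ym]
        rw [f1, f2, hqc Ym]
      rw [this]; ring
    simp only [e1, Finset.sum_sub_distrib]
    rw [hDq, sub_zero, ← hqs Y Ym, ← hYm]
    have h5 : ∑ a, P a * q (Y a) (Y a) ≤ ∑ a, P a * c :=
      Finset.sum_le_sum fun a _ => mul_le_mul_of_nonneg_left (hqY a) (hP a)
    rw [← Finset.sum_mul, hP1, one_mul] at h5
    linarith [hqnn Ym hYmh]
  let Z : (I → X) → Op B := fun x => avg (fun i => Y (x i)) - Ym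
  have hZh : ∀ x, (Z x).IsHermitian := fun x => (IsHermitian.avg fun i => (hY _).1).sub hYmh
  have hZq : ∀ x, q (Z x) (Z x) = ((Fintype.card I : ℝ)⁻¹) ^ 2 *
      ∑ i, ∑ j, q (D (x i)) (D (x j)) := fun x => by
    have e1 : Z x = ∑ i, (((Fintype.card I : ℝ)⁻¹ : ℝ) : ℂ) • D (x i) := by
      have : Z x = avg fun i => D (x i) := by
        simp only [Z, D]
        rw [avg_sub, avg_const]
      rw [this, avg, Finset.smul_sum]
    have e2 : ∀ V, q (Z x) V = (Fintype.card I : ℝ)⁻¹ * ∑ i, q (D (x i)) V := fun V => by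
      rw [e1]
      simp only [q, Finset.sum_mul, Matrix.trace_sum, Complex.re_sum, Matrix.smul_mul,
        re_trace_smul, Finset.mul_sum]
    rw [e2]
    have e3 : ∀ i, q (D (x i)) (Z x) = (Fintype.card I : ℝ)⁻¹ * ∑ j, q (D (x i)) (D (x j)) :=
      fun i => by
        rw [hqc, e2]
        simp only [hqc (D (x i))]
    simp only [e3, ← Finset.mul_sum]
    ring
  have hZexp : ∑ x : I → X, (∏ k, P (x k)) * q (Z x) (Z x) ≤ c / Fintype.card I := by
    have e1 : ∑ x : I → X, (∏ k, P (x k)) * q (Z x) (Z x) = ((Fintype.card I : ℝ)⁻¹) ^ 2 *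
        ∑ i, ∑ j, ∑ x : I → X, (∏ k, P (x k)) * q (D (x i)) (D (x j)) := by
      simp only [hZq]
      have : ∀ x : I → X, (∏ k, P (x k)) * (((Fintype.card I : ℝ)⁻¹) ^ 2 *
          ∑ i, ∑ j, q (D (x i)) (D (x j))) = ((Fintype.card I : ℝ)⁻¹) ^ 2 *
          ∑ i, ∑ j, (∏ k, P (x k)) * q (D (x i)) (D (x j)) := fun x => by
        simp only [← Finset.mul_sum]; ring
      simp only [this]
      rw [← Finset.mul_sum, Finset.sum_comm]
      congr 1
      exact Finset.sum_congr rfl fun i _ => Finset.sum_comm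
    -- Centred terms with different indices are independent, so only the diagonal of the double sum
    -- survives.
    have e2 : ∀ i j : I, ∑ x : I → X, (∏ k, P (x k)) * q (D (x i)) (D (x j)) =
        if i = j then ∑ a, P a * q (D a) (D a) else 0 := fun i j => by
      split_ifs with hij
      · subst hij
        exact expect_one hP1 i fun a => q (D a) (D a)
      · rw [expect_two hP1 (Ne.symm hij) fun a b => q (D a) (D b)]
        have : ∀ a, ∑ b, P b * q (D a) (D b) = 0 := fun a => by
          rw [← hDq (D a)]
          exact Finset.sum_congr rfl fun b _ => by rw [hqc]
        simp [this]
    rw [e1]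
    simp only [e2, Finset.sum_ite_eq, Finset.mem_univ, if_true, Finset.sum_const,
      Finset.card_univ, nsmul_eq_mul]
    calc ((Fintype.card I : ℝ)⁻¹) ^ 2 * (Fintype.card I * ∑ a, P a * q (D a) (D a)) =
        (∑ a, P a * q (D a) (D a)) / Fintype.card I := by field_simp
      _ ≤ _ := by gcongr
  have hWnn : ∀ x : I → X, 0 ≤ ∏ k, P (x k) := fun x => Finset.prod_nonneg fun k _ => hP _
  calc _ ≤ ∑ x : I → X, (∏ k, P (x k)) * √(2 * q (Z x) (Z x)) := by
        refine Finset.sum_le_sum fun x _ => mul_le_mul_of_nonneg_left ?_ (hWnn x)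
        have := traceNorm_le_of_weight hS hS' h1 h2 h3 (hZh x)
        rwa [hRtr, ← Real.sqrt_mul zero_le_two] at this
    _ ≤ √(∑ x : I → X, (∏ k, P (x k)) * (2 * q (Z x) (Z x))) :=
        sum_mul_sqrt_le hWnn (sum_prod_weight hP1) fun x =>
          mul_nonneg zero_le_two (hqnn _ (hZh x))
    _ ≤ _ := by
        refine Real.sqrt_le_sqrt ?_
        rw [show ∑ x : I → X, (∏ k, P (x k)) * (2 * q (Z x) (Z x)) =
          2 * ∑ x : I → X, (∏ k, P (x k)) * q (Z x) (Z x) by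
            rw [Finset.mul_sum]; exact Finset.sum_congr rfl fun x _ => by ring]
        linarith

/-- The mean of a random sample from an ensemble is close to the mean of the ensemble. -/
lemma expect_traceNorm_sample_le [Nonempty I] {P : X → ℝ} (hP : ∀ x, 0 ≤ P x)
    (hP1 : ∑ x, P x = 1) {σ : X → Op B} (hσ : ∀ x, IsDensity (σ x)) {ρ : Op B}
    (hρ : IsDensity ρ) (hρσ : ρ = ∑ a, (P a : ℂ) • σ a) {Y : X → Op B}
    (hY : ∀ x, (Y x).PosSemidef) (hY1 : ∀ x, (Y x).trace.re ≤ 1) {c γ : ℝ} (hc : 0 ≤ c)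
    (hle : ∀ x, ((c : ℂ) • ρ - Y x).PosSemidef)
    (hγ : ∑ a, P a * traceNorm (σ a - Y a) ≤ γ) :
    ∑ x : I → X, (∏ k, P (x k)) * traceNorm (avg (fun i => σ (x i)) - ρ) ≤
      2 * γ + √(2 * (c / Fintype.card I)) := by
  have hWnn : ∀ x : I → X, 0 ≤ ∏ k, P (x k) := fun x => Finset.prod_nonneg fun k _ => hP _
  have hN : (0 : ℝ) < Fintype.card I := Nat.cast_pos.mpr Fintype.card_pos
  set Ym := ∑ a, (P a : ℂ) • Y a with hYm
  have hYmh : Ym.IsHermitian := isHermitian_sum _ fun a _ => isHermitian_smul (hY a).1 _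
  have h3 : traceNorm (Ym - ρ) ≤ γ := by
    rw [traceNorm_sub_comm, hρσ, hYm, ← Finset.sum_sub_distrib]
    simp only [← smul_sub]
    refine (traceNorm_sum_le _ fun a _ => isHermitian_smul ((hσ a).1.1.sub (hY a).1) _).trans
      (le_trans (Finset.sum_le_sum fun a _ => ?_) hγ)
    exact traceNorm_smul_le ((hσ a).1.1.sub (hY a).1) (hP a)
  have h1 : ∑ x : I → X, (∏ k, P (x k)) *
      ((Fintype.card I : ℝ)⁻¹ * ∑ i, traceNorm (σ (x i) - Y (x i))) ≤ γ := by
    have e : ∑ x : I → X, (∏ k, P (x k)) *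
        ((Fintype.card I : ℝ)⁻¹ * ∑ i, traceNorm (σ (x i) - Y (x i))) =
        (Fintype.card I : ℝ)⁻¹ * ∑ i : I, ∑ x : I → X, (∏ k, P (x k)) *
          traceNorm (σ (x i) - Y (x i)) := by
      rw [Finset.sum_comm, Finset.mul_sum]
      refine Finset.sum_congr rfl fun x _ => ?_
      rw [← Finset.mul_sum]; ring
    rw [e]
    refine inv_card_mul_sum_le fun i => ?_
    rw [expect_one hP1 i fun a => traceNorm (σ a - Y a)]
    exact hγ
  -- Triangle inequality through the sample mean and the true mean of the truncated `Y`; each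
  -- replacement of `σ` by `Y` costs `γ`.
  calc _ ≤ ∑ x : I → X, (∏ k, P (x k)) *
        ((Fintype.card I : ℝ)⁻¹ * ∑ i, traceNorm (σ (x i) - Y (x i)) +
          traceNorm (avg (fun i => Y (x i)) - Ym) + γ) := by
        refine Finset.sum_le_sum fun x _ => mul_le_mul_of_nonneg_left ?_ (hWnn x)
        have ha : (avg fun i => σ (x i)).IsHermitian := IsHermitian.avg fun i => (hσ _).1.1
        have hb : (avg fun i => Y (x i)).IsHermitian := IsHermitian.avg fun i => (hY _).1
        refine (traceNorm_sub_le_add ha hYmh hρ.1.1).trans (add_le_add ?_ h3)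
        refine (traceNorm_sub_le_add ha hb hYmh).trans (add_le_add ?_ le_rfl)
        rw [← avg_sub]
        exact traceNorm_avg_le fun i => (hσ _).1.1.sub (hY _).1
    _ = ∑ x : I → X, (∏ k, P (x k)) *
        ((Fintype.card I : ℝ)⁻¹ * ∑ i, traceNorm (σ (x i) - Y (x i))) +
        ∑ x : I → X, (∏ k, P (x k)) * traceNorm (avg (fun i => Y (x i)) - Ym) + γ := by
        simp only [mul_add, Finset.sum_add_distrib]
        rw [← Finset.sum_mul, sum_prod_weight hP1, one_mul]
    _ ≤ _ := by
        have := expect_traceNorm_avg_sub_le (I := I) hP hP1 hρ hY hY1 hc hle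
        linarith

end Codebook

/-! ## Covert codes over general channels -/

section Noisy

variable {A B X κ M : Type*} [Fintype A] [Fintype B] [DecidableEq B] [Fintype X] [Fintype κ]
  [Fintype M]

/-- There is a codebook which is good for decoding with every key, and whose mean is close to the
mean of the ensemble. -/
lemma exists_codebook [DecidableEq κ] [DecidableEq M] [Nonempty κ] [Nonempty M] {P : X → ℝ}
    (hP : ∀ x, 0 ≤ P x) (hP1 : ∑ x, P x = 1) {σ : X → Op B} (hσ : ∀ x, IsDensity (σ x)) {ρ : Op B}
    (hρ : IsDensity ρ) (hρσ : ρ = ∑ a, (P a : ℂ) • σ a) {Y : X → Op B}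
    (hY : ∀ x, (Y x).PosSemidef) (hY1 : ∀ x, (Y x).trace.re ≤ 1) {c γ : ℝ} (hc : 0 ≤ c)
    (hle : ∀ x, ((c : ℂ) • ρ - Y x).PosSemidef)
    (hγ : ∑ a, P a * traceNorm (σ a - Y a) ≤ γ) {E : X → Op B} (hE : ∀ x, (E x).PosSemidef)
    (hE1 : ∀ x, (1 - E x).PosSemidef) {α : ℝ}
    (hα : ∑ x, P x * ((1 - E x) * σ x).trace.re +
      Fintype.card M * ∑ x, P x * (E x * ρ).trace.re ≤ α) {η : ℝ} (hη : 0 < η) :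
    ∃ (x : M × κ → X) (Λ : κ → M → Op B), (∀ k i, (Λ k i).PosSemidef) ∧
      (∀ k, (1 - ∑ i, Λ k i).PosSemidef) ∧
      (Fintype.card (M × κ) : ℝ)⁻¹ * ∑ i : M × κ, (1 - (Λ i.2 i.1 * σ (x i)).trace.re) +
        traceNorm (avg (fun i => σ (x i)) - ρ) ≤
      4 * α + 4 * η + (2 * γ + √(2 * (c / Fintype.card (M × κ)))) := by
  -- The Hayashi–Nagaoka bound on the error of codeword `i`, whose competitors are only the
  -- codewords with the same key `i.2`.
  let err : (M × κ → X) → M × κ → ℝ := fun x i =>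
    2 * ((1 - E (x i)) * σ (x i)).trace.re +
      4 * (∑ j ∈ Finset.univ.erase i.1, (E (x (j, i.2)) * σ (x i)).trace.re + η)
  have hWnn : ∀ x : M × κ → X, 0 ≤ ∏ k, P (x k) := fun x => Finset.prod_nonneg fun k _ => hP _
  have ht : ∀ a, 0 ≤ (E a * ρ).trace.re := fun a => re_trace_mul_nonneg (hE a) hρ.1
  have ht' : ∀ a, 0 ≤ ((1 - E a) * σ a).trace.re := fun a => re_trace_mul_nonneg (hE1 a) (hσ a).1
  have hs : 0 ≤ ∑ x, P x * (E x * ρ).trace.re :=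
    Finset.sum_nonneg fun a _ => mul_nonneg (hP a) (ht a)
  have hs' : 0 ≤ ∑ x, P x * ((1 - E x) * σ x).trace.re :=
    Finset.sum_nonneg fun a _ => mul_nonneg (hP a) (ht' a)
  have hexp : ∀ i, ∑ x : M × κ → X, (∏ k, P (x k)) * err x i ≤ 4 * α + 4 * η := fun i => by
    -- A competing test is independent of the transmitted codeword, so on average it acts on the
    -- mean state `ρ`.
    have e1 : ∀ j ∈ Finset.univ.erase i.1, ∑ x : M × κ → X, (∏ k, P (x k)) *
        (E (x (j, i.2)) * σ (x i)).trace.re = ∑ b, P b * (E b * ρ).trace.re := fun j hj => by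
      have hne : (j, i.2) ≠ i := fun h => (Finset.ne_of_mem_erase hj) (congrArg Prod.fst h)
      rw [expect_two hP1 hne fun a b => (E b * σ a).trace.re]
      simp only [Finset.mul_sum]
      rw [Finset.sum_comm]
      refine Finset.sum_congr rfl fun b _ => ?_
      rw [hρσ, Finset.mul_sum, Matrix.trace_sum, Complex.re_sum, Finset.mul_sum]
      refine Finset.sum_congr rfl fun a _ => ?_
      rw [Matrix.mul_smul, re_trace_smul]; ring
    have e2 : ∑ x : M × κ → X, (∏ k, P (x k)) * err x i =
        2 * ∑ x : M × κ → X, (∏ k, P (x k)) * ((1 - E (x i)) * σ (x i)).trace.re +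
        4 * ∑ j ∈ Finset.univ.erase i.1, ∑ x : M × κ → X, (∏ k, P (x k)) *
          (E (x (j, i.2)) * σ (x i)).trace.re + 4 * η := by
      rw [Finset.sum_comm]
      have : 4 * η = ∑ x : M × κ → X, (∏ k, P (x k)) * (4 * η) := by
        rw [← Finset.sum_mul, sum_prod_weight hP1, one_mul]
      rw [this, Finset.mul_sum, Finset.mul_sum, ← Finset.sum_add_distrib,
        ← Finset.sum_add_distrib]
      refine Finset.sum_congr rfl fun x _ => ?_
      simp only [err, ← Finset.mul_sum]
      ring
    rw [e2, expect_one hP1 i fun a => ((1 - E a) * σ a).trace.re, Finset.sum_congr rfl e1,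
      Finset.sum_const, nsmul_eq_mul]
    have h1 : ((Finset.univ.erase i.1).card : ℝ) ≤ Fintype.card M := by
      exact_mod_cast Finset.card_le_univ _
    have h2 := mul_le_mul_of_nonneg_right h1 hs
    linarith
  have hcov := expect_traceNorm_sample_le (I := M × κ) hP hP1 hσ hρ hρσ hY hY1 hc hle hγ
  -- The two criteria are added before a codebook is selected, so that a single codebook meets both.
  obtain ⟨x, hx⟩ := exists_le_of_sum_mul_le (w := fun x : M × κ → X => ∏ k, P (x k))
    (f := fun x => (Fintype.card (M × κ) : ℝ)⁻¹ * ∑ i, err x i +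
      traceNorm (avg (fun i => σ (x i)) - ρ))
    (c := 4 * α + 4 * η + (2 * γ + √(2 * (c / Fintype.card (M × κ))))) hWnn
    (sum_prod_weight hP1) (by
      simp only [mul_add (∏ k, P (_ : X)), Finset.sum_add_distrib]
      refine add_le_add ?_ hcov
      have e : ∑ x : M × κ → X, (∏ k, P (x k)) *
          ((Fintype.card (M × κ) : ℝ)⁻¹ * ∑ i, err x i) = (Fintype.card (M × κ) : ℝ)⁻¹ *
          ∑ i, ∑ x : M × κ → X, (∏ k, P (x k)) * err x i := by
        rw [Finset.sum_comm, Finset.mul_sum]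
        refine Finset.sum_congr rfl fun x _ => ?_
        rw [← Finset.mul_sum]; ring
      rw [e]
      exact inv_card_mul_sum_le hexp)
  choose Λ hΛ hΛ1 hΛe using fun k => exists_sqrt_measurement (fun i => E (x (i, k)))
    (fun i => hE _) (fun i => hE1 _) hη
  refine ⟨x, Λ, hΛ, hΛ1, le_trans (add_le_add_left (mul_le_mul_of_nonneg_left
    (Finset.sum_le_sum fun i _ => ?_) (by positivity)) _) hx⟩
  have h := re_trace_mul_nonneg (hΛe i.2 i.1) (hσ (x i)).1
  have e1 : ∑ j, E (x (j, i.2)) - E (x (i.1, i.2)) = ∑ j ∈ Finset.univ.erase i.1, E (x (j, i.2)) := by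
    rw [← Finset.add_sum_erase _ _ (Finset.mem_univ i.1), add_sub_cancel_left]
  rw [e1] at h
  simp only [Matrix.sub_mul, Matrix.add_mul, Matrix.smul_mul, Matrix.trace_sub, Matrix.trace_add,
    Complex.sub_re, Complex.add_re, re_trace_smul, Matrix.one_mul, (hσ _).2, Complex.one_re,
    Finset.sum_mul, Matrix.trace_sum, Complex.re_sum, smul_add] at h
  simp only [err, Matrix.sub_mul, Matrix.one_mul, Matrix.trace_sub, Complex.sub_re, (hσ _).2,
    Complex.one_re]
  linarith

/-- The expectation of `E`, as a map to the operators on a trivial system. -/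
def expectL (E : Op B) : Op B →ₗ[ℂ] Op (Fin 1) where
  toFun X := (E * X).trace • 1
  map_add' X Y := by rw [Matrix.mul_add, Matrix.trace_add, add_smul]
  map_smul' c X := by rw [Matrix.mul_smul, Matrix.trace_smul, smul_assoc]; rfl

omit [DecidableEq B] in
lemma expectL_apply (E Z : Op B) : expectL E Z = (E * Z).trace • 1 := rfl

lemma CP.expectL {E : Op B} (hE : E.PosSemidef) : CP (expectL E) := by
  obtain ⟨S, rfl⟩ := exists_eq_conjTranspose_mul_self hE
  let V : B → Matrix (Fin 1) B ℂ := fun b =>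
    (Matrix.single (0 : Fin 1) b (1 : ℂ) : Matrix (Fin 1) B ℂ) * S
  have : QStego.expectL (Sᴴ * S) = ∑ b, conjMap (V b) := by
    ext Z i j
    rw [LinearMap.sum_apply, Matrix.sum_apply, expectL_apply, Matrix.mul_assoc,
      Matrix.trace_mul_comm, Subsingleton.elim i 0, Subsingleton.elim j 0, Matrix.smul_apply,
      Matrix.one_apply_eq, smul_eq_mul, mul_one, Matrix.trace]
    refine Finset.sum_congr rfl fun b _ => ?_
    rw [conjMap_apply]
    simp only [V, Matrix.conjTranspose_mul]
    calc Matrix.diag (S * Z * Sᴴ) b = (Matrix.single (0 : Fin 1) b (1 : ℂ) * (S * Z * Sᴴ) *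
          (Matrix.single (0 : Fin 1) b (1 : ℂ))ᴴ) 0 0 := by
          simp [Matrix.conjTranspose_single, Matrix.mul_apply, Matrix.single_apply]
      _ = _ := by simp only [Matrix.mul_assoc]
  rw [this]
  exact CP.of_conjMap_sum V

lemma maxEnt_one : maxEnt 1 = 1 := by
  ext p q
  rw [Subsingleton.elim q p, Matrix.one_apply_eq]
  simp [maxEnt, ketbra, Matrix.vecMulVec_apply, Subsingleton.elim p.1 p.2]

omit [Fintype X] in
/-- A codebook with local randomness gives a covert code. -/
lemma covertCode_of_codebook {C ρ' : Type*} [Fintype C] [Fintype ρ'] [Nonempty C]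
    [Nonempty ρ'] [DecidableEq C] {T : Op A →ₗ[ℂ] Op B} (hT : IsChannel T)
    {τ : X → Op A} (hτ : ∀ x, IsDensity (τ x)) (x : (C × ρ') × κ → X) {Λ : κ → C × ρ' → Op B}
    (hΛ : ∀ k i, (Λ k i).PosSemidef) (hΛ1 : ∀ k, (1 - ∑ i, Λ k i).PosSemidef) {ρ : Op B}
    {δ ζ : ℝ}
    (hδ : (Fintype.card ((C × ρ') × κ) : ℝ)⁻¹ *
      ∑ i : (C × ρ') × κ, (1 - (Λ i.2 i.1 * T (τ (x i))).trace.re) ≤ δ)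
    (hζ : traceNorm (avg (fun i => T (τ (x i))) - ρ) ≤ ζ) :
    CovertCode C κ T (maxEnt 1) ρ δ ζ := by
  obtain ⟨c₀⟩ := ‹Nonempty C›
  have hR : (0 : ℝ) < Fintype.card ρ' := Nat.cast_pos.mpr Fintype.card_pos
  -- Bob ignores Alice's local randomness `r`. The rest of the subnormalized measurement is assigned
  -- to one message, which only helps its decoding.
  let G : κ → C → Op B := fun k c => ∑ r, Λ k (c, r) + if c = c₀ then 1 - ∑ i, Λ k i else 0
  have hrest : ∀ k c, (if c = c₀ then 1 - ∑ i, Λ k i else 0 : Op B).PosSemidef := fun k c => by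
    split_ifs
    · exact hΛ1 k
    · exact Matrix.PosSemidef.zero
  have hG : ∀ k c, (G k c).PosSemidef := fun k c =>
    (Matrix.posSemidef_sum _ fun r _ => hΛ k _).add (hrest k c)
  have hG1 : ∀ k, ∑ c, G k c = 1 := fun k => by
    simp only [G, Finset.sum_add_distrib, Finset.sum_ite_eq', Finset.mem_univ, if_true]
    rw [← Fintype.sum_prod_type]
    abel
  let t : C × κ → Op A := fun y => avg fun r : ρ' => τ (x ((y.1, r), y.2))
  have ht : ∀ y, IsDensity (t y) := fun y => IsDensity.avg fun r => hτ _
  have hone : IsDensity (1 : Op (Fin 1)) := ⟨Matrix.PosSemidef.one, by simp⟩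
  refine ⟨fun y => (1 : Op (Fin 1)) ⊗ₖ t y, fun k c => expectL (G k c), fun y =>
    hone.kronecker (ht y), fun k c => CP.expectL (hG k c), fun k Z => ?_, ?_, ?_⟩
  · rw [LinearMap.sum_apply]
    simp only [expectL_apply, Matrix.trace_sum, Matrix.trace_smul, Matrix.trace_one,
      Fintype.card_fin, Nat.cast_one, smul_eq_mul, mul_one]
    rw [← Matrix.trace_sum, ← Finset.sum_mul, hG1, Matrix.one_mul]
  · refine le_trans ?_ hδ
    have h1 : ∀ y : C × κ, traceNorm (idTensor (Fin 1) (expectL (G y.2 y.1) ∘ₗ T)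
        ((1 : Op (Fin 1)) ⊗ₖ t y) - maxEnt 1) ≤
        (Fintype.card ρ' : ℝ)⁻¹ * ∑ r, (1 - (Λ y.2 (y.1, r) * T (τ (x ((y.1, r), y.2)))).trace.re) :=
      fun y => by
      set p := (G y.2 y.1 * T (t y)).trace.re with hp
      have hTt : IsDensity (T (t y)) := hT.isDensity (ht y)
      have hpt : (G y.2 y.1 * T (t y)).trace = (p : ℂ) := by
        obtain ⟨S, hS⟩ := exists_eq_conjTranspose_mul_self (hG y.2 y.1)
        have hh := trace_eq_re (hTt.1.mul_mul_conjTranspose_same S).1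
        rwa [Matrix.trace_mul_comm, ← Matrix.mul_assoc, ← hS] at hh
      have e1 : idTensor (Fin 1) (expectL (G y.2 y.1) ∘ₗ T) ((1 : Op (Fin 1)) ⊗ₖ t y) =
          (p : ℂ) • 1 := by
        rw [idTensor_eq_mapTensor, mapTensor_kronecker, LinearMap.comp_apply, expectL_apply, hpt,
          Matrix.kronecker_smul, LinearMap.id_apply, Matrix.one_kronecker_one]
      have hp1 : p ≤ 1 := by
        have h2 : (1 - G y.2 y.1).PosSemidef := by
          rw [← hG1 y.2, ← Finset.add_sum_erase _ _ (Finset.mem_univ y.1), add_sub_cancel_left]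
          exact Matrix.posSemidef_sum _ fun c _ => hG _ _
        have := re_trace_mul_le_of_effect h2 hTt.1
        rwa [hTt.2, Complex.one_re] at this
      rw [e1, maxEnt_one, traceNorm_sub_comm]
      have e2 : (1 : Op (Fin 1 × Fin 1)) - (p : ℂ) • 1 = ((1 - p : ℝ) : ℂ) • 1 := by
        push_cast; rw [sub_smul, one_smul]
      rw [e2, traceNorm_of_posSemidef (posSemidef_smul Matrix.PosSemidef.one (by linarith)),
        re_trace_smul]
      simp only [Matrix.trace_one, Fintype.card_prod, Fintype.card_fin, mul_one, Nat.cast_one,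
        Complex.one_re, Finset.sum_sub_distrib, Finset.sum_const, Finset.card_univ, nsmul_eq_mul,
        mul_sub]
      rw [inv_mul_cancel₀ hR.ne']
      have h3 : (Fintype.card ρ' : ℝ)⁻¹ *
          ∑ r, (Λ y.2 (y.1, r) * T (τ (x ((y.1, r), y.2)))).trace.re ≤ p := by
        have h4 : p = ((∑ r, Λ y.2 (y.1, r)) * T (t y)).trace.re +
            ((if y.1 = c₀ then 1 - ∑ i, Λ y.2 i else 0) * T (t y)).trace.re := by
          rw [hp, ← Complex.add_re, ← Matrix.trace_add, ← Matrix.add_mul]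
        have h5 := re_trace_mul_nonneg (hrest y.2 y.1) hTt.1
        have h6 : (Fintype.card ρ' : ℝ)⁻¹ *
            ∑ r, (Λ y.2 (y.1, r) * T (τ (x ((y.1, r), y.2)))).trace.re ≤
            ((∑ r, Λ y.2 (y.1, r)) * T (t y)).trace.re := by
          have h7 : T (t y) = avg fun r : ρ' => T (τ (x ((y.1, r), y.2))) := map_avg T _
          rw [h7, avg, Matrix.mul_smul, re_trace_smul, Matrix.mul_sum, Matrix.trace_sum,
            Complex.re_sum]
          refine mul_le_mul_of_nonneg_left (Finset.sum_le_sum fun r _ => ?_) (by positivity)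
          classical
          rw [Finset.sum_mul, Matrix.trace_sum, Complex.re_sum]
          exact Finset.single_le_sum (f := fun r' => (Λ y.2 (y.1, r') *
            T (τ (x ((y.1, r), y.2)))).trace.re) (fun r' _ => re_trace_mul_nonneg (hΛ _ _)
              (hT.isDensity (hτ _)).1) (Finset.mem_univ r)
        linarith
      linarith
    refine (mul_le_mul_of_nonneg_left (Finset.sum_le_sum fun y _ => h1 y) (by positivity)).trans
      (le_of_eq ?_)
    simp only [Fintype.sum_prod_type, Fintype.card_prod, ← Finset.mul_sum]
    have h8 : ∀ c : C, ∑ k : κ, ∑ r : ρ', (1 - (Λ k (c, r) * T (τ (x ((c, r), k)))).trace.re) =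
        ∑ r : ρ', ∑ k : κ, (1 - (Λ k (c, r) * T (τ (x ((c, r), k)))).trace.re) := fun c =>
      Finset.sum_comm
    simp only [h8]
    push_cast
    rw [← mul_assoc, ← mul_inv]
    ring
  · have e1 : ∀ y : C × κ, T (trFst ((1 : Op (Fin 1)) ⊗ₖ t y)) =
        avg fun r : ρ' => T (τ (x ((y.1, r), y.2))) := fun y => by
      rw [trFst_kronecker, hone.2, one_smul]
      exact map_avg T _
    have e2 : avg (fun y : C × κ => T (trFst ((1 : Op (Fin 1)) ⊗ₖ t y))) =
        avg fun i => T (τ (x i)) := by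
      simp only [e1]
      let e : (C × κ) × ρ' ≃ (C × ρ') × κ :=
        ⟨fun p => ((p.1.1, p.2), p.1.2), fun p => ((p.1.1, p.2), p.1.2), fun _ => rfl,
          fun _ => rfl⟩
      rw [← avg_equiv e, avg_prod (κ := C × κ)]
      rfl
    rw [e2]
    exact hζ

end Noisy

/-! ### Sizes of messages and keys for covert codes over general channels -/

section NoisyRates

variable {A B : Type*} [Fintype A] [Fintype B] [DecidableEq B] {m : ℕ}

lemma one_le_numEig [Nonempty B] {ρ : Op B} (hρ : ρ.IsHermitian) : 1 ≤ numEig ρ := by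
  obtain ⟨V, μ, -, -, -, h, -⟩ := exists_joint_basis hρ hρ
  rw [← h, Nat.one_le_iff_ne_zero, Finset.card_ne_zero]
  exact Finset.univ_nonempty.image μ

omit [DecidableEq B] in
lemma IsDensity.nonempty {ρ : Op B} (hρ : IsDensity ρ) : Nonempty B := by
  by_contra h
  rw [not_nonempty_iff] at h
  have := hρ.2
  simp [Matrix.trace] at this

omit [DecidableEq B] in
lemma isDensity_sum {P : Fin m → ℝ} (hP : ∀ x, 0 ≤ P x) (hP1 : ∑ x, P x = 1)
    {σ : Fin m → Op B} (hσ : ∀ x, IsDensity (σ x)) : IsDensity (∑ x, (P x : ℂ) • σ x) := by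
  refine ⟨Matrix.posSemidef_sum _ fun x _ => posSemidef_smul (hσ x).1 (hP x), ?_⟩
  simp only [Matrix.trace_sum, Matrix.trace_smul, (hσ _).2, smul_eq_mul, mul_one]
  rw [← Complex.ofReal_sum, hP1, Complex.ofReal_one]

/-- Truncated versions of the states of an ensemble, dominated by the mean. -/
lemma exists_covering_operators {P : Fin m → ℝ} (hP : ∀ x, 0 ≤ P x) (hP1 : ∑ x, P x = 1)
    {σ : Fin m → Op B} (hσ : ∀ x, IsDensity (σ x)) {ρ : Op B}
    (hρσ : ρ = ∑ a, (P a : ℂ) • σ a) {c s : ℝ} (hc : 0 < c) (hs : 0 < s) :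
    ∃ Y : Fin m → Op B, (∀ x, (Y x).PosSemidef) ∧ (∀ x, (Y x).trace.re ≤ 1) ∧
      (∀ x, (((numEig ρ * c : ℝ) : ℂ) • ρ - Y x).PosSemidef) ∧
      ∑ x, P x * traceNorm (σ x - Y x) ≤
        2 * √(c ^ (-s) * ∑ x, P x * (rpow (σ x) (1 + s) * rpow ρ (-s)).trace.re) := by
  have hρ : IsDensity ρ := hρσ ▸ isDensity_sum hP hP1 hσ
  have hex : ∀ x, ∃ E : Op B, E.PosSemidef ∧ E * E = E ∧ (1 - E).PosSemidef ∧
      P x * ((1 - E) * σ x).trace.re ≤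
        P x * (c ^ (-s) * (rpow (σ x) (1 + s) * rpow ρ (-s)).trace.re) ∧
      (((numEig ρ * c : ℝ) : ℂ) • ρ - E * σ x * E).PosSemidef := fun x => by
    rcases (hP x).eq_or_lt with h | h
    -- A state of weight zero need not be dominated by any multiple of the mean, so it is discarded
    -- entirely.
    · refine ⟨0, Matrix.PosSemidef.zero, by simp, by simpa using Matrix.PosSemidef.one, ?_, ?_⟩
      · rw [← h, zero_mul, zero_mul]
      · simpa using posSemidef_smul hρ.1 (c := numEig ρ * c) (by positivity)
    · have hle : (ρ - (P x : ℂ) • σ x).PosSemidef := by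
        rw [hρσ, ← Finset.add_sum_erase _ _ (Finset.mem_univ x), add_sub_cancel_left]
        exact Matrix.posSemidef_sum _ fun y _ => posSemidef_smul (hσ y).1 (hP y)
      obtain ⟨E, h1, h2, h3, h4, h5⟩ := exists_truncation hρ.1 (hσ x).1 h hle hc hs
      exact ⟨E, h1, h2, h3, mul_le_mul_of_nonneg_left h4 h.le, h5⟩
  choose E hE hEE hE1 ht hle using hex
  have hEh : ∀ x, (E x)ᴴ = E x := fun x => (hE x).1.eq
  refine ⟨fun x => E x * σ x * E x, fun x => ?_, fun x => ?_, hle, ?_⟩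
  · have := (hσ x).1.mul_mul_conjTranspose_same (E x)
    rwa [hEh] at this
  · change (E x * σ x * E x).trace.re ≤ 1
    rw [Matrix.mul_assoc, re_trace_mul_comm, Matrix.mul_assoc, hEE, re_trace_mul_comm]
    refine (re_trace_mul_le_of_effect (hE1 x) (hσ x).1).trans_eq ?_
    rw [(hσ x).2, Complex.one_re]
  · have h0 : ∀ x, 0 ≤ ((1 - E x) * σ x).trace.re := fun x =>
      re_trace_mul_nonneg (hE1 x) (hσ x).1
    calc ∑ x, P x * traceNorm (σ x - E x * σ x * E x) ≤
        ∑ x, P x * (2 * √((1 - E x) * σ x).trace.re) := by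
          refine Finset.sum_le_sum fun x _ => mul_le_mul_of_nonneg_left ?_ (hP x)
          rw [traceNorm_sub_comm]
          refine traceNorm_gentle (hσ x).1 (by rw [(hσ x).2, Complex.one_re]) (hE1 x) (hE x)
            (hEE x) ?_
          -- A projection is its own square root, and the third condition on the square root is an
          -- equality.
          have : 1 - E x - (1 - E x) * (1 - E x) = 0 := by
            rw [Matrix.mul_sub, Matrix.sub_mul (1 : Op B) (E x) (E x), hEE]; simp
          rw [this]
          exact Matrix.PosSemidef.zero
      _ = 2 * ∑ x, P x * √((1 - E x) * σ x).trace.re := by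
          rw [Finset.mul_sum]; exact Finset.sum_congr rfl fun x _ => by ring
      _ ≤ 2 * √(∑ x, P x * ((1 - E x) * σ x).trace.re) :=
          mul_le_mul_of_nonneg_left (sum_mul_sqrt_le hP hP1 h0) zero_le_two
      _ ≤ _ := by
          refine mul_le_mul_of_nonneg_left (Real.sqrt_le_sqrt ?_) zero_le_two
          rw [Finset.mul_sum]
          exact Finset.sum_le_sum fun x _ => (ht x).trans_eq (by ring)

lemma ceil_inv_bounds {ζ : ℝ} (hζ : 0 < ζ) (hζ1 : ζ ≤ 1 / 16) :
    1 ≤ ⌈1 / ζ⌉₊ ∧ 1 / ζ ≤ (⌈1 / ζ⌉₊ : ℝ) ∧ (⌈1 / ζ⌉₊ : ℝ) ≤ 17 / (16 * ζ) := by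
  have h0 : 0 < 1 / ζ := by positivity
  refine ⟨Nat.one_le_ceil_iff.mpr h0, Nat.le_ceil _, (Nat.ceil_lt_add_one h0.le).le.trans ?_⟩
  rw [div_add_one hζ.ne', div_le_div_iff₀ hζ (by positivity)]
  nlinarith

/-- The price of `n ^ 2` additional messages. Because `a < 1` they, together with one bit of slack,
multiply the test error by at most `2n`, of order `1/ζ`, and `(ζ/12)²` absorbs this. -/
lemma packing_error_le {ζ a n x Q : ℝ} (hζ : 0 < ζ) (ha : a ∈ Set.Ioo (0 : ℝ) 1) (hn' : 1 ≤ n)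
    (hnu : n ≤ 17 / (16 * ζ)) (hx : 0 < x) (hpack : (x / 2) ^ a * Q ≤ (ζ / 12) ^ 4) :
    (x * n ^ 2) ^ (a / 2) * √Q ≤ ζ / 64 := by
  have e1 : (x * n ^ 2 : ℝ) = (x / 2) * (2 * n ^ 2) := by ring
  have h1 : (2 * n ^ 2 : ℝ) ^ (a / 2) ≤ 2 * n := by
    calc (2 * n ^ 2 : ℝ) ^ (a / 2) ≤ (2 * n ^ 2 : ℝ) ^ (1 / 2 : ℝ) :=
          Real.rpow_le_rpow_of_exponent_le (by nlinarith) (by linarith [ha.2])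
      _ ≤ ((2 * n) ^ 2 : ℝ) ^ (1 / 2 : ℝ) :=
          Real.rpow_le_rpow (by positivity) (by nlinarith) (by norm_num)
      _ = 2 * n := by rw [← Real.sqrt_eq_rpow, Real.sqrt_sq (by positivity)]
  have h2 : (x / 2 : ℝ) ^ (a / 2) * √Q ≤ (ζ / 12) ^ 2 := by
    have h3 := Real.sqrt_le_sqrt hpack
    rw [Real.sqrt_mul (by positivity), show (ζ / 12) ^ 4 = ((ζ / 12) ^ 2) ^ 2 by ring,
      Real.sqrt_sq (by positivity)] at h3
    have h4 : √((x / 2 : ℝ) ^ a) = (x / 2 : ℝ) ^ (a / 2) := by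
      rw [Real.sqrt_eq_rpow, ← Real.rpow_mul (by positivity)]
      congr 1; ring
    rwa [h4] at h3
  rw [e1, Real.mul_rpow (by positivity) (by positivity)]
  calc (x / 2 : ℝ) ^ (a / 2) * (2 * n ^ 2 : ℝ) ^ (a / 2) * √Q =
      ((x / 2 : ℝ) ^ (a / 2) * √Q) * (2 * n ^ 2 : ℝ) ^ (a / 2) := by ring
    _ ≤ (ζ / 12) ^ 2 * (2 * n) := mul_le_mul h2 h1 (by positivity) (by positivity)
    _ ≤ (ζ / 12) ^ 2 * (2 * (17 / (16 * ζ))) := by gcongr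
    _ = 17 / 1152 * ζ := by field_simp; ring
    _ ≤ ζ / 64 := by linarith

/-- Tests that recognize the states of an ensemble cannot exist if truncated states are dominated
by a small multiple of the mean. -/
lemma sq_le_key {P : Fin m → ℝ} (hP : ∀ x, 0 ≤ P x) (hP1 : ∑ x, P x = 1) {σ : Fin m → Op B}
    (hσ : ∀ x, IsDensity (σ x)) {ρ : Op B} (hρ : IsDensity ρ) {E Y : Fin m → Op B}
    (hE : ∀ x, (E x).PosSemidef) (hE1 : ∀ x, (1 - E x).PosSemidef) (hY : ∀ x, (Y x).PosSemidef)
    {ζ n K y : ℝ} (hζ : 0 < ζ) (hζ1 : ζ ≤ 1 / 16) (hK : 0 ≤ K) (hy : 0 ≤ y)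
    (hEα : ∑ x, P x * ((1 - E x) * σ x).trace.re +
      y * n ^ 2 * ∑ x, P x * (E x * ρ).trace.re ≤ ζ / 64)
    (hle : ∀ x, (((y * K * (ζ / 12) ^ 2 : ℝ) : ℂ) • ρ - Y x).PosSemidef)
    (hγ' : ∑ x, P x * traceNorm (σ x - Y x) ≤ ζ / 6) : n ^ 2 ≤ ζ * K / 16 := by
  have ht0 : ∀ x, 0 ≤ ((1 - E x) * σ x).trace.re := fun x => re_trace_mul_nonneg (hE1 x) (hσ x).1
  have ht1 : ∀ x, 0 ≤ (E x * ρ).trace.re := fun x => re_trace_mul_nonneg (hE x) hρ.1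
  have hs0 : 0 ≤ ∑ x, P x * ((1 - E x) * σ x).trace.re :=
    Finset.sum_nonneg fun x _ => mul_nonneg (hP x) (ht0 x)
  have hs1 : 0 ≤ ∑ x, P x * (E x * ρ).trace.re :=
    Finset.sum_nonneg fun x _ => mul_nonneg (hP x) (ht1 x)
  -- The test accepts `σ x`, hence nearly accepts `Y x`, hence a multiple of the mean, which by
  -- `hEα` it accepts rarely. The multiple, and with it `K`, must therefore be large.
  have h1 : ∀ x, (1 : ℝ) ≤ ((1 - E x) * σ x).trace.re + traceNorm (σ x - Y x) +
      (y * K * (ζ / 12) ^ 2) * (E x * ρ).trace.re := fun x => by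
    have k1 := re_trace_effect_mul_le ((hσ x).1.1.sub (hY x).1) (hE x) (hE1 x)
    have k2 := re_trace_mul_mono (hle x) (hE x)
    rw [Matrix.smul_mul, re_trace_smul, re_trace_mul_comm, re_trace_mul_comm ρ] at k2
    rw [Matrix.mul_sub, Matrix.trace_sub, Complex.sub_re] at k1
    rw [Matrix.sub_mul, Matrix.one_mul, Matrix.trace_sub, Complex.sub_re, (hσ x).2,
      Complex.one_re]
    linarith
  have h2 : (1 : ℝ) ≤ ∑ x, P x * ((1 - E x) * σ x).trace.re +
      ∑ x, P x * traceNorm (σ x - Y x) +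
      (y * K * (ζ / 12) ^ 2) * ∑ x, P x * (E x * ρ).trace.re := by
    rw [← hP1, Finset.mul_sum, ← Finset.sum_add_distrib, ← Finset.sum_add_distrib]
    refine Finset.sum_le_sum fun x _ => ?_
    have := mul_le_mul_of_nonneg_left (h1 x) (hP x)
    linarith
  have h3 : (y * n ^ 2) * ∑ x, P x * (E x * ρ).trace.re ≤ ζ / 64 := by
    linarith
  have h4 : (1 / 2 : ℝ) ≤ (y * K * (ζ / 12) ^ 2) * ∑ x, P x * (E x * ρ).trace.re := by
    have : ∑ x, P x * ((1 - E x) * σ x).trace.re ≤ ζ / 64 := by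
      have : 0 ≤ y * n ^ 2 * ∑ x, P x * (E x * ρ).trace.re := by positivity
      linarith
    linarith
  have h5 : n ^ 2 * (1 / 2) ≤ K * (ζ / 12) ^ 2 * (ζ / 64) := by
    calc n ^ 2 * (1 / 2) ≤
        n ^ 2 * ((y * K * (ζ / 12) ^ 2) * ∑ x, P x * (E x * ρ).trace.re) := by gcongr
      _ = K * (ζ / 12) ^ 2 * ((y * n ^ 2) * ∑ x, P x * (E x * ρ).trace.re) := by ring
      _ ≤ _ := by gcongr
  have h6 : ζ ^ 2 ≤ 1 := by nlinarith
  have h7 : K * ζ * ζ ^ 2 ≤ K * ζ * 1 := by gcongr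
  have h8 : K * (ζ / 12) ^ 2 * (ζ / 64) = K * ζ * ζ ^ 2 / 9216 := by ring
  have h9 : 0 ≤ K * ζ := by positivity
  rw [h8] at h5
  linarith

/-- Covert codes at the rates of an ensemble of channel outputs. -/
lemma exists_noisy_covertCode {T : Op A →ₗ[ℂ] Op B} (hT : IsChannel T) {P : Fin m → ℝ}
    (hP : ∀ x, 0 ≤ P x) (hP1 : ∑ x, P x = 1) {τ : Fin m → Op A} (hτ : ∀ x, IsDensity (τ x))
    {σ : Fin m → Op B} (hστ : ∀ x, σ x = T (τ x)) {ρ : Op B}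
    (hρσ : ρ = ∑ a, (P a : ℂ) • σ a) {ζ : ℝ} (hζ : 0 < ζ) (hζ1 : ζ ≤ 1 / 16) {L K R n : ℕ}
    (hL : 1 ≤ L) (hK : 1 ≤ K) (hR : 1 ≤ R) (hn : n = ⌈1 / ζ⌉₊) {a s : ℝ}
    (ha : a ∈ Set.Ioo (0 : ℝ) 1) (hs : 0 < s)
    (hpack : (L * R / 2 : ℝ) ^ a * (cqState P σ * rpow (prodMarginals (cqState P σ)) (a / 2) *
        rpow (cqState P σ) (-a) * rpow (prodMarginals (cqState P σ)) (a / 2)).trace.re ≤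
      (ζ / 12) ^ 4)
    (hcov : (L * R * K * (ζ / 12) ^ 2 / numEig ρ : ℝ) ^ (-s) *
      ∑ x, P x * (rpow (σ x) (1 + s) * rpow ρ (-s)).trace.re ≤ (ζ / 12) ^ 2) :
    ∃ K' : ℕ, 1 ≤ K' ∧ n ^ 2 * K' ≤ K ∧ (K : ℝ) - n ^ 2 * K' ≤ ζ * K ∧
      CovertCode (Fin L × Fin (n ^ 2)) (Fin K') T (maxEnt 1) ρ ζ ζ := by
  have hσ : ∀ x, IsDensity (σ x) := fun x => hστ x ▸ hT.isDensity (hτ x)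
  have hρ : IsDensity ρ := hρσ ▸ isDensity_sum hP hP1 hσ
  have hne : Nonempty B := hρ.nonempty
  have hν : (1 : ℝ) ≤ numEig ρ := by exact_mod_cast one_le_numEig hρ.1.1
  have hL' : (1 : ℝ) ≤ L := by exact_mod_cast hL
  have hK' : (1 : ℝ) ≤ K := by exact_mod_cast hK
  have hR' : (1 : ℝ) ≤ R := by exact_mod_cast hR
  obtain ⟨hn1, hnl, hnu⟩ := ceil_inv_bounds hζ hζ1
  rw [← hn] at hn1 hnl hnu
  have hn' : (1 : ℝ) ≤ n := by exact_mod_cast hn1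
  set Q := (cqState P σ * rpow (prodMarginals (cqState P σ)) (a / 2) *
        rpow (cqState P σ) (-a) * rpow (prodMarginals (cqState P σ)) (a / 2)).trace.re with hQ
  -- the tests for decoding
  have hT0 : (0 : ℝ) ≤ L * n ^ 2 * R := by positivity
  obtain ⟨E, hE, hE1, hEα⟩ := exists_packing_tests hP hP1 hσ ha hT0
  rw [← hQ, ← hρσ] at hEα
  have hα := packing_error_le hζ ha hn' hnu (x := (L * R : ℝ)) (by positivity) hpack
  rw [show (L * R : ℝ) * n ^ 2 = L * n ^ 2 * R by ring] at hα
  -- the truncated states for covering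
  set c := (L * R * K * (ζ / 12) ^ 2 / numEig ρ : ℝ) with hc
  have hc0 : 0 < c := by positivity
  have hνc : numEig ρ * c = L * R * K * (ζ / 12) ^ 2 := by rw [hc]; field_simp
  obtain ⟨Y, hY, hY1, hle, hγ⟩ := exists_covering_operators hP hP1 hσ hρσ hc0 hs
  have hγ' : ∑ x, P x * traceNorm (σ x - Y x) ≤ ζ / 6 := by
    refine hγ.trans ?_
    have := Real.sqrt_le_sqrt hcov
    rw [Real.sqrt_sq (by positivity)] at this
    linarith
  -- This makes `K / n ^ 2` at least `1`, and the remainder of the division at most `ζ K`.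
  have hkey := sq_le_key (n := n) (K := K) (y := L * R) hP hP1 hσ hρ hE hE1 hY hζ hζ1 (by positivity)
    (by positivity)
    (by rw [show (L * R : ℝ) * n ^ 2 = L * n ^ 2 * R by ring]; exact hEα.trans hα)
    (by rw [← hνc]; exact hle) hγ'
  have hζK : ζ * K ≤ 1 / 16 * K := by gcongr
  have hn2 : 0 < n ^ 2 := by positivity
  have hnK : (n : ℝ) ^ 2 ≤ K := by linarith
  refine ⟨K / n ^ 2, ?_, Nat.mul_div_le _ _, ?_, ?_⟩
  · rw [Nat.le_div_iff_mul_le hn2, one_mul]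
    exact_mod_cast hnK
  · have h1 : K < K / n ^ 2 * n ^ 2 + n ^ 2 := Nat.lt_div_mul_add hn2
    have h2 : (K : ℝ) < ((K / n ^ 2 : ℕ) : ℝ) * n ^ 2 + n ^ 2 := by exact_mod_cast h1
    have hζK0 : 0 ≤ ζ * K := by positivity
    linarith
  · set K₁ := K / n ^ 2 with hK₁
    have hK₁1 : 1 ≤ K₁ := by
      rw [hK₁, Nat.le_div_iff_mul_le hn2, one_mul]
      exact_mod_cast hnK
    have hhalf : (K : ℝ) / 2 ≤ n ^ 2 * K₁ := by
      have h1 : K < K / n ^ 2 * n ^ 2 + n ^ 2 := Nat.lt_div_mul_add hn2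
      have h2 : (K : ℝ) < (K₁ : ℝ) * n ^ 2 + n ^ 2 := by exact_mod_cast h1
      linarith
    have : Nonempty (Fin L) := ⟨⟨0, hL⟩⟩
    have : Nonempty (Fin R) := ⟨⟨0, hR⟩⟩
    have : Nonempty (Fin (n ^ 2)) := ⟨⟨0, hn2⟩⟩
    have : Nonempty (Fin K₁) := ⟨⟨0, hK₁1⟩⟩
    obtain ⟨x, Λ, hΛ, hΛ1, hx⟩ := exists_codebook (κ := Fin K₁)
      (M := (Fin L × Fin (n ^ 2)) × Fin R) hP hP1 hσ hρ hρσ hY hY1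
      (mul_nonneg (zero_le_one.trans hν) hc0.le) hle hγ' hE hE1 (α := ζ / 64)
      (by
        simp only [Fintype.card_prod, Fintype.card_fin]
        push_cast
        exact hEα.trans hα)
      (η := ζ / 16) (by positivity)
    have hsq : √(2 * (numEig ρ * c /
        (Fintype.card (((Fin L × Fin (n ^ 2)) × Fin R) × Fin K₁) : ℝ))) ≤ ζ / 6 := by
      refine Real.sqrt_le_iff.mpr ⟨by positivity, ?_⟩
      simp only [Fintype.card_prod, Fintype.card_fin]
      push_cast
      have hpos : (0 : ℝ) < L * n ^ 2 * R * K₁ := by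
        have : (1 : ℝ) ≤ K₁ := by exact_mod_cast hK₁1
        positivity
      rw [hνc, ← mul_div_assoc, div_le_iff₀ hpos]
      -- The rounding `K ≤ 2 n² K₁` costs a factor `2`, and `4 (ζ/12)² = (ζ/6)²`.
      calc 2 * (L * R * K * (ζ / 12) ^ 2) = (4 * (L * R) * (ζ / 12) ^ 2) * (K / 2) := by ring
        _ ≤ (4 * (L * R) * (ζ / 12) ^ 2) * (n ^ 2 * K₁) := by gcongr
        _ = _ := by ring
    have hnn := traceNorm_nonneg (avg (fun i => σ (x i)) - ρ)
    have hnn2 : (0 : ℝ) ≤ (Fintype.card (((Fin L × Fin (n ^ 2)) × Fin R) × Fin K₁) : ℝ)⁻¹ *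
        ∑ i : ((Fin L × Fin (n ^ 2)) × Fin R) × Fin K₁,
          (1 - (Λ i.2 i.1 * σ (x i)).trace.re) := by
      refine mul_nonneg (by positivity) (Finset.sum_nonneg fun i _ => sub_nonneg.mpr ?_)
      have h2 : (1 - Λ i.2 i.1).PosSemidef := by
        have h3 := (hΛ1 i.2).add (Matrix.posSemidef_sum (Finset.univ.erase i.1)
          fun j _ => hΛ i.2 j)
        rwa [← Finset.add_sum_erase _ _ (Finset.mem_univ i.1), sub_add_eq_sub_sub,
          sub_add_cancel] at h3
      have := re_trace_mul_le_of_effect h2 (hσ (x i)).1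
      rwa [(hσ _).2, Complex.one_re] at this
    simp only [hστ] at hx hnn hnn2
    -- The sum `4·ζ/64 + 4·ζ/16 + 2·ζ/6 + ζ/6` is below `ζ`. As both of its parts are nonnegative,
    -- it bounds the decoding error and the deviation of the output separately.
    exact covertCode_of_codebook hT hτ x hΛ hΛ1 (by linarith) (by linarith)

/-! ### The rate conditions -/

lemma logb_natCast_nonneg (k : ℕ) : 0 ≤ Real.logb 2 k := by
  rcases k.eq_zero_or_pos with h | h
  · simp [h]
  · exact Real.logb_nonneg one_lt_two (by exact_mod_cast h)

/-- The rate bound, multiplied by `a` and exponentiated. The term `v`, a logarithm of a number of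
eigenvalues, is dropped, because the Chernoff tests need no pinching. `Q = 0` is separate since its
logarithm is `0` by convention. -/
lemma packing_condition {a Q y ζ v : ℝ} (ha : 0 < a) (hQ : 0 ≤ Q) (hy : 0 < y) (hζ : 0 < ζ)
    (hv : 0 ≤ v) (h : Real.logb 2 y - 1 ≤
      -(1 / a) * Real.logb 2 Q - 1 / a * v - 4 / a * Real.logb 2 (12 / ζ)) :
    (y / 2) ^ a * Q ≤ (ζ / 12) ^ 4 := by
  rcases hQ.eq_or_lt with h0 | h0
  · rw [← h0, mul_zero]; positivity
  have h1 : Real.logb 2 ((y / 2) ^ a * Q) ≤ Real.logb 2 ((ζ / 12) ^ 4) := by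
    rw [Real.logb_mul (by positivity) h0.ne', Real.logb_rpow_eq_mul_logb_of_pos (by positivity),
      Real.logb_div hy.ne' two_ne_zero, Real.logb_self_eq_one one_lt_two, Real.logb_pow,
      show ζ / 12 = (12 / ζ)⁻¹ by rw [inv_div], Real.logb_inv]
    have h2 := mul_le_mul_of_nonneg_left h ha.le
    have h3 : a * (-(1 / a) * Real.logb 2 Q - 1 / a * v - 4 / a * Real.logb 2 (12 / ζ)) =
        -Real.logb 2 Q - v - 4 * Real.logb 2 (12 / ζ) := by field_simp
    rw [h3] at h2
    push_cast
    linarith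
  exact (Real.logb_le_logb one_lt_two (by positivity) (by positivity)).mp h1

lemma covering_condition {s G y ζ ν : ℝ} (hs : 0 < s) (hG : 0 ≤ G) (hy : 0 < y) (hζ : 0 < ζ)
    (hν : 0 < ν) (h : 1 / s * Real.logb 2 G + Real.logb 2 ν + (2 + 2 / s) * Real.logb 2 (12 / ζ) ≤
      Real.logb 2 y) : (y * (ζ / 12) ^ 2 / ν) ^ (-s) * G ≤ (ζ / 12) ^ 2 := by
  rcases hG.eq_or_lt with h0 | h0
  · rw [← h0, mul_zero]; positivity
  have h1 : Real.logb 2 ((y * (ζ / 12) ^ 2 / ν) ^ (-s) * G) ≤ Real.logb 2 ((ζ / 12) ^ 2) := by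
    rw [Real.logb_mul (by positivity) h0.ne', Real.logb_rpow_eq_mul_logb_of_pos (by positivity),
      Real.logb_div (by positivity) hν.ne', Real.logb_mul hy.ne' (by positivity), Real.logb_pow,
      show ζ / 12 = (12 / ζ)⁻¹ by rw [inv_div], Real.logb_inv]
    have h2 := mul_le_mul_of_nonneg_left h hs.le
    have h3 : s * (1 / s * Real.logb 2 G + Real.logb 2 ν + (2 + 2 / s) * Real.logb 2 (12 / ζ)) =
        Real.logb 2 G + s * Real.logb 2 ν + (2 * s + 2) * Real.logb 2 (12 / ζ) := by field_simp
    rw [h3] at h2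
    push_cast
    linarith
  exact (Real.logb_le_logb one_lt_two (by positivity) (by positivity)).mp h1

/-- The conditions on the numbers of messages and key values allow for a multiplicity `R` of
codewords that satisfies a packing and a covering condition. -/
lemma exists_multiplicity {packing covering : ℝ → ℝ} {S S' : Set ℝ} (hS' : S'.Nonempty) {L K : ℕ}
    (hL : 1 ≤ L) (hK : 1 ≤ K)
    (h1 : ((Real.logb 2 L : ℝ) : EReal) ≤ ⨆ a ∈ S, ((packing a : ℝ) : EReal))
    (h2 : (⨅ a ∈ S', ((covering a : ℝ) : EReal)) - (⨆ a ∈ S, ((packing a : ℝ) : EReal)) + 1 ≤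
      ((Real.logb 2 K : ℝ) : EReal)) :
    ∃ R : ℕ, 1 ≤ R ∧ (∃ a ∈ S, Real.logb 2 (L * R) - 1 ≤ packing a) ∧
      ∃ a ∈ S', covering a ≤ Real.logb 2 (L * R * K) := by
  have hL' : (0 : ℝ) < L := by exact_mod_cast hL
  have hK' : (0 : ℝ) < K := by exact_mod_cast hK
  have hsup : ∀ t : ℝ, ((t : ℝ) : EReal) < ⨆ a ∈ S, ((packing a : ℝ) : EReal) →
      ∃ a ∈ S, t < packing a := fun t ht => by
    simp only [lt_iSup_iff, exists_prop] at ht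
    obtain ⟨a, ha, h⟩ := ht
    exact ⟨a, ha, by exact_mod_cast h⟩
  generalize (⨆ a ∈ S, ((packing a : ℝ) : EReal)) = b at *
  induction b using EReal.rec with
  | bot => exact absurd h1 (by simp)
  -- Without a bound on packing, `R` can be taken so large that covering holds for any chosen
  -- exponent.
  | top =>
    obtain ⟨a', ha'⟩ := hS'
    obtain ⟨R, hR⟩ := exists_nat_ge ((2 : ℝ) ^ covering a' + 1)
    have hR0 : (2 : ℝ) ^ covering a' ≤ R := by linarith
    have hRpos : (1 : ℝ) ≤ R := by
      have := Real.rpow_pos_of_pos two_pos (covering a'); linarith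
    obtain ⟨a, ha, h⟩ := hsup (Real.logb 2 (L * R)) (EReal.coe_lt_top _)
    refine ⟨R, by exact_mod_cast hRpos, ⟨a, ha, by linarith⟩, a', ha', ?_⟩
    rw [Real.le_logb_iff_rpow_le one_lt_two (by positivity)]
    have hL1 : (1 : ℝ) ≤ L := by exact_mod_cast hL
    have hK1 : (1 : ℝ) ≤ K := by exact_mod_cast hK
    calc (2 : ℝ) ^ covering a' ≤ 1 * R * 1 := by linarith
      _ ≤ L * R * K := by gcongr
  | coe b =>
    have hbL : Real.logb 2 L ≤ b := by exact_mod_cast h1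
    have hLb : (L : ℝ) ≤ 2 ^ b := by rwa [Real.logb_le_iff_le_rpow one_lt_two hL'] at hbL
    -- With `R = ⌊2^b/L⌋ ≥ 1` the value `log (LR)` lies in `(b - 1, b]`. The supremum `b` need not
    -- be attained, which is why packing is claimed only with a slack of one bit.
    set y := (2 : ℝ) ^ b / L with hy
    have hy1 : 1 ≤ y := by rwa [hy, le_div_iff₀ hL', one_mul]
    have hR1 : 1 ≤ ⌊y⌋₊ := (Nat.one_le_floor_iff y).mpr hy1
    have hR1' : (1 : ℝ) ≤ ⌊y⌋₊ := by exact_mod_cast hR1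
    have hRle : (⌊y⌋₊ : ℝ) ≤ y := Nat.floor_le (by linarith)
    have hRgt : y < 2 * ⌊y⌋₊ := by linarith [Nat.lt_floor_add_one y]
    have hLR : (L * ⌊y⌋₊ : ℝ) ≤ 2 ^ b := by
      calc (L * ⌊y⌋₊ : ℝ) ≤ L * y := by gcongr
        _ = 2 ^ b := by rw [hy]; field_simp
    have hLR' : (2 : ℝ) ^ b < L * ⌊y⌋₊ * 2 := by
      calc (2 : ℝ) ^ b = L * y := by rw [hy]; field_simp
        _ < L * (2 * ⌊y⌋₊) := by gcongr
        _ = _ := by ring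
    have hlog1 : Real.logb 2 (L * ⌊y⌋₊) ≤ b := by
      rwa [Real.logb_le_iff_le_rpow one_lt_two (by positivity)]
    have hlog2 : b - 1 < Real.logb 2 (L * ⌊y⌋₊) := by
      rw [Real.lt_logb_iff_rpow_lt one_lt_two (by positivity), Real.rpow_sub_one two_ne_zero,
        div_lt_iff₀ two_pos]
      exact hLR'
    obtain ⟨a, ha, h⟩ := hsup (b - 1) (by exact_mod_cast (by linarith : b - 1 < b))
    refine ⟨⌊y⌋₊, hR1, ⟨a, ha, by linarith⟩, ?_⟩
    -- The summand `1` in the key condition pays for rounding `R` down; the strict inequality then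
    -- yields an actual exponent.
    have hinf : (⨅ a ∈ S', ((covering a : ℝ) : EReal)) <
        ((Real.logb 2 (L * ⌊y⌋₊ * K) : ℝ) : EReal) := by
      rw [Real.logb_mul (by positivity) hK'.ne']
      generalize (⨅ a ∈ S', ((covering a : ℝ) : EReal)) = i at *
      induction i using EReal.rec with
      | bot => exact EReal.bot_lt_coe _
      | top =>
        rw [EReal.top_sub_coe, show (⊤ : EReal) + 1 = ⊤ from EReal.top_add_coe 1] at h2
        exact absurd h2 (by simp)
      | coe i =>
        have h3 : i - b + 1 ≤ Real.logb 2 K := by exact_mod_cast h2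
        exact_mod_cast (by linarith : i < Real.logb 2 (L * ⌊y⌋₊) + Real.logb 2 K)
    simp only [iInf_lt_iff, exists_prop] at hinf
    obtain ⟨a', ha', h'⟩ := hinf
    exact ⟨a', ha', by exact_mod_cast h'.le⟩

end NoisyRates

/-! ## Covert codes over noiseless channels -/

section Noiseless

variable {A B C : Type*} [Fintype A] [Fintype B] [DecidableEq B] [Fintype C]

omit [Fintype B] in
lemma exists_largest_subset (l : B → ℝ) (D : ℕ) (S : Finset B) (hS : D + 1 ≤ S.card) :
    ∃ H ⊆ S, H.card = D + 1 ∧ ∃ x ∈ H, (∀ y ∈ H, l x ≤ l y) ∧ ∀ y ∈ S \ H, l y ≤ l x := by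
  induction D with
  | zero =>
    obtain ⟨x, hx, h⟩ := S.exists_max_image l (Finset.card_pos.mp (by omega))
    exact ⟨{x}, by simpa using hx, by simp, x, by simp, by simp,
      fun y hy => h y (Finset.mem_sdiff.mp hy).1⟩
  | succ D ih =>
    obtain ⟨H, hH, hcard, x, hx, h1, h2⟩ := ih (by omega)
    have hne : (S \ H).Nonempty := by
      rw [← Finset.card_pos, Finset.card_sdiff_of_subset hH]; omega
    obtain ⟨z, hz, h⟩ := (S \ H).exists_max_image l hne
    have hz' := Finset.mem_sdiff.mp hz
    refine ⟨insert z H, Finset.insert_subset hz'.1 hH, by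
      rw [Finset.card_insert_of_notMem hz'.2, hcard], z, by simp, fun y hy => ?_, fun y hy => ?_⟩
    · rcases Finset.mem_insert.mp hy with rfl | hy
      · exact le_rfl
      · exact (h2 z hz).trans (h1 y hy)
    · simp only [Finset.mem_sdiff, Finset.mem_insert, not_or] at hy
      exact h y (Finset.mem_sdiff.mpr ⟨hy.1, hy.2.2⟩)

omit [Fintype B] in
/-- A function bounded by `t` dominates a function that is constant on disjoint blocks of equal
size, up to the weight `t` times the size of the blocks. -/
lemma exists_blocks {γ : Type} [Fintype γ] [Nonempty γ] (l : B → ℝ) (n : ℕ) :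
    ∀ (S : Finset B) (t : ℝ), S.card ≤ n → 0 ≤ t → (∀ b ∈ S, 0 ≤ l b ∧ l b ≤ t) →
    ∃ (ι : Type) (_ : Fintype ι) (c : ι × γ → B) (w : ι → ℝ), Function.Injective c ∧
      (∀ x, c x ∈ S) ∧ (∀ r, 0 ≤ w r) ∧ (∀ x, w x.1 ≤ l (c x)) ∧
      ∑ b ∈ S, l b - Fintype.card γ * ∑ r, w r ≤ Fintype.card γ * t := by
  induction n with
  | zero =>
    intro S t hS ht _
    have : S = ∅ := Finset.card_eq_zero.mp (by omega)
    subst this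
    refine ⟨Empty, inferInstance, fun x => x.1.elim, fun x => x.elim, fun x => x.1.elim,
      fun x => x.1.elim, fun x => x.elim, fun x => x.1.elim, ?_⟩
    simp only [Finset.sum_empty, Finset.univ_eq_empty, mul_zero, sub_zero]
    positivity
  | succ n ih =>
    intro S t hS ht hl
    have hγ : 1 ≤ Fintype.card γ := Fintype.card_pos
    obtain ⟨D, hD⟩ : ∃ D, Fintype.card γ = D + 1 := ⟨Fintype.card γ - 1, by omega⟩
    -- Too few points for a block: all the remaining mass is given up, less than a full block times
    -- `t`.
    rcases lt_or_ge S.card (D + 1) with hlt | hge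
    · refine ⟨Empty, inferInstance, fun x => x.1.elim, fun x => x.elim, fun x => x.1.elim,
        fun x => x.1.elim, fun x => x.elim, fun x => x.1.elim, ?_⟩
      simp only [Finset.univ_eq_empty, Finset.sum_empty, mul_zero, sub_zero]
      refine (Finset.sum_le_card_nsmul _ _ t fun b hb => (hl b hb).2).trans ?_
      rw [nsmul_eq_mul]
      gcongr
      omega
    · obtain ⟨H, hH, hcard, x, hx, h1, h2⟩ := exists_largest_subset l D S hge
      have hxS := hl x (hH hx)
      -- The largest values form a block flattened to its minimum `l x`, which loses at most `card γ
      -- * (t - l x)`. All other values are bounded by `l x`, so the losses telescope.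
      obtain ⟨ι, hι, c, w, hc, hcS, hw, hwl, hsum⟩ := ih (S \ H) (l x)
        (by rw [Finset.card_sdiff_of_subset hH]; omega) hxS.1
        fun b hb => ⟨(hl b (Finset.mem_sdiff.mp hb).1).1, h2 b hb⟩
      have e : γ ≃ H := Fintype.equivOfCardEq (by simp [hD, hcard])
      refine ⟨Option ι, inferInstance, fun y => y.1.elim (e y.2 : B) fun r => c (r, y.2),
        fun r => r.elim (l x) w, ?_, ?_, ?_, ?_, ?_⟩
      · rintro ⟨_ | r, g⟩ ⟨_ | r', g'⟩ h
        · have : e g = e g' := Subtype.ext h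
          rw [e.injective this]
        · have h3 : (e g : B) = c (r', g') := h
          exact absurd (e g).2 (h3 ▸ (Finset.mem_sdiff.mp (hcS (r', g'))).2)
        · have h3 : c (r, g) = (e g' : B) := h
          exact absurd (e g').2 (h3 ▸ (Finset.mem_sdiff.mp (hcS (r, g))).2)
        · have h3 := hc (show c (r, g) = c (r', g') from h)
          simp only [Prod.mk.injEq] at h3
          rw [h3.1, h3.2]
      · rintro ⟨_ | r, g⟩
        · exact hH (e g).2
        · exact (Finset.mem_sdiff.mp (hcS (r, g))).1
      · rintro (_ | r)
        · exact hxS.1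
        · exact hw r
      · rintro ⟨_ | r, g⟩
        · exact h1 _ (e g).2
        · exact hwl (r, g)
      · rw [Fintype.sum_option]
        simp only [Option.elim]
        rw [← Finset.sum_sdiff hH]
        have h3 : ∑ b ∈ H, l b ≤ Fintype.card γ * t := by
          refine (Finset.sum_le_card_nsmul _ _ t fun b hb => (hl b (hH hb)).2).trans_eq ?_
          rw [nsmul_eq_mul, hcard, hD]
        rw [mul_add]
        linarith

/-- Truncation and flattening of a probability distribution. -/
lemma exists_flattening {γ : Type} [Fintype γ] [Nonempty γ] {l : B → ℝ} (hl : ∀ b, 0 ≤ l b)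
    (hl1 : ∑ b, l b = 1) {a t : ℝ} (ha : 0 < a) (ht : 0 < t) :
    ∃ (ι : Type) (_ : Fintype ι) (c : ι × γ → B) (w : ι → ℝ), Function.Injective c ∧
      (∀ r, 0 ≤ w r) ∧ (∀ x, w x.1 ≤ l (c x)) ∧
      1 - Fintype.card γ * ∑ r, w r ≤ Fintype.card γ * t + t ^ (-a) * ∑ b, l b ^ (1 + a) := by
  obtain ⟨ι, hι, c, w, hc, -, hw, hwl, hsum⟩ := exists_blocks (γ := γ) l _
    (Finset.univ.filter fun b => l b ≤ t) t le_rfl ht.le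
    fun b hb => ⟨hl b, (Finset.mem_filter.mp hb).2⟩
  refine ⟨ι, hι, c, w, hc, hw, hwl, ?_⟩
  -- Markov's inequality for the mass above the cut-off `t`.
  have h1 : ∑ b ∈ Finset.univ.filter (fun b => ¬ l b ≤ t), l b ≤
      t ^ (-a) * ∑ b, l b ^ (1 + a) := by
    rw [Finset.mul_sum]
    refine (Finset.sum_le_sum fun b hb => ?_).trans
      (Finset.sum_le_sum_of_subset_of_nonneg (Finset.filter_subset _ _) fun b _ _ =>
        mul_nonneg (Real.rpow_nonneg ht.le _) (Real.rpow_nonneg (hl b) _))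
    have hb' : t < l b := not_le.mp (Finset.mem_filter.mp hb).2
    have hlb : 0 < l b := ht.trans hb'
    rw [Real.rpow_add hlb, Real.rpow_one]
    have : (1 : ℝ) ≤ t ^ (-a) * l b ^ a := by
      rw [Real.rpow_neg ht.le, ← div_eq_inv_mul, one_le_div (Real.rpow_pos_of_pos ht _)]
      exact Real.rpow_le_rpow ht.le hb'.le ha.le
    nlinarith
  have h2 := Finset.sum_filter_add_sum_filter_not Finset.univ (fun b => l b ≤ t) l
  rw [hl1] at h2
  linarith

/-- The inclusion of the block with label `x` into the space. -/
def blockIncl {ι : Type*} {q : ℕ} (c : ι × C × Fin q → B) (x : ι × C) : Matrix B (Fin q) ℂ :=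
  Matrix.of fun b p => if b = c (x.1, x.2, p) then 1 else 0

omit [Fintype C] in
lemma conjTranspose_blockIncl_mul [DecidableEq C] {ι : Type*} [DecidableEq ι] {q : ℕ}
    {c : ι × C × Fin q → B} (hc : Function.Injective c) (x y : ι × C) :
    (blockIncl c x)ᴴ * blockIncl c y = if x = y then 1 else 0 := by
  ext p p'
  simp only [Matrix.mul_apply, conjTranspose_apply, blockIncl, of_apply, apply_ite star, star_one,
    star_zero, mul_ite, mul_one, mul_zero, Finset.sum_ite_eq', Finset.mem_univ,
    if_true, hc.eq_iff]
  obtain ⟨r, m⟩ := x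
  obtain ⟨r', m'⟩ := y
  by_cases h : (r, m) = (r', m')
  · rw [if_pos h]
    simp only [Prod.mk.injEq] at h
    obtain ⟨rfl, rfl⟩ := h
    simp [Matrix.one_apply, eq_comm]
  · rw [if_neg h, Matrix.zero_apply, if_neg]
    rintro h'
    simp only [Prod.mk.injEq] at h' h
    exact h ⟨h'.1.symm, h'.2.1.symm⟩

omit [Fintype B] [Fintype C] in
lemma blockIncl_mul_conjTranspose {ι : Type*} {q : ℕ} (c : ι × C × Fin q → B) (x : ι × C) :
    blockIncl c x * (blockIncl c x)ᴴ =
      rdiag fun b => ∑ p, if c (x.1, x.2, p) = b then 1 else 0 := by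
  ext b b'
  simp only [Matrix.mul_apply, conjTranspose_apply, blockIncl, of_apply, rdiag,
    Matrix.diagonal_apply]
  split_ifs with h
  · subst h
    push_cast
    refine Finset.sum_congr rfl fun p _ => ?_
    simp [apply_ite, eq_comm]
  · refine Finset.sum_eq_zero fun p _ => ?_
    by_cases h1 : b = c (x.1, x.2, p)
    · by_cases h2 : b' = c (x.1, x.2, p)
      · exact absurd (h1.trans h2.symm) h
      · simp [h2]
    · simp [h1]

omit [DecidableEq B] [Fintype B] in
lemma CP.add {Φ Ψ : Op A →ₗ[ℂ] Op B} (hΦ : CP Φ) (hΨ : CP Ψ) : CP (Φ + Ψ) := by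
  have h := CP.sum (Φ := fun b : Bool => cond b Φ Ψ) fun b => by cases b <;> assumption
  rwa [Fintype.sum_bool] at h

lemma trFst_maxEnt {q : ℕ} (hq : 1 ≤ q) : trFst (maxEnt q) = (((q : ℝ)⁻¹ : ℝ) : ℂ) • 1 := by
  have hq' : (0 : ℝ) < q := by exact_mod_cast hq
  ext p p'
  simp only [trFst, maxEnt, ketbra, vecMulVec_apply, Pi.star_apply, apply_ite star, star_zero,
    mul_ite, mul_zero, ite_mul, zero_mul, Finset.sum_ite_eq', Finset.mem_univ, if_true,
    Matrix.smul_apply, Matrix.one_apply, smul_eq_mul, mul_one, Complex.star_def,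
    Complex.conj_ofReal, ← Complex.ofReal_mul]
  rw [show 1 / √(q : ℝ) * (1 / √q) = (q : ℝ)⁻¹ by
    rw [div_mul_div_comm, one_mul, Real.mul_self_sqrt hq'.le, one_div]]
  by_cases h : p = p' <;> simp [h, eq_comm]

/-- Messages and halves of maximally entangled states are encoded into blocks of eigenvectors. -/
lemma covertCode_of_blocks [DecidableEq C] [Nonempty C] {ι : Type*} [Fintype ι] {q : ℕ}
    (hq : 1 ≤ q) {U : Op B} (hU : Uᴴ * U = 1) (hU' : U * Uᴴ = 1) {c : ι × C × Fin q → B}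
    (hc : Function.Injective c) {w : ι → ℝ} (hw : ∀ r, 0 ≤ w r) {s : ℝ} (hs : 0 < s)
    (hws : Fintype.card C * q * ∑ r, w r = s) {ρ : Op B} {ζ : ℝ}
    (hζ : traceNorm (((s⁻¹ : ℝ) : ℂ) • (U * rdiag (fun b => ∑ y, if c y = b then w y.1 else 0) *
      Uᴴ) - ρ) ≤ ζ) :
    CovertCode C (Fin 1) (LinearMap.id : Op B →ₗ[ℂ] Op B) (maxEnt q) ρ 0 ζ := by
  classical
  obtain ⟨m₀⟩ := ‹Nonempty C›
  have hneC : Nonempty C := ⟨m₀⟩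
  have hq' : (0 : ℝ) < q := by exact_mod_cast hq
  have hC : (0 : ℝ) < Fintype.card C := Nat.cast_pos.mpr Fintype.card_pos
  let V : ι × C → Matrix B (Fin q) ℂ := fun x => U * blockIncl c x
  -- Kraus operators for eigenvectors outside all blocks. They make the decoder trace preserving and
  -- never act on a codeword.
  let G : B → Matrix (Fin q) B ℂ := fun b =>
    if ∃ y, c y = b then 0 else (Matrix.single (⟨0, hq⟩ : Fin q) b (1 : ℂ) : Matrix (Fin q) B ℂ) * Uᴴ
  -- The probability with which the encoder chooses block `r`. Uniform over messages, the output
  -- then has the constant weight `w r / s` on that block.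
  let v : ι → ℝ := fun r => Fintype.card C * q * w r / s
  have hv : ∀ r, 0 ≤ v r := fun r => by have := hw r; positivity
  have hv1 : ∑ r, v r = 1 := by
    rw [← Finset.sum_div, ← Finset.mul_sum, hws, div_self hs.ne']
  have hVV : ∀ x y, (V x)ᴴ * V y = if x = y then 1 else 0 := fun x y => by
    rw [← conjTranspose_blockIncl_mul hc, conjTranspose_mul, Matrix.mul_assoc,
      ← Matrix.mul_assoc Uᴴ, hU, Matrix.one_mul]
  have hGV : ∀ b x, G b * V x = 0 := fun b x => by
    dsimp only [G, V]
    split_ifs with h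
    · exact Matrix.zero_mul _
    · rw [Matrix.mul_assoc, ← Matrix.mul_assoc Uᴴ, hU, Matrix.one_mul]
      ext p p'
      rw [Matrix.mul_apply, Matrix.zero_apply]
      refine Finset.sum_eq_zero fun b' _ => ?_
      rw [Matrix.single_apply, blockIncl, of_apply]
      by_cases h1 : b' = c (x.1, x.2, p')
      · rw [if_neg (fun h2 => h ⟨_, (h2.2.trans h1).symm⟩), zero_mul]
      · rw [if_neg h1, mul_zero]
  let Z : Op B →ₗ[ℂ] Op (Fin q) := ∑ b, conjMap (G b)
  have hZ : CP Z := CP.of_conjMap_sum G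
  let Υ : C → Op B →ₗ[ℂ] Op (Fin q) := fun m =>
    ∑ r, conjMap (V (r, m))ᴴ + if m = m₀ then Z else 0
  have hΥ : ∀ m, CP (Υ m) := fun m => by
    have h1 : CP (∑ r, conjMap (V (r, m))ᴴ) := CP.of_conjMap_sum fun r => (V (r, m))ᴴ
    dsimp only [Υ]
    split_ifs with h
    · exact h1.add hZ
    · rwa [add_zero]
  have hsum : ∑ x : ι × C, V x * (V x)ᴴ + ∑ b, (G b)ᴴ * G b = 1 := by
    have h1 : ∀ x, V x * (V x)ᴴ =
        U * rdiag (fun b => ∑ p, if c (x.1, x.2, p) = b then (1 : ℝ) else 0) * Uᴴ := fun x => by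
      rw [← blockIncl_mul_conjTranspose, conjTranspose_mul, Matrix.mul_assoc, Matrix.mul_assoc,
        Matrix.mul_assoc]
    have h2 : ∀ b, (G b)ᴴ * G b = U * rdiag (fun b' => if b' = b then
        (if ∃ y, c y = b then (0 : ℝ) else 1) else 0) * Uᴴ := fun b => by
      dsimp only [G]
      split_ifs with h
      · simp [rdiag]
      · rw [conjTranspose_mul, conjTranspose_conjTranspose, Matrix.mul_assoc,
          ← Matrix.mul_assoc (Matrix.single _ _ _)ᴴ, ← Matrix.mul_assoc U, conjTranspose_single,
          Matrix.single_mul_single_same]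
        congr 2
        ext x y
        simp only [Matrix.single_apply, rdiag, Matrix.diagonal_apply, star_one, mul_one]
        rcases eq_or_ne x y with rfl | hxy
        · by_cases hx : b = x <;> simp [hx, eq_comm]
        · rw [if_neg hxy, if_neg fun h => hxy (h.1.symm.trans h.2)]
    simp only [h1, h2]
    rw [← Matrix.sum_mul, ← Matrix.sum_mul, ← Matrix.mul_sum, ← Matrix.mul_sum,
      ← Matrix.add_mul, ← Matrix.mul_add]
    rw [show (∑ x : ι × C, rdiag (fun b => ∑ p, if c (x.1, x.2, p) = b then (1 : ℝ) else 0)) +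
      ∑ b, rdiag (fun b' => if b' = b then (if ∃ y, c y = b then (0 : ℝ) else 1) else 0) =
        (1 : Op B) from ?_, Matrix.mul_one, hU']
    ext b b'
    simp only [Matrix.add_apply, Matrix.sum_apply, rdiag, Matrix.diagonal_apply, Matrix.one_apply]
    by_cases h : b = b'
    · subst h
      simp only [if_true]
      rw [← Complex.ofReal_sum, ← Complex.ofReal_sum, ← Complex.ofReal_add,
        ← Complex.ofReal_one]
      congr 1
      rw [Finset.sum_ite_eq, if_pos (Finset.mem_univ _), show ∑ x : ι × C, ∑ p, (if c (x.1, x.2, p) = b then (1 : ℝ) else 0) =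
          ∑ y, if c y = b then (1 : ℝ) else 0 by simp only [Fintype.sum_prod_type]]
      split_ifs with h
      · obtain ⟨y, hy⟩ := h
        rw [add_zero, Finset.sum_eq_single y (fun z _ hz => if_neg fun h => hz
          (hc (h.trans hy.symm))) (by simp), if_pos hy]
      · rw [Finset.sum_eq_zero fun y _ => if_neg fun h1 => h ⟨y, h1⟩, zero_add]
    · simp [h]
  have hΥt : TP (∑ m, Υ m) := fun X => by
    simp only [Υ, Finset.sum_add_distrib, Finset.sum_ite_eq', Finset.mem_univ, if_true, Z,
      LinearMap.add_apply, LinearMap.sum_apply, conjMap_apply, conjTranspose_conjTranspose,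
      Matrix.trace_add, Matrix.trace_sum]
    have h1 : ∀ m r, ((V (r, m))ᴴ * X * V (r, m)).trace = (V (r, m) * (V (r, m))ᴴ * X).trace :=
      fun m r => Matrix.trace_mul_cycle _ _ _
    have h2 : ∀ b, (G b * X * (G b)ᴴ).trace = ((G b)ᴴ * G b * X).trace :=
      fun b => Matrix.trace_mul_cycle _ _ _
    simp only [h1, h2]
    rw [Finset.sum_comm, ← Fintype.sum_prod_type' fun r m => (V (r, m) * (V (r, m))ᴴ * X).trace,
      ← Matrix.trace_sum, ← Matrix.trace_sum, ← Matrix.trace_add, ← Matrix.sum_mul,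
      ← Matrix.sum_mul, ← Matrix.add_mul, hsum, Matrix.one_mul]
  -- Different blocks are orthogonal, so decoding is exact whichever `r` was chosen.
  have hdec : ∀ m r, Υ m ∘ₗ conjMap (V (r, m)) = LinearMap.id := fun m r => by
    ext1 X
    have h1 : Z (V (r, m) * X * (V (r, m))ᴴ) = 0 := by
      simp only [Z, LinearMap.sum_apply, conjMap_apply]
      refine Finset.sum_eq_zero fun b _ => ?_
      rw [← Matrix.mul_assoc, ← Matrix.mul_assoc, hGV, Matrix.zero_mul, Matrix.zero_mul,
        Matrix.zero_mul]
    have h2 : ∀ r', (V (r', m))ᴴ * (V (r, m) * X * (V (r, m))ᴴ) * V (r', m) =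
        if r' = r then X else 0 := fun r' => by
      rw [show (V (r', m))ᴴ * (V (r, m) * X * (V (r, m))ᴴ) * V (r', m) =
        ((V (r', m))ᴴ * V (r, m)) * X * ((V (r, m))ᴴ * V (r', m)) by
          simp only [Matrix.mul_assoc], hVV, hVV]
      by_cases h : r' = r
      · simp [h]
      · simp [h]
    simp only [Υ, LinearMap.comp_apply, LinearMap.add_apply, LinearMap.sum_apply, conjMap_apply,
      conjTranspose_conjTranspose, h2, Finset.sum_ite_eq', Finset.mem_univ, if_true,
      LinearMap.id_apply]
    split_ifs
    · rw [h1, add_zero]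
    · rw [LinearMap.zero_apply, add_zero]
  let En : C → Op (Fin q) →ₗ[ℂ] Op B := fun m => ∑ r, ((v r : ℝ) : ℂ) • conjMap (V (r, m))
  have hEn : ∀ m, IsChannel (En m) := fun m => by
    have h1 : ∀ r, ((v r : ℝ) : ℂ) • conjMap (V (r, m)) =
        conjMap (((√(v r) : ℝ) : ℂ) • V (r, m)) := fun r => by
      ext1 X
      rw [LinearMap.smul_apply, conjMap_apply, conjMap_apply, conjTranspose_smul,
        Matrix.smul_mul, Matrix.smul_mul, Matrix.mul_smul, smul_smul, Complex.star_def,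
        Complex.conj_ofReal, ← Complex.ofReal_mul, Real.mul_self_sqrt (hv r)]
    simp only [En, h1]
    refine (CP.of_conjMap_sum _).isChannel (TP.of_conjMap_sum ?_)
    simp only [conjTranspose_smul, Matrix.smul_mul, Matrix.mul_smul, smul_smul, Complex.star_def,
        Complex.conj_ofReal, ← Complex.ofReal_mul, Real.mul_self_sqrt (hv _), hVV, if_true]
    rw [← Finset.sum_smul, ← Complex.ofReal_sum, hv1, Complex.ofReal_one, one_smul]
  have hdecE : ∀ m, Υ m ∘ₗ En m = LinearMap.id := fun m => by
    ext1 X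
    have h1 := fun r => LinearMap.congr_fun (hdec m r) X
    simp only [LinearMap.comp_apply, LinearMap.id_apply] at h1
    simp only [En, LinearMap.comp_apply, LinearMap.sum_apply, LinearMap.smul_apply, map_sum,
      map_smul, h1, LinearMap.id_apply]
    rw [← Finset.sum_smul, ← Complex.ofReal_sum, hv1, Complex.ofReal_one, one_smul]
  refine ⟨fun x => idTensor (Fin q) (En x.1) (maxEnt q), fun _ => Υ, fun x =>
    (isDensity_maxEnt hq).idTensor (hEn _), fun _ => hΥ, fun _ => hΥt, ?_, ?_⟩
  · have h1 : ∀ x : C × Fin 1, idTensor (Fin q) (Υ x.1 ∘ₗ LinearMap.id)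
        (idTensor (Fin q) (En x.1) (maxEnt q)) = maxEnt q := fun x => by
      change idTensor (Fin q) (Υ x.1 ∘ₗ En x.1) (maxEnt q) = _
      rw [hdecE]
      rfl
    rw [Finset.sum_eq_zero fun x _ => by rw [h1 x, sub_self, traceNorm_zero], mul_zero]
  · refine (le_of_eq ?_).trans hζ
    congr 2
    simp only [LinearMap.id_apply, trFst_idTensor, trFst_maxEnt hq, En, LinearMap.sum_apply,
      LinearMap.smul_apply, conjMap_apply, Matrix.mul_smul, Matrix.smul_mul, Matrix.mul_one]
    have h1 : ∀ x, V x * (V x)ᴴ =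
        U * rdiag (fun b => ∑ p, if c (x.1, x.2, p) = b then (1 : ℝ) else 0) * Uᴴ := fun x => by
      rw [← blockIncl_mul_conjTranspose, conjTranspose_mul, Matrix.mul_assoc, Matrix.mul_assoc,
        Matrix.mul_assoc]
    simp only [h1, avg, Fintype.card_prod, Fintype.card_fin, mul_one]
    rw [Fintype.sum_prod_type]
    simp only [Finset.univ_unique, Finset.sum_singleton]
    have h2 : ∀ (a : ℂ) (X : Op B), a • (U * X * Uᴴ) = U * (a • X) * Uᴴ := fun a X => by simp
    simp only [h2, ← Matrix.sum_mul, ← Matrix.mul_sum]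
    congr 2
    ext b b'
    simp only [Matrix.smul_apply, Matrix.sum_apply, rdiag, Matrix.diagonal_apply]
    by_cases h : b = b'
    · subst h
      simp only [if_true, smul_eq_mul, ← Complex.ofReal_mul, ← Complex.ofReal_sum]
      congr 1
      rw [Finset.sum_comm, Finset.mul_sum, Finset.mul_sum, Fintype.sum_prod_type]
      refine Finset.sum_congr rfl fun r _ => ?_
      rw [Fintype.sum_prod_type]
      simp only [Finset.mul_sum, v]
      refine Finset.sum_congr rfl fun m _ => Finset.sum_congr rfl fun p _ => ?_
      split_ifs
      · field_simp
      · simp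
    · simp [h]

/-- A density operator is close to a normalized operator that is constant on blocks of
eigenvectors. -/
lemma covertCode_of_flattening [DecidableEq C] [Nonempty C] {ι : Type*} [Fintype ι] {q : ℕ}
    (hq : 1 ≤ q) {U : Op B} (hU : Uᴴ * U = 1) (hU' : U * Uᴴ = 1) {d : B → ℝ} (hd1 : ∑ b, d b = 1)
    (hd : ∀ b, 0 ≤ d b) {c : ι × C × Fin q → B} (hc : Function.Injective c) {w : ι → ℝ}
    (hw : ∀ r, 0 ≤ w r) (hwd : ∀ x, w x.1 ≤ d (c x)) {η : ℝ} (hη1 : η < 1)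
    (hη : 1 - Fintype.card C * q * ∑ r, w r ≤ η) :
    CovertCode C (Fin 1) (LinearMap.id : Op B →ₗ[ℂ] Op B) (maxEnt q) (U * rdiag d * Uᴴ) 0
      (2 * η) := by
  classical
  obtain ⟨s, hs⟩ : ∃ s, Fintype.card C * q * ∑ r, w r = s := ⟨_, rfl⟩
  have hs0 : 0 < s := by linarith
  refine covertCode_of_blocks hq hU hU' hc hw hs0 hs ?_
  set u : B → ℝ := fun b => ∑ y, if c y = b then w y.1 else 0 with hu
  have hu0 : ∀ b, 0 ≤ u b := fun b => Finset.sum_nonneg fun y _ => by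
    split_ifs
    exacts [hw _, le_rfl]
  have hud : ∀ b, u b ≤ d b := fun b => by
    by_cases h : ∃ y, c y = b
    · obtain ⟨y, hy⟩ := h
      rw [hu]
      dsimp only
      rw [Finset.sum_eq_single y (fun z _ hz => if_neg fun h => hz (hc (h.trans hy.symm)))
        (by simp), if_pos hy, ← hy]
      exact hwd y
    · rw [hu]
      dsimp only
      rw [Finset.sum_eq_zero fun y _ => if_neg fun h1 => h ⟨y, h1⟩]
      exact hd b
  have hus : ∑ b, u b = s := by
    rw [hu, Finset.sum_comm, ← hs]
    simp only [Finset.sum_ite_eq, Finset.mem_univ, if_true]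
    rw [Fintype.sum_prod_type]
    simp only [Finset.sum_const, Finset.card_univ, Fintype.card_prod, Fintype.card_fin,
      nsmul_eq_mul, Nat.cast_mul, ← Finset.mul_sum]
  have hs1 : s ≤ 1 := by
    rw [← hus, ← hd1]
    exact Finset.sum_le_sum fun b _ => hud b
  have hX := posSemidef_conj_rdiag U hu0
  have hρ := isHermitian_conj_rdiag U d
  -- The missing mass `1 - s` counts twice, here and in the renormalization `h2`; hence the
  -- deviation `2 * η`.
  have h1 : traceNorm (U * rdiag d * Uᴴ - U * rdiag u * Uᴴ) = 1 - s := by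
    rw [conj_rdiag_sub, traceNorm_of_posSemidef (posSemidef_conj_rdiag U fun b =>
      sub_nonneg.mpr (hud b)), trace_conj_rdiag hU, Complex.ofReal_re, Finset.sum_sub_distrib,
      hd1, hus]
  have h2 : traceNorm (((s⁻¹ : ℝ) : ℂ) • (U * rdiag u * Uᴴ) - U * rdiag u * Uᴴ) ≤ 1 - s := by
    have : ((s⁻¹ : ℝ) : ℂ) • (U * rdiag u * Uᴴ) - U * rdiag u * Uᴴ =
        ((s⁻¹ - 1 : ℝ) : ℂ) • (U * rdiag u * Uᴴ) := by
      rw [Complex.ofReal_sub, sub_smul, Complex.ofReal_one, one_smul]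
    rw [this]
    refine (traceNorm_smul_le hX.1 (by
      rw [sub_nonneg]; exact (one_le_inv₀ hs0).mpr hs1)).trans_eq ?_
    rw [traceNorm_of_posSemidef hX, trace_conj_rdiag hU, Complex.ofReal_re, hus]
    field_simp
  refine (traceNorm_sub_le_add (isHermitian_smul hX.1 _) hX.1 hρ).trans ?_
  rw [traceNorm_sub_comm (U * rdiag u * Uᴴ), h1]
  linarith

/-- Covert codes over a noiseless channel, without key. -/
theorem exists_noiseless_covertCode {L : ℕ} (hL : 1 ≤ L) {ρ : Op B} (hρ : IsDensity ρ) {ζ : ℝ}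
    (hζ : 0 < ζ) (hζ' : ζ ≤ 1 / 16)
    (hrate : ((Real.logb 2 L : ℝ) : EReal) ≤ noiselessBits ρ ζ) :
    CovertCode (Fin L) (Fin 1) (LinearMap.id : Op B →ₗ[ℂ] Op B) (maxEnt ⌈1 / ζ⌉₊) ρ 0 ζ := by
  obtain ⟨hq1, -, hq2⟩ := ceil_inv_bounds hζ hζ'
  set q := ⌈1 / ζ⌉₊ with hq
  have hL' : (1 : ℝ) ≤ L := by exact_mod_cast hL
  have : Nonempty (Fin L) := ⟨⟨0, hL⟩⟩
  have : Nonempty (Fin q) := ⟨⟨0, hq1⟩⟩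
  obtain ⟨a, ⟨ha0, ha1⟩, ha⟩ : ∃ a ∈ Set.Ioo (0 : ℝ) 1,
      Real.logb 2 L - 1 < renyiH a ρ - 4 / a * Real.logb 2 (2 / ζ) := by
    have h1 : ((Real.logb 2 L - 1 : ℝ) : EReal) < noiselessBits ρ ζ :=
      lt_of_lt_of_le (by exact_mod_cast (by linarith : Real.logb 2 L - 1 < Real.logb 2 L)) hrate
    simp only [noiselessBits, lt_iSup_iff, exists_prop] at h1
    obtain ⟨a, ha, h⟩ := h1
    exact ⟨a, ha, by exact_mod_cast h⟩
  obtain ⟨U, d, hU, hU', hd, rfl⟩ := exists_spectral hρ.1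
  have hd1 : ∑ b, d b = 1 := by
    have h := hρ.2
    rw [trace_conj_rdiag hU] at h
    exact_mod_cast h
  have hQ0 : 0 ≤ ∑ b, d b ^ (1 + a) := Finset.sum_nonneg fun b _ => Real.rpow_nonneg (hd b) _
  have hpack : (L / 2 : ℝ) ^ a * ∑ b, d b ^ (1 + a) ≤ (ζ / 2) ^ 4 := by
    -- The substitution `6 * ζ` turns the constant `12` into the `2` of the noiseless rate.
    have h := packing_condition (ζ := 6 * ζ) (v := 0) (y := L) ha0 hQ0 (by linarith) (by linarith)
      le_rfl (by
        rw [renyiH, rpow_conj_rdiag hU hU', trace_conj_rdiag hU, Complex.ofReal_re,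
          add_comm a 1] at ha
        rw [show 12 / (6 * ζ) = 2 / ζ by field_simp; norm_num]
        linarith)
    rwa [show 6 * ζ / 12 = ζ / 2 by ring] at h
  set Q := ∑ b, d b ^ (1 + a) with hQ
  -- This cut-off is so small that a block of `L * q` levels costs at most `ζ/4`, and so large that
  -- the mass above it is at most `ζ²`; the sum is below `ζ/2`.
  have ht : 0 < ζ ^ 2 / (8 * L) := by positivity
  obtain ⟨ι, hι, c, w, hc, hw, hwd, hloss⟩ :=
    exists_flattening (γ := Fin L × Fin q) hd hd1 ha0 ht
  have hloss1 : (L * q : ℝ) * (ζ ^ 2 / (8 * L)) ≤ ζ / 4 := by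
    have h1 : (L * q : ℝ) * (ζ ^ 2 / (8 * L)) = q * ζ ^ 2 / 8 := by field_simp
    have h2 : (q : ℝ) * ζ ≤ 2 := by
      calc (q : ℝ) * ζ ≤ 17 / (16 * ζ) * ζ := by gcongr
        _ = 17 / 16 := by field_simp
        _ ≤ 2 := by norm_num
    rw [h1]
    nlinarith
  have hloss2 : (ζ ^ 2 / (8 * L)) ^ (-a) * Q ≤ ζ ^ 2 := by
    have h1 : (ζ ^ 2 / (8 * L)) ^ (-a) = (16 / ζ ^ 2) ^ a * (L / 2 : ℝ) ^ a := by
      rw [← Real.mul_rpow (by positivity) (by positivity), Real.rpow_neg ht.le,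
        ← Real.inv_rpow ht.le]
      congr 1
      field_simp
      norm_num
    have h2 : (16 / ζ ^ 2) ^ a ≤ 16 / ζ ^ 2 := by
      refine (Real.rpow_le_rpow_of_exponent_le ?_ ha1.le).trans_eq (Real.rpow_one _)
      rw [le_div_iff₀ (by positivity)]
      nlinarith
    rw [h1, mul_assoc]
    calc (16 / ζ ^ 2) ^ a * ((L / 2 : ℝ) ^ a * Q) ≤ 16 / ζ ^ 2 * (ζ / 2) ^ 4 := by gcongr
      _ = ζ ^ 2 := by field_simp; norm_num
  have h := covertCode_of_flattening (C := Fin L) hq1 hU hU' hd1 hd hc hw hwd (η := ζ / 2)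
    (by linarith) (by
      simp only [Fintype.card_prod, Fintype.card_fin, Nat.cast_mul] at hloss ⊢
      nlinarith)
  rwa [show 2 * (ζ / 2) = ζ by ring] at h

end Noiseless

/-! ## Codes for entanglement sharing from distillation and covert communication -/

section Combination

variable {A B C A₁ A₂ B₁ B₂ R κ Q Q' : Type*} [Fintype A] [Fintype B] [Fintype C] [Fintype A₁]
  [Fintype A₂] [Fintype B₁] [Fintype B₂] [Fintype R] [Fintype κ] [Fintype Q] [Fintype Q']

/-- Completely depolarizing channels. -/
lemma exists_replacer {Z : Op B} (hZ : IsDensity Z) :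
    ∃ D : Op A →ₗ[ℂ] Op B, IsChannel D :=
  ⟨trSndL ∘ₗ kronL Z, (CP.trSndL.comp (CP.kronL hZ.1)).isChannel fun X => by
    change (trSnd (Z ⊗ₖ X)).trace = X.trace
    rw [trace_trSnd, Matrix.trace_kronecker, hZ.2, one_mul]⟩

/-- If the allowed error is at least `2`, the cover itself is a code. -/
lemma exists_isCCESCode_of_two_le [DecidableEq B] {T : Op A →ₗ[ℂ] Op B} (hT : IsChannel T)
    {S M M' : ℕ} (hS : 1 ≤ S) (hM : 1 ≤ M) (hM' : 1 ≤ M') {α : Fin M → Op A}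
    (hα : ∀ w, IsDensity (α w)) {E : ℝ} (hE : 2 ≤ E) :
    ∃ (g : Fin S → Fin M → Op (Fin M' × A)) (D : Fin S → Op B →ₗ[ℂ] Op (Fin M × Fin M')),
      IsCCESCode T S M M' g D E ∧ ccesOutput T S M M' g = (1 / (M : ℂ)) • ∑ w, T (α w) := by
  have : Nonempty (Fin S) := ⟨⟨0, hS⟩⟩
  have : Nonempty (Fin M) := ⟨⟨0, hM⟩⟩
  have hΦ := isDensity_maxEnt hM'
  have hΦM := isDensity_maxEnt hM
  have hZ := hΦ.trFst
  -- Any decoder will do: the required success probability is negative, and two states are never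
  -- further apart than `2`.
  obtain ⟨D, hD⟩ := exists_replacer (A := B) (hΦM.trFst.kronecker hZ)
  have hg : ∀ w, IsDensity (trFst (maxEnt M') ⊗ₖ α w) := fun w => hZ.kronecker (hα w)
  have htr : IsChannel (trFstL : Op (Fin M × Fin M') →ₗ[ℂ] Op (Fin M')) :=
    CP.trFstL.isChannel fun X => trace_trFst X
  refine ⟨fun _ w => trFst (maxEnt M') ⊗ₖ α w, fun _ => D, ⟨fun _ w => hg w, fun _ => hD, ?_, ?_⟩,
    ?_⟩
  · have h0 : ∀ w, 0 ≤ ((trSnd (D (T (trFst (trFst (maxEnt M') ⊗ₖ α w))))) w w).re := fun w => by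
      have h1 := hD.isDensity (hT.isDensity (hg w).trFst)
      have h2 := (CP.trSndL.posSemidef h1.1).diag_nonneg (i := w)
      exact (Complex.le_def.mp h2).1
    refine le_trans ?_ (mul_nonneg (by positivity) (Finset.sum_nonneg fun s _ =>
      Finset.sum_nonneg fun w _ => h0 w))
    linarith
  · rw [smul_sum_sum_eq_avg]
    exact (traceNorm_sub_le_two (IsDensity.avg fun w => IsDensity.avg fun _ =>
      (hg w).idTensor (htr.comp (hD.comp hT))) hΦ).trans hE
  · rw [ccesOutput, smul_sum_sum_eq_avg]
    simp only [avg_const, trFst_kronecker, hZ.2, one_smul]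
    simp [avg]

lemma isChannel_reindexL (e : A ≃ B) : IsChannel (reindexL e) :=
  (CP.reindexL e).isChannel (TP.reindexL e)

lemma traceNorm_sub_self_le [DecidableEq A] {X Y : Op A} (h : X = Y) : traceNorm (X - Y) ≤ 0 := by
  rw [h, sub_self, traceNorm_zero]

/-- Distillation through a covert code which also generates entanglement. -/
lemma OneWay.innerCode_maxEnt [AddGroup C] [Nonempty κ] [DecidableEq B₁] [DecidableEq B₂]
    {T₁ : Op A₁ →ₗ[ℂ] Op B₁} {T₂ : Op A₂ →ₗ[ℂ] Op B₂} (hT₁ : IsChannel T₁) (hT₂ : IsChannel T₂)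
    {ψ : Op (R × A₁)} (hψ : IsDensity ψ) {m q : ℕ} (hq : 1 ≤ q) {ρ : Op B₂}
    (hρ : ρ.IsHermitian) {e δ ζ : ℝ} (h1 : OneWay C (idTensor R T₁ ψ) (maxEnt m) e)
    (h2 : CovertCode C κ T₂ (maxEnt q) ρ δ ζ) :
    InnerCode (C × κ) (mapTensor T₁ T₂) (maxEnt (m * q)) (T₁ (trFst ψ) ⊗ₖ ρ) (e + 2 * δ) ζ := by
  have hbox : (box (maxEnt m) (maxEnt q)).IsHermitian :=
    (posSemidef_box (Matrix.posSemidef_vecMulVec_self_star _)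
      (Matrix.posSemidef_vecMulVec_self_star _)).1
  have h := (h1.innerCode hT₁ hT₂ hψ (isHermitian_maxEnt m) (isDensity_maxEnt hq) hρ h2).local
    ((hT₁.cp.mapTensor hT₂.cp).isChannel (hT₁.tp.mapTensor hT₂.tp)) hbox
    (isHermitian_maxEnt (m * q)) (isChannel_reindexL finProdFinEquiv)
    (isChannel_reindexL finProdFinEquiv)
    (traceNorm_sub_self_le (mapTensor_reindexL_box_maxEnt m q))
  exact h.mono (by linarith)

/-- Distillation through a covert code over a noiseless channel. -/
lemma innerCode_of_noiseless [DecidableEq B₁] [DecidableEq B₂] {T₁ : Op A₁ →ₗ[ℂ] Op B₁}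
    {T₂ : Op A₂ →ₗ[ℂ] Op B₂} (hT₁ : IsChannel T₁) (hT₂ : IsChannel T₂) {ψ : Op (R × A₁)}
    (hψ : IsDensity ψ) {α : Op A₂} (hα : IsDensity α) {L m M : ℕ} (hL : 1 ≤ L) (hm : 1 ≤ m)
    (hmM : m ≤ M) {ζ : ℝ} (hζ : 0 < ζ) (hζ1 : ζ ≤ 1 / 16)
    (h1 : OneWay (Fin L) (idTensor R T₁ ψ) (maxEnt M) ζ)
    (h2 : CovertCode (Fin L) (Fin 1) T₂ (maxEnt ⌈1 / ζ⌉₊) (T₂ α) 0 ζ) :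
    InnerCode (Fin (L * 1)) (mapTensor T₁ T₂) (maxEnt m) (mapTensor T₁ T₂ (trFst ψ ⊗ₖ α))
      (7 * ζ) ζ := by
  obtain ⟨hq, hql, -⟩ := ceil_inv_bounds hζ hζ1
  have : NeZero L := ⟨by omega⟩
  have hT := (hT₁.cp.mapTensor hT₂.cp).isChannel (hT₁.tp.mapTensor hT₂.tp)
  have h := h1.innerCode_maxEnt hT₁ hT₂ hψ hq (hT₂.isDensity hα).1.1 h2
  rw [← mapTensor_kronecker] at h
  -- The code has produced a state of dimension `M * ⌈1 / ζ⌉₊ ≥ m / ζ`, so local compression costs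
  -- at most `2ζ`.
  obtain ⟨V, hV, hVe⟩ := exists_compression hm (hmM.trans (Nat.le_mul_of_pos_right M hq))
  have h' := (h.local hT (isHermitian_maxEnt _) (isHermitian_maxEnt m) hV hV hVe).reindex_keys
    (finProdFinEquiv (m := L) (n := 1)).symm
  refine h'.mono ?_
  have hM : (0 : ℝ) < M := by exact_mod_cast hm.trans hmM
  have hmM' : (m : ℝ) ≤ M := by exact_mod_cast hmM
  have hq' : (0 : ℝ) < ⌈1 / ζ⌉₊ := by exact_mod_cast hq
  have : (m : ℝ) / ((M * ⌈1 / ζ⌉₊ : ℕ) : ℝ) ≤ ζ := by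
    rw [Nat.cast_mul, div_le_iff₀ (by positivity)]
    rw [div_le_iff₀ hζ] at hql
    nlinarith
  linarith

/-- Distillation through a covert code over a general channel. -/
lemma innerCode_of_noisy [DecidableEq B₁] [DecidableEq B₂] {T₁ : Op A₁ →ₗ[ℂ] Op B₁}
    {T₂ : Op A₂ →ₗ[ℂ] Op B₂} (hT₁ : IsChannel T₁) (hT₂ : IsChannel T₂) {ψ : Op (R × A₁)}
    (hψ : IsDensity ψ) {α : Op A₂} (hα : IsDensity α) {L K K' n m M : ℕ} (hL : 1 ≤ L)
    (hK' : 1 ≤ K') (hm : 1 ≤ m) (hmM : m ≤ M) {ζ : ℝ} (hζ : 0 < ζ) (hζ1 : ζ ≤ 1 / 16)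
    (hn : n = ⌈1 / ζ⌉₊) (hnK : n ^ 2 * K' ≤ K) (hKζ : (K : ℝ) - n ^ 2 * K' ≤ ζ * K)
    (h1 : OneWay (Fin L) (idTensor R T₁ ψ) (maxEnt M) ζ)
    (h2 : CovertCode (Fin L × Fin (n ^ 2)) (Fin K') T₂ (maxEnt 1) (T₂ α) ζ ζ) :
    InnerCode (Fin (L * K)) (mapTensor T₁ T₂) (maxEnt m) (mapTensor T₁ T₂ (trFst ψ ⊗ₖ α))
      (7 * ζ) ζ := by
  obtain ⟨hq, hql, -⟩ := ceil_inv_bounds hζ hζ1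
  rw [← hn] at hq hql
  have : NeZero L := ⟨by omega⟩
  have : NeZero (n ^ 2) := ⟨by positivity⟩
  have : NeZero K' := ⟨by omega⟩
  have hT := (hT₁.cp.mapTensor hT₂.cp).isChannel (hT₁.tp.mapTensor hT₂.tp)
  -- The shrinking protocol is appended to distillation before encryption, so its `n ^ 2` symbols
  -- are protected by the same one-time pad.
  have h1' := h1.comp (hψ.idTensor hT₁) (isHermitian_maxEnt M) (isHermitian_maxEnt m)
    (oneWay_maxEnt hq hm hmM)
  have h := h1'.innerCode_maxEnt hT₁ hT₂ hψ le_rfl (hT₂.isDensity hα).1.1 h2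
  rw [← mapTensor_kronecker, mul_one] at h
  have hcard : L * (n ^ 2 * K') ≤ L * K := Nat.mul_le_mul_left L hnK
  have hpad := h.pad (κ' := Fin (L * K - L * (n ^ 2 * K'))) hT (isDensity_maxEnt hm)
    (hψ.trFst.kronecker hα)
  have hkeys : Fintype.card (((Fin L × Fin (n ^ 2)) × Fin K') ⊕ Fin (L * K - L * (n ^ 2 * K'))) =
      Fintype.card (Fin (L * K)) := by
    simp only [Fintype.card_sum, Fintype.card_prod, Fintype.card_fin, mul_assoc]
    omega
  -- The error `7ζ`: distillation contributes `ζ`, and shrinking, the covert code and the padding of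
  -- the key contribute at most `2ζ` each.
  refine (hpad.reindex_keys (Fintype.equivOfCardEq hkeys).symm).mono ?_
  have hL' : (1 : ℝ) ≤ L := by exact_mod_cast hL
  have hK0 : (1 : ℝ) ≤ K := by
    exact_mod_cast (Nat.mul_pos (pow_pos hq 2) hK').trans_le hnK
  have hn' : (0 : ℝ) < n := by exact_mod_cast hq
  have e1 : (2 : ℝ) / n ≤ 2 * ζ := by
    rw [div_le_iff₀ hn']
    rw [div_le_iff₀ hζ] at hql
    linarith
  have e2 : (Fintype.card (Fin (L * K - L * (n ^ 2 * K'))) : ℝ) /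
      (Fintype.card ((Fin L × Fin (n ^ 2)) × Fin K') +
        Fintype.card (Fin (L * K - L * (n ^ 2 * K')))) ≤ ζ := by
    simp only [Fintype.card_prod, Fintype.card_fin, Nat.cast_sub hcard]
    push_cast
    rw [div_le_iff₀ (by ring_nf; positivity)]
    nlinarith
  linarith

lemma CovertCode.of_reindexL [DecidableEq A] [DecidableEq B] [DecidableEq Q] [DecidableEq Q']
    (f : A ≃ B) {Ψ : Op (Q × Q')} {ρ : Op B} {δ ζ : ℝ}
    (h : CovertCode C κ (LinearMap.id : Op B →ₗ[ℂ] Op B) Ψ ρ δ ζ) :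
    CovertCode C κ (reindexL f) Ψ ρ δ ζ := by
  obtain ⟨θ, Υ, hθ, hΥ, hΥt, hδ, hζ⟩ := h
  have h0 : reindexL f ∘ₗ reindexL f.symm = LinearMap.id := by ext X; simp
  refine ⟨fun x => idTensor Q (reindexL f.symm) (θ x), Υ, fun x =>
    (hθ x).idTensor (isChannel_reindexL _), hΥ, hΥt, ?_, ?_⟩
  · have h1 : ∀ x : C × κ, idTensor Q (Υ x.2 x.1 ∘ₗ reindexL f)
        (idTensor Q (reindexL f.symm) (θ x)) = idTensor Q (Υ x.2 x.1 ∘ₗ LinearMap.id) (θ x) :=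
      fun x => by
        change idTensor Q (Υ x.2 x.1 ∘ₗ (reindexL f ∘ₗ reindexL f.symm)) (θ x) = _
        rw [h0]
    simpa only [h1] using hδ
  · have h1 : ∀ x : C × κ, reindexL f (trFst (idTensor Q (reindexL f.symm) (θ x))) =
        trFst (θ x) := fun x => by
      rw [trFst_idTensor]
      exact LinearMap.congr_fun h0 (trFst (θ x))
    simpa only [h1, LinearMap.id_apply] using hζ

omit [Fintype B] in
lemma IsNoiseless.tensorPow [DecidableEq A] {N : Op A →ₗ[ℂ] Op B} (h : IsNoiseless N) (n : ℕ) :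
    ∃ f : (Fin n → A) ≃ (Fin n → B), QStego.tensorPow N n = reindexL f := by
  classical
  obtain ⟨e, he⟩ := h
  refine ⟨Equiv.piCongrRight fun _ => e, op_ext fun a a' => ?_⟩
  ext b b'
  rw [tensorPow_single, reindexL_apply]
  simp only [he, Matrix.reindex_apply, Matrix.submatrix_apply, Matrix.single_apply]
  rw [Finset.prod_ite_zero]
  simp [funext_iff, forall_and]

end Combination

/-! ### From the entropic conditions to inner codes, and the final error estimates -/

section Rates

variable {A B : Type*} [Fintype A] [Fintype B] [DecidableEq B] {m : ℕ}

/-- Covert codes over general channels, with the rate and key conditions in entropic form. -/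
lemma exists_noisy_covertCode_of_rates {T : Op A →ₗ[ℂ] Op B} (hT : IsChannel T) {P : Fin m → ℝ}
    (hP : ∀ x, 0 ≤ P x) (hP1 : ∑ x, P x = 1) {τ : Fin m → Op A} (hτ : ∀ x, IsDensity (τ x))
    {ζ : ℝ} (hζ : 0 < ζ) (hζ1 : ζ ≤ 1 / 16) {L K n : ℕ} (hL : 1 ≤ L) (hK : 1 ≤ K)
    (hn : n = ⌈1 / ζ⌉₊)
    (hbits : ((Real.logb 2 L : ℝ) : EReal) ≤ noisyBits P (fun x => T (τ x)) ζ)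
    (hkey : noisyKeyBits P (fun x => T (τ x)) ζ ζ ≤ ((Real.logb 2 K : ℝ) : EReal)) :
    ∃ K' : ℕ, 1 ≤ K' ∧ n ^ 2 * K' ≤ K ∧ (K : ℝ) - n ^ 2 * K' ≤ ζ * K ∧
      CovertCode (Fin L × Fin (n ^ 2)) (Fin K') T (maxEnt 1)
        (trFst (cqState P fun x => T (τ x))) ζ ζ := by
  set σ : Fin m → Op B := fun x => T (τ x) with hσdef
  have hσ : ∀ x, IsDensity (σ x) := fun x => hT.isDensity (hτ x)
  have hρ : IsDensity (trFst (cqState P σ)) := by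
    rw [trFst_cqState]
    exact isDensity_sum hP hP1 hσ
  have : Nonempty B := hρ.nonempty
  obtain ⟨R, hR, ⟨a, ha, hpa⟩, a', ha', hca⟩ :=
    exists_multiplicity ⟨-1, by simp⟩ hL hK hbits hkey
  have hL' : (0 : ℝ) < L := by exact_mod_cast hL
  have hK' : (0 : ℝ) < K := by exact_mod_cast hK
  have hR' : (0 : ℝ) < R := by exact_mod_cast hR
  have hν : (0 : ℝ) < numEig (trFst (cqState P σ)) := by exact_mod_cast one_le_numEig hρ.1.1
  have ha'0 : a' < 0 := ha'
  refine exists_noisy_covertCode hT hP hP1 hτ (fun _ => rfl) (trFst_cqState P σ) hζ hζ1 hL hK hR hn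
    ha (s := -a') (by linarith) ?_ ?_
  · refine packing_condition ha.1 ?_ (by positivity) hζ
      (logb_natCast_nonneg (numEig (prodMarginals (cqState P σ)))) hpa
    rw [trace_mutualInfoH hP hσ]
    refine Finset.sum_nonneg fun x _ => mul_nonneg (hP x) ?_
    have hY := (posSemidef_rpow (isDensity_sum hP hP1 hσ).1 (a / 2)).1
    have h := (posSemidef_rpow (hσ x).1 (-a)).mul_mul_conjTranspose_same
      (rpow (∑ x, (P x : ℂ) • σ x) (a / 2))
    rw [hY.eq] at h
    have h2 := re_trace_mul_nonneg (hσ x).1 h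
    simpa only [Matrix.mul_assoc] using h2
  · refine covering_condition (by linarith) ?_ (by positivity) hζ hν ?_
    · exact Finset.sum_nonneg fun x _ => mul_nonneg (hP x)
        (re_trace_mul_nonneg (posSemidef_rpow (hσ x).1 _) (posSemidef_rpow hρ.1 _))
    · rw [mutualInfoR] at hca
      rw [neg_neg, ← sub_eq_add_neg, show 1 / -a' = -(1 / a') by rw [one_div_neg_eq_neg_one_div],
        show 2 + 2 / -a' = 2 - 2 / a' by rw [div_neg, sub_eq_add_neg]]
      exact hca

/-- Both kinds of covert codes, combined with distillation. -/
lemma IsCovertSize.innerCode [DecidableEq A] {N : Op A →ₗ[ℂ] Op B} {𝓜 : Op A →ₗ[ℂ] Op A}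
    (hN : IsChannel N) (h𝓜 : IsChannel 𝓜) {n M : ℕ} {f : Fin M → Op (Fin n → A)}
    (hf : ∀ w, IsDensity (f w)) {ζ : ℝ} (hζ : 0 < ζ) (hζ1 : ζ ≤ 1 / 16) {L K : ℕ}
    (h : IsCovertSize N 𝓜 n M f ζ L K) {R A₁ B₁ : Type*} [Fintype R] [Fintype A₁] [Fintype B₁]
    [DecidableEq B₁] {T₁ : Op A₁ →ₗ[ℂ] Op B₁} (hT₁ : IsChannel T₁) {ψ : Op (R × A₁)}
    (hψ : IsDensity ψ) {k k' : ℕ} (hk : 1 ≤ k) (hkk' : k ≤ k')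
    (h1 : OneWay (Fin L) (idTensor R T₁ ψ) (maxEnt k') ζ) (w : Fin M) :
    InnerCode (Fin (L * K)) (mapTensor T₁ (tensorPow N n)) (maxEnt k)
      (mapTensor T₁ (tensorPow N n) (trFst ψ ⊗ₖ tensorPow 𝓜 n (f w))) (7 * ζ) ζ := by
  obtain ⟨hL, hK, ⟨hno, rfl, hbits⟩ | ⟨m, P, τ, hP, hP1, hτ, hav, hbits, hkey⟩⟩ := h
  · obtain ⟨e, he⟩ := hno.tensorPow n
    have hα := (h𝓜.tensorPow n).isDensity (hf w)
    have h2 := (exists_noiseless_covertCode hL ((hN.tensorPow n).isDensity hα) hζ hζ1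
      (hbits w)).of_reindexL e
    rw [← he] at h2
    exact innerCode_of_noiseless hT₁ (hN.tensorPow n) hψ hα hL hk hkk' hζ hζ1 h1 h2
  · obtain ⟨K', hK', hnK, hKζ, h2⟩ := exists_noisy_covertCode_of_rates (hN.tensorPow n) (hP w)
      (hP1 w) (hτ w) hζ hζ1 hL hK rfl (hbits w) (hkey w)
    rw [hav w] at h2
    exact innerCode_of_noisy hT₁ (hN.tensorPow n) hψ ((h𝓜.tensorPow n).isDensity (hf w)) hL hK' hk
      hkk' hζ hζ1 rfl hnK hKζ h1 h2

-- Approximating the supremum from below by `M - 1` covers the value `⊤` as well. The code obtained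
-- may be larger than `M`, which is why states have to be shrunk.
omit [Fintype A] [DecidableEq B] in
lemma exists_isEDCode_of_le_distillable {R : Type*} [Fintype R] {ρ : Op (R × B)} {L M : ℕ} {ζ : ℝ}
    (hM : 1 ≤ M) (h : (M : ℕ∞) ≤ distillable ρ L ζ) :
    ∃ M', M ≤ M' ∧ ∃ E D, IsEDCode M' L ρ ζ E D := by
  have hlt : ((M - 1 : ℕ) : ℕ∞) < distillable ρ L ζ :=
    lt_of_lt_of_le (by exact_mod_cast Nat.sub_lt hM one_pos) h
  obtain ⟨_, ⟨M', rfl, hcode⟩, hM'⟩ := lt_sSup_iff.mp hlt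
  have h2 : M - 1 < M' := by exact_mod_cast hM'
  exact ⟨M', by omega, hcode⟩

omit [Fintype B] [DecidableEq B] in
lemma appendTensor_output [DecidableEq A] (N : Op A →ₗ[ℂ] Op B) (𝓜 : Op A →ₗ[ℂ] Op A) {n₁ n₂ : ℕ}
    (f₁ : Op (Fin n₁ → A)) (f₂ : Op (Fin n₂ → A)) :
    tensorPow N (n₁ + n₂) (tensorPow 𝓜 (n₁ + n₂) (appendTensor f₁ f₂)) =
      reindexL (splitEquiv B n₁ n₂) (mapTensor (tensorPow N n₁) (tensorPow N n₂)
        (tensorPow 𝓜 n₁ f₁ ⊗ₖ tensorPow 𝓜 n₂ f₂)) := by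
  have h1 := LinearMap.congr_fun (tensorPow_split 𝓜 n₁ n₂) (f₁ ⊗ₖ f₂)
  have h2 := LinearMap.congr_fun (tensorPow_split N n₁ n₂)
    (tensorPow 𝓜 n₁ f₁ ⊗ₖ tensorPow 𝓜 n₂ f₂)
  simp only [LinearMap.comp_apply] at h1 h2
  rw [appendTensor_eq, h1, mapTensor_kronecker, h2]

/-- With `u = ε + ζ` the construction has error `2√u + u + 7ζ`. The last root of the claimed bound
is of order at least `u^{1/4}` and absorbs the excess `u + 5ζ`. -/
lemma stego_error_le {u ζ : ℝ} (hζ : 0 < ζ) (hζ1 : ζ ≤ 1 / 16) (hζu : ζ ≤ u) (hu : u ≤ 1) :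
    u + 5 * ζ ≤ 2 * √(ζ + 2 * √u) := by
  have hu0 : 0 ≤ u := hζ.le.trans hζu
  obtain ⟨x, hx0, hx⟩ : ∃ x, 0 ≤ x ∧ u = x ^ 2 := ⟨√u, Real.sqrt_nonneg _, (Real.sq_sqrt hu0).symm⟩
  have hx1 : x ≤ 1 := by nlinarith
  rw [hx, Real.sqrt_sq hx0]
  rw [hx] at hζu
  have h : (x ^ 2 + 5 * ζ) / 2 ≤ √(ζ + 2 * x) := by
    refine Real.le_sqrt_of_sq_le ?_
    have hx2 : x ^ 2 ≤ x := by nlinarith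
    have h4 : x ^ 2 * x ^ 2 ≤ x := by nlinarith
    have h5 : x ^ 2 * ζ ≤ x * (1 / 16) := by nlinarith
    have h6 : ζ * ζ ≤ x * (1 / 16) := by nlinarith
    nlinarith
  linarith

/-- The reason for the threshold `1/16`: above it the claimed error is trivial, since `√(1/16 +
2·1/4) = 3/4`. -/
lemma two_le_of_sixteenth_le {u ζ : ℝ} (hζ : 1 / 16 ≤ ζ) (hu : ζ ≤ u) :
    2 ≤ 2 * ζ + 2 * √u + 2 * √(ζ + 2 * √u) := by
  have h1 : 1 / 4 ≤ √u := Real.le_sqrt_of_sq_le (by linarith)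
  have h2 : 3 / 4 ≤ √(ζ + 2 * √u) := Real.le_sqrt_of_sq_le (by linarith)
  linarith

lemma IsCCCode.error_nonneg {T : Op A →ₗ[ℂ] Op B} (hT : IsChannel T) {M : ℕ} (hM : 1 ≤ M)
    {f : Fin M → Op A} {Λ : Fin M → Op B} {ε : ℝ} (h : IsCCCode T M f Λ ε) : 0 ≤ ε := by
  have hM0 : (0 : ℝ) < M := by exact_mod_cast hM
  have h1 : ∀ w, (Λ w * T (f w)).trace.re ≤ 1 := fun w => by
    have hle : (1 - Λ w).PosSemidef := by
      rw [← h.povm_sum, ← Finset.add_sum_erase _ _ (Finset.mem_univ w), add_sub_cancel_left]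
      exact Matrix.posSemidef_sum _ fun v _ => h.povm_nonneg v
    have hd := hT.isDensity (h.density w)
    have := re_trace_mul_le_of_effect hle hd.1
    rwa [hd.2, Complex.one_re] at this
  have h2 : (1 / (M : ℝ)) * ∑ w, (Λ w * T (f w)).trace.re ≤ 1 := by
    refine (mul_le_mul_of_nonneg_left (Finset.sum_le_sum fun w _ => h1 w)
      (by positivity)).trans_eq ?_
    simp [hM0.ne']
  linarith [h.success]

end Rates

end QStego

end

/-! ### Assembly of the stego code -/

open QStego in
theorem theorem2 {A B R : Type*} [Fintype A] [DecidableEq A] [Fintype B] [DecidableEq B]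
    [Fintype R]
    (N : QStego.Op A →ₗ[ℂ] QStego.Op B) (𝓜 : QStego.Op A →ₗ[ℂ] QStego.Op A)
    (hN : QStego.IsChannel N) (h𝓜 : QStego.IsChannel 𝓜)
    (n₁ n₂ M : ℕ) (hM : 1 ≤ M) (ε : ℝ)
    -- the cover code for `N^{⊗n} ∘ 𝓜^{⊗n}`, with `n = n₁ + n₂`
    (f : Fin M → QStego.Op (Fin (n₁ + n₂) → A)) (Λ : Fin M → QStego.Op (Fin (n₁ + n₂) → B))
    (hcover : QStego.IsCCCode
      (QStego.tensorPow N (n₁ + n₂) ∘ₗ QStego.tensorPow 𝓜 (n₁ + n₂)) M f Λ ε)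
    -- its codewords split into two blocks
    (f₁ : Fin M → QStego.Op (Fin n₁ → A)) (f₂ : Fin M → QStego.Op (Fin n₂ → A))
    (hf₁ : ∀ w, QStego.IsDensity (f₁ w)) (hf₂ : ∀ w, QStego.IsDensity (f₂ w))
    (hf : ∀ w, f w = QStego.appendTensor (f₁ w) (f₂ w))
    -- purifications of the first blocks after `𝓜`
    (φ : Fin M → R × (Fin n₁ → A) → ℂ)
    (hφ : ∀ w, QStego.trFst (QStego.ketbra (φ w)) = QStego.tensorPow 𝓜 n₁ (f₁ w))
    (ζ : ℝ) (hζ : 0 < ζ)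
    -- numbers of messages and key values of the covert classical protocol on the second block
    (L K : ℕ) (hLK : QStego.IsCovertSize N 𝓜 n₂ M f₂ ζ L K)
    (M' : ℕ) (hM' : 1 ≤ M')
    (hrate : ∀ w, (M' : ℕ∞) ≤
      QStego.distillable (QStego.idTensor R (QStego.tensorPow N n₁) (QStego.ketbra (φ w))) L ζ) :
    -- a stego code over the true channel `N^{⊗n}`, with a key of `log L + log K` bits
    ∃ (g : Fin (L * K) → Fin M → QStego.Op (Fin M' × (Fin (n₁ + n₂) → A)))
      (D : Fin (L * K) → QStego.Op (Fin (n₁ + n₂) → B) →ₗ[ℂ] QStego.Op (Fin M × Fin M')),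
      QStego.IsCCESCode (QStego.tensorPow N (n₁ + n₂)) (L * K) M M' g D
        (2 * ζ + 2 * √(ε + ζ) + 2 * √(ζ + 2 * √(ε + ζ))) ∧
      QStego.traceNorm
        (QStego.ccesOutput (QStego.tensorPow N (n₁ + n₂)) (L * K) M M' g -
          QStego.ccOutput (QStego.tensorPow N (n₁ + n₂) ∘ₗ QStego.tensorPow 𝓜 (n₁ + n₂)) M f)
        ≤ ζ := by
  classical
  have hn : IsChannel (tensorPow N (n₁ + n₂)) := hN.tensorPow _
  have h𝓜n : IsChannel (tensorPow 𝓜 (n₁ + n₂)) := h𝓜.tensorPow _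
  have hε : 0 ≤ ε := hcover.error_nonneg (hn.comp h𝓜n) hM
  have hS : 1 ≤ L * K := Nat.mul_pos hLK.1 hLK.2.1
  have hα : ∀ w, IsDensity (tensorPow 𝓜 (n₁ + n₂) (f w)) := fun w =>
    h𝓜n.isDensity (hcover.density w)
  -- An error of `2` is no constraint, and then the output can equal the cover output exactly. The
  -- other case forces `ζ ≤ 1/16` and `ε + ζ ≤ 1`.
  rcases le_or_gt 2 (2 * ζ + 2 * √(ε + ζ) + 2 * √(ζ + 2 * √(ε + ζ))) with hE | hE
  · obtain ⟨g, D, hcode, hout⟩ := exists_isCCESCode_of_two_le hn hS hM hM' hα hE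
    refine ⟨g, D, hcode, ?_⟩
    rw [hout, ccOutput]
    exact (traceNorm_sub_self_le rfl).trans hζ.le
  have hζ1 : ζ ≤ 1 / 16 := by
    by_contra h
    linarith [two_le_of_sixteenth_le (not_le.mp h).le (show ζ ≤ ε + ζ by linarith)]
  have hu : ε + ζ ≤ 1 := by
    by_contra h
    have h1 : 1 ≤ √(ε + ζ) := Real.le_sqrt_of_sq_le (by linarith)
    linarith [Real.sqrt_nonneg (ζ + 2 * √(ε + ζ))]
  have hcode : ∀ w, InnerCode (Fin (L * K)) (tensorPow N (n₁ + n₂)) (maxEnt M')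
      (tensorPow N (n₁ + n₂) (tensorPow 𝓜 (n₁ + n₂) (f w))) (7 * ζ) ζ := fun w => by
    have hψ : IsDensity (ketbra (φ w)) := by
      refine ⟨Matrix.posSemidef_vecMulVec_self_star _, ?_⟩
      rw [← trace_trFst, hφ w]
      exact ((h𝓜.tensorPow n₁).isDensity (hf₁ w)).2
    obtain ⟨M'', hle, E, D, hED⟩ := exists_isEDCode_of_le_distillable hM' (hrate w)
    have h := IsCovertSize.innerCode hN h𝓜 hf₂ hζ hζ1 hLK (hN.tensorPow n₁) hψ hM' hle
      hED.oneWay w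
    have hT := ((hN.tensorPow n₁).cp.mapTensor (hN.tensorPow n₂).cp).isChannel
      ((hN.tensorPow n₁).tp.mapTensor (hN.tensorPow n₂).tp)
    have hd := hT.isDensity (((h𝓜.tensorPow n₁).isDensity (hf₁ w)).kronecker
      ((h𝓜.tensorPow n₂).isDensity (hf₂ w)))
    -- The purification property enters here: the marginal fed into the first block is the one
    -- expected by the warden.
    rw [hφ w] at h
    have h' := h.reindex hT hd.1.1 (splitEquiv A n₁ n₂) (splitEquiv B n₁ n₂)
      (tensorPow_split N n₁ n₂)
    rwa [← appendTensor_output, ← hf w] at h'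
  exact exists_isCCESCode hn hS hM hcover.povm_nonneg hcover.povm_sum
    (fun w => (hn.isDensity (hα w)).1.1) hcover.success hcode
    (by linarith [stego_error_le hζ hζ1 (show ζ ≤ ε + ζ by linarith) hu])
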